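/- **Setting.** For each sample size $n$ let $Y_i=X_i\beta+e_i$, $X_i=\Pi_i+V_i$ ($i=1,\dots,n$), $\mathbb E e_i=\mathbb E V_i=0$, with a fixed $n\times K$ instrument matrix $Z$ of full column rank, $K=K_n\to\infty$, $P=Z(Z^\top Z)^{-1}Z^\top$; all quantities may depend on $n$. The value $\beta_0$ is tested; $\Delta=\beta-\beta_0$, $e_i(\beta_0)=Y_i-X_i\beta_0$, $Q_{a,b}=K^{-1/2}\sum_i\sum_{j\ne i}a_iP_{ij}b_j$, $\mathcal C=Q_{\Pi,\Pi}$. Let $\mathcal Z(\mu)\sim\mathcal N(\mu,1)$, $\alpha\in(0,1)$, $\overline a\in(0,1)$, $\mathbb A_0=\{(a_1,a_2)\in[0,1]^2:a_1+a_2\le\overline a\}$. Let $\mathbb C_\alpha(a_1,a_2;\rho)$ be the $1-\alpha$ quantile of $a_1\mathcal Z_1^2+a_2(\rho\mathcal Z_1+(1-\rho^2)^{1/2}\mathcal Z_2)^2+(1-a_1-a_2)\mathcal Z_2^2$ for independent standard normal $\mathcal Z_1,\mathcal Z_2$; $\mathbb C_\alpha$ that of $\mathcal Z^2$; $\mathbb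 C_{\alpha,\max}(\rho)=\sup_{\mathbb A_0}\mathbb C_\alpha(\cdot;\rho)$. **Assumptions.** 1. $(Q_{e,e},Q_{X,e},Q_{X,X}-\mathcal C)$ converges in distribution to $\mathcal N(0,\Sigma)$ with $\Sigma=\begin{pmatrix}\Phi_1&\Phi_{12}&\Phi_{13}\\\Phi_{12}&\Psi&\tau\\\Phi_{13}&\tau&\Upsilon\end{pmatrix}$ positive definite. Put $\rho=\Phi_{12}/\sqrt{\Phi_1\Psi}$. 2. Let $\gamma(\beta_0)=(\Phi_1(\beta_0),\Phi_{12}(\beta_0),\Phi_{13}(\beta_0),\Psi(\beta_0),\tau(\beta_0),\Upsilon,\rho(\beta_0))$, where $\Phi_1(\beta_0)=\Delta^4\Upsilon+4\Delta^3\tau+\Delta^2(4\Psi+2\Phi_{13})+4\Delta\Phi_{12}+\Phi_1$, $\Phi_{12}(\beta_0)=\Delta^3\Upsilon+3\Delta^2\tau+\Delta(2\Psi+\Phi_{13})+\Phi_{12}$, $\Phi_{13}(\beta_0)=\Delta^2\Upsilon+2\Delta\tau+\Phi_{13}$, $\Psi(\beta_0)=\Delta^2\Upsilon+2\Delta\tau+\Psi$,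 $\tau(\beta_0)=\Delta\Upsilon+\tau$, $\rho(\beta_0)=\Phi_{12}(\beta_0)/\sqrt{\Phi_1(\beta_0)\Psi(\beta_0)}$. The estimator $\widehat\gamma=(\widehat\Phi_1,\widehat\Phi_{12},\widehat\Phi_{13},\widehat\Psi,\widehat\tau,\widehat\Upsilon,\widehat\rho)$ satisfies $\|\widehat\gamma-\gamma(\beta_0)\|_2\to0$ in probability. 3. The parameter space $\mathcal B\subset\mathbb R$ is compact, and for some $r>0$ it contains, for each $n$, $[\beta_0,\beta_0+r]$ or $[\beta_0-r,\beta_0]$ (e.g. $\mathcal B$ a compact interval of positive length containing $\beta_0$). 4. (Strong identification, local alternatives) For all large $n$, $\mathcal C=\widetilde{\mathcal C}/d_n$ and $\Delta=\widetilde\Delta d_n$ with constants $\widetilde{\mathcal C}\ne0$, $\widetilde\Delta$ and deterministic $d_n\neq 0$, $d_n\to0$. **The test.** Let $AR=Q_{e(\beta_0),e(\beta_0)}/\widehat\Phi_1^{1/2}$, $LM=Q_{X,e(\beta_0)}/\widehat\Psi^{1/2}$, $LM^*=(1-\widehat\rho^2)^{-1/2}(LM-\widehat\rho AR)$, $\widehat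 k=\begin{pmatrix}\widehat\Phi_1&\widehat\Phi_{12}\\\widehat\Phi_{12}&\widehat\Psi\end{pmatrix}^{-1}\begin{pmatrix}\widehat\Phi_{13}\\\widehat\tau\end{pmatrix}$, $\widehat D=Q_{X,X}-(Q_{e(\beta_0),e(\beta_0)},Q_{X,e(\beta_0)})\widehat k$, $\widehat\sigma_D^2=\widehat\Upsilon-(\widehat\Phi_{13},\widehat\tau)\widehat k$, $\widehat r=\widehat D^2/\widehat\sigma_D^2$, $\widehat r_{pp}=\max(\widehat r-1,0)$, $\widehat r_{krs}=\widehat r-1+e^{-\widehat r/2}\big(\sum_{j\ge0}(-\widehat r/2)^j\frac1{j!(1+2j)}\big)^{-1}$, $f_s=\widehat\sigma_D\sqrt{\widehat r_s}$ for $s\in\{pp,krs\}$. Let $\mathcal D=\{\delta:\delta+\beta_0\in\mathcal B\}$, $\widehat b(\delta)=1-(\delta^2,\delta)\widehat k$, $\widehat C_1(\delta)=\widehat\Phi_1^{-1/2}\delta^2/\widehat b(\delta)$, $\widehat C_2(\delta)=(1-\widehat\rho^2)^{-1/2}(\widehat\Psi^{-1/2}\delta-\widehat\rho\,\widehat\Phi_1^{-1/2}\delta^2)/\widehat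 b(\delta)$, $\widehat c_{\mathcal B}=\sup_{\delta\in\mathcal D}\widehat b(\delta)^2$, $\widehat\Delta_*=\widehat\Phi_1^{1/2}\widehat\Psi^{-1/2}\widehat\rho^{-1}$, $\underline a=\min\big(0.01,\,1.1\,\mathbb C_{\alpha,\max}(\widehat\rho)\widehat\Phi_1\widehat c_{\mathcal B}/(\widehat\Delta_*^4f_s^2)\big)$ (quotient $+\infty$ if $f_s=0$, and $0$ if $\widehat\rho=0\ne f_s$), $\mathbb A=\{(a_1,a_2)\in\mathbb A_0:\underline a\le a_1\le\overline a\}$. For $a\in\mathbb A$ let $p_a(\delta)$ be the probability, with the data held fixed and $\mathcal Z_1,\mathcal Z_2$ independent with means $\widehat C_1(\delta)f_s$, $\widehat C_2(\delta)f_s$ and unit variances, that $a_1\mathcal Z_1^2+a_2(\widehat\rho\mathcal Z_1+(1-\widehat\rho^2)^{1/2}\mathcal Z_2)^2+(1-a_1-a_2)\mathcal Z_2^2\ge\mathbb C_\alpha(a_1,a_2;\widehat\rho)$. The weights $\mathcal A_s=(\mathcal A_{1,s},\mathcal A_{2,s})$ are a (measurable) minimizer over $a\in\mathbb A$ of $\sup_{\delta\in\mathcal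 D}\big(\sup_{a'\in\mathbb A}p_{a'}(\delta)-p_a(\delta)\big)$ (arbitrary if $\mathbb A=\emptyset$), and the CLC test is $$\widehat\phi_{\mathcal A_s}=1\{\mathcal A_{1,s}AR^2+\mathcal A_{2,s}LM^2+(1-\mathcal A_{1,s}-\mathcal A_{2,s})LM^{*2}\ge\mathbb C_\alpha(\mathcal A_s;\widehat\rho)\}.$$ **Classes of tests.** Let $(\mathcal N_1,\mathcal N_2)$ be bivariate normal with mean $(0,\theta)$, unit variances and correlation $\rho$, and $\mathcal N_2^*=(1-\rho^2)^{-1/2}(\mathcal N_2-\rho\mathcal N_1)$. $\Phi^I_\alpha$ (resp. $\Phi^U_\alpha$) is the set of measurable $\phi:\mathbb R^2\to[0,1]$, whose discontinuities have zero Lebesgue measure, with $\mathbb E\phi(\mathcal N_1,\mathcal N_2)\le\alpha$ if $\theta=0$, and which are invariant under the sign change $\mathcal N_2^*\mapsto-\mathcal N_2^*$ with $\mathcal N_1$ fixed, i.e. $\phi(x,y)=\phi(x,2\rho x-y)$ (resp. are unbiased: $\mathbb E\phi(\mathcal N_1,\mathcal N_2)\ge\alpha$ for all $\theta\ne0$).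 **Theorem.** Under Assumptions 1–4, for $s\in\{pp,krs\}$, $$\mathcal A_{1,s}\xrightarrow{p}0,\qquad \mathcal A_{2,s}\,\rho\xrightarrow{p}0,\qquad \widehat\phi_{\mathcal A_s}\rightsquigarrow1\{\mathcal N_2^{*2}\ge\mathbb C_\alpha\},\quad \mathcal N_2^*\sim\mathcal N\Big(\tfrac{\widetilde\Delta\widetilde{\mathcal C}}{[(1-\rho^2)\Psi]^{1/2}},1\Big).$$ Moreover $\lim_n\mathbb E\phi(AR,LM)$ exists for each $\phi\in\Phi^I_\alpha\cup\Phi^U_\alpha$, $\lim_n\mathbb E\widehat\phi_{\mathcal A_s}$ exists, and $$\lim_n\mathbb E\widehat\phi_{\mathcal A_s}=\sup_{\phi\in\Phi^I_\alpha\cup\Phi^U_\alpha}\lim_n\mathbb E\phi(AR,LM)\ \ge\ \lim_n\mathbb E\breve\phi_n$$ for every uniformly integrable sequence $(\breve\phi_n)$ with $\breve\phi_n=\phi(AR,LM)+o_P(1)$ for some $\phi\in\Phi^I_\alpha\cup\Phi^U_\alpha$ (the last limit exists). -/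

import Mathlib

open MeasureTheory ProbabilityTheory Filter Topology
open scoped Matrix ENNReal

noncomputable section

namespace JackknifeCLC

/-! ### The linear IV model with many instruments -/

/-- A triangular array of linear IV models on a probability space `(Ω, P)`: the row of sample size
`n` has fixed instruments `Z n` (of full column rank), first stage means `Pi n i`, errors
`e n i`, `V n i` with mean zero, a true parameter `β n` and a tested value `β₀ n`; the number
`K n` of instruments diverges. Nothing is assumed on the dependence or the homogeneity of the
errors. -/
structure IVArray (Ω : Type*) [MeasurableSpace Ω] (P : Measure Ω) where
  K : ℕ → ℕ
  Z : ∀ n, Matrix (Fin n) (Fin (K n)) ℝ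
  Pi : ∀ n, Fin n → ℝ
  β : ℕ → ℝ
  β₀ : ℕ → ℝ
  e : ∀ n, Fin n → Ω → ℝ
  V : ∀ n, Fin n → Ω → ℝ
  tendsto_K : Tendsto K atTop atTop
  isUnit_gram : ∀ n, IsUnit ((Z n)ᵀ * Z n).det
  integrable_e : ∀ n i, Integrable (e n i) P
  integrable_V : ∀ n i, Integrable (V n i) P
  mean_e : ∀ n i, ∫ ω, e n i ω ∂P = 0
  mean_V : ∀ n i, ∫ ω, V n i ω ∂P = 0

namespace IVArray

variable {Ω : Type*} [MeasurableSpace Ω] {P : Measure Ω} (M : IVArray Ω P)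

/-- The endogenous variable `X_i = Π_i + V_i`. -/
def X (n : ℕ) (i : Fin n) (ω : Ω) : ℝ := M.Pi n i + M.V n i ω

/-- The outcome `Y_i = X_i β + e_i`. -/
def Y (n : ℕ) (i : Fin n) (ω : Ω) : ℝ := M.X n i ω * M.β n + M.e n i ω

/-- The residual `e_i(β₀) = Y_i - X_i β₀` at the tested value. -/
def e₀ (n : ℕ) (i : Fin n) (ω : Ω) : ℝ := M.Y n i ω - M.X n i ω * M.β₀ n

/-- `Δ = β - β₀`. -/
def Δ (n : ℕ) : ℝ := M.β n - M.β₀ n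

/-- The projection matrix `Z (Zᵀ Z)⁻¹ Zᵀ`. -/
def proj (n : ℕ) : Matrix (Fin n) (Fin n) ℝ := M.Z n * ((M.Z n)ᵀ * M.Z n)⁻¹ * (M.Z n)ᵀ

/-- `Q_{a,b} = K^{-1/2} ∑_i ∑_{j ≠ i} a_i P_{ij} b_j`. -/
def Q (n : ℕ) (a b : Fin n → ℝ) : ℝ :=
  (∑ i, ∑ j ∈ Finset.univ.erase i, a i * M.proj n i j * b j) / √(M.K n : ℝ)

/-- The concentration parameter `𝒞 = Q_{Π,Π}`. -/
def conc (n : ℕ) : ℝ := M.Q n (M.Pi n) (M.Pi n)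

def Qee (n : ℕ) (ω : Ω) : ℝ := M.Q n (fun i => M.e n i ω) (fun i => M.e n i ω)
def QXe (n : ℕ) (ω : Ω) : ℝ := M.Q n (fun i => M.X n i ω) (fun i => M.e n i ω)
def QXX (n : ℕ) (ω : Ω) : ℝ := M.Q n (fun i => M.X n i ω) (fun i => M.X n i ω)
def Qee₀ (n : ℕ) (ω : Ω) : ℝ := M.Q n (fun i => M.e₀ n i ω) (fun i => M.e₀ n i ω)
def QXe₀ (n : ℕ) (ω : Ω) : ℝ := M.Q n (fun i => M.X n i ω) (fun i => M.e₀ n i ω)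

end IVArray

/-! ### Variance components -/

/-- The entries of the limiting covariance matrix of `(Q_{e,e}, Q_{X,e}, Q_{X,X} - 𝒞)`. -/
structure LimitCov where
  Φ₁ : ℝ
  Φ₁₂ : ℝ
  Φ₁₃ : ℝ
  Ψ : ℝ
  τ : ℝ
  Υ : ℝ

/-- The limiting covariance matrix. -/
def LimitCov.mat (S : LimitCov) : Matrix (Fin 3) (Fin 3) ℝ :=
  !![S.Φ₁, S.Φ₁₂, S.Φ₁₃; S.Φ₁₂, S.Ψ, S.τ; S.Φ₁₃, S.τ, S.Υ]

/-- `ρ = Φ₁₂ / (Φ₁ Ψ)^{1/2}`. -/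
def LimitCov.ρ (S : LimitCov) : ℝ := S.Φ₁₂ / √(S.Φ₁ * S.Ψ)

/-- A vector `(Φ₁, Φ₁₂, Φ₁₃, Ψ, τ, Υ, ρ)`: a value of `γ(β₀)` or of its estimator. -/
structure VarComp where
  Φ₁ : ℝ
  Φ₁₂ : ℝ
  Φ₁₃ : ℝ
  Ψ : ℝ
  τ : ℝ
  Υ : ℝ
  ρ : ℝ

/-- The components as a vector of Euclidean space. -/
def VarComp.toVec (g : VarComp) : EuclideanSpace ℝ (Fin 7) :=
  !₂[g.Φ₁, g.Φ₁₂, g.Φ₁₃, g.Ψ, g.τ, g.Υ, g.ρ]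

/-- `(Φ₁(β₀), Φ₁₂(β₀), Φ₁₃(β₀), Ψ(β₀), τ(β₀), Υ)` as a function of `Δ = β - β₀`. -/
def LimitCov.shift (S : LimitCov) (Δ : ℝ) : LimitCov where
  Φ₁ := Δ ^ 4 * S.Υ + 4 * Δ ^ 3 * S.τ + Δ ^ 2 * (4 * S.Ψ + 2 * S.Φ₁₃) + 4 * Δ * S.Φ₁₂ + S.Φ₁
  Φ₁₂ := Δ ^ 3 * S.Υ + 3 * Δ ^ 2 * S.τ + Δ * (2 * S.Ψ + S.Φ₁₃) + S.Φ₁₂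
  Φ₁₃ := Δ ^ 2 * S.Υ + 2 * Δ * S.τ + S.Φ₁₃
  Ψ := Δ ^ 2 * S.Υ + 2 * Δ * S.τ + S.Ψ
  τ := Δ * S.Υ + S.τ
  Υ := S.Υ

/-- `γ(β₀)` as a function of `Δ = β - β₀`. -/
def LimitCov.gamma (S : LimitCov) (Δ : ℝ) : VarComp where
  Φ₁ := (S.shift Δ).Φ₁
  Φ₁₂ := (S.shift Δ).Φ₁₂
  Φ₁₃ := (S.shift Δ).Φ₁₃
  Ψ := (S.shift Δ).Ψ
  τ := (S.shift Δ).τ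
  Υ := (S.shift Δ).Υ
  ρ := (S.shift Δ).ρ

namespace VarComp

variable (g : VarComp)

/-- The projection coefficients `[Φ₁, Φ₁₂; Φ₁₂, Ψ]⁻¹ (Φ₁₃, τ)ᵀ`. -/
def coef : Fin 2 → ℝ := !![g.Φ₁, g.Φ₁₂; g.Φ₁₂, g.Ψ]⁻¹ *ᵥ ![g.Φ₁₃, g.τ]

/-- `1 - (δ², δ) [Φ₁, Φ₁₂; Φ₁₂, Ψ]⁻¹ (Φ₁₃, τ)ᵀ`. -/
def bracket (δ : ℝ) : ℝ := 1 - ![δ ^ 2, δ] ⬝ᵥ g.coef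

def C₁ (δ : ℝ) : ℝ := (√g.Φ₁)⁻¹ * δ ^ 2 * (g.bracket δ)⁻¹

def C₂ (δ : ℝ) : ℝ :=
  (√(1 - g.ρ ^ 2))⁻¹ * ((√g.Ψ)⁻¹ * δ - g.ρ * (√g.Φ₁)⁻¹ * δ ^ 2) * (g.bracket δ)⁻¹

/-- `σ_D`, the conditional standard deviation of `Q_{X,X}`. -/
def σD : ℝ := √(g.Υ - ![g.Φ₁₃, g.τ] ⬝ᵥ g.coef)

/-- `Δ_* = Φ₁^{1/2} Ψ^{-1/2} ρ^{-1}`. -/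
def Δstar : ℝ := √g.Φ₁ * (√g.Ψ)⁻¹ * g.ρ⁻¹

end VarComp

/-! ### Critical values and calibrated power -/

/-- `a₁ z₁² + a₂ (ρ z₁ + (1 - ρ²)^{1/2} z₂)² + (1 - a₁ - a₂) z₂²`. -/
def quadForm (a : ℝ × ℝ) (ρ z₁ z₂ : ℝ) : ℝ :=
  a.1 * z₁ ^ 2 + a.2 * (ρ * z₁ + √(1 - ρ ^ 2) * z₂) ^ 2 + (1 - a.1 - a.2) * z₂ ^ 2

/-- The law of two independent normal variables with unit variances and means `m₁`, `m₂`. -/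
def normalPair (m₁ m₂ : ℝ) : Measure (ℝ × ℝ) := (gaussianReal m₁ 1).prod (gaussianReal m₂ 1)

/-- `ℂ_α(a₁, a₂; ρ)`: the `1 - α` quantile of the quadratic form in two independent standard
normal variables. -/
def critVal (α : ℝ) (a : ℝ × ℝ) (ρ : ℝ) : ℝ :=
  sInf {c | 1 - α ≤ (normalPair 0 0).real {z | quadForm a ρ z.1 z.2 ≤ c}}

/-- `ℂ_α`: the `1 - α` quantile of the square of a standard normal variable. -/
def chiSqCrit (α : ℝ) : ℝ := sInf {c | 1 - α ≤ (gaussianReal 0 1).real {z | z ^ 2 ≤ c}}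

/-- `𝔸₀ = {(a₁, a₂) ∈ [0,1]² : a₁ + a₂ ≤ ā}`. -/
def weights₀ (abar : ℝ) : Set (ℝ × ℝ) :=
  {a | a.1 ∈ Set.Icc 0 1 ∧ a.2 ∈ Set.Icc 0 1 ∧ a.1 + a.2 ≤ abar}

/-- `ℂ_{α,max}(ρ)`. -/
def critMax (α abar ρ : ℝ) : ℝ := sSup ((fun a => critVal α a ρ) '' weights₀ abar)

/-- `𝒟(β₀) = {δ : δ + β₀ ∈ ℬ}`. -/
def altSet (B : Set ℝ) (β₀ : ℝ) : Set ℝ := {δ | δ + β₀ ∈ B}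

/-- `c_ℬ = sup_{δ ∈ 𝒟(β₀)} [1 - (δ², δ) [Φ₁, Φ₁₂; Φ₁₂, Ψ]⁻¹ (Φ₁₃, τ)ᵀ]²`. -/
def cB (D : Set ℝ) (g : VarComp) : ℝ := sSup ((fun δ => g.bracket δ ^ 2) '' D)

/-- The lower bound `min (0.01, 1.1 ℂ_{α,max}(ρ) Φ₁ c_ℬ / (Δ_*⁴ μ²))` of the weight `a₁`.
A positive number over `μ² = 0` is read as `+∞`; if `ρ = 0`, then `Δ_* = ±∞` and the quotient
is `0`, which is also the value of the expression below. -/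
def aLower (α abar : ℝ) (D : Set ℝ) (μ : ℝ) (g : VarComp) : ℝ :=
  if μ = 0 then 0.01
  else min 0.01 (1.1 * critMax α abar g.ρ * g.Φ₁ * cB D g / (g.Δstar ^ 4 * μ ^ 2))

/-- The set `𝔸(μ, γ)` of admissible weights. -/
def weights (α abar : ℝ) (D : Set ℝ) (μ : ℝ) (g : VarComp) : Set (ℝ × ℝ) :=
  {a | a ∈ weights₀ abar ∧ a.1 ∈ Set.Icc (aLower α abar D μ g) abar}

/-- The calibrated power `𝔼 φ_{a₁,a₂}(δ, μ, γ)` (the expectation is over the two normal variables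
only). -/
def power (α : ℝ) (μ : ℝ) (g : VarComp) (δ : ℝ) (a : ℝ × ℝ) : ℝ :=
  (normalPair (g.C₁ δ * μ) (g.C₂ δ * μ)).real
    {z | critVal α a g.ρ ≤ quadForm a g.ρ z.1 z.2}

/-- The highest attainable power at `δ`. -/
def maxPower (α abar : ℝ) (D : Set ℝ) (μ : ℝ) (g : VarComp) (δ : ℝ) : ℝ :=
  sSup (power α μ g δ '' weights α abar D μ g)

/-- The maximum regret over `δ ∈ 𝒟(β₀)` of the weights `a`. -/
def maxRegret (α abar : ℝ) (D : Set ℝ) (μ : ℝ) (g : VarComp) (a : ℝ × ℝ) : ℝ :=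
  sSup ((fun δ => maxPower α abar D μ g δ - power α μ g δ a) '' D)

/-- The minimax-regret weights: the argmin of the maximum regret over `𝔸(μ, γ)`. -/
def minimaxWeights (α abar : ℝ) (D : Set ℝ) (μ : ℝ) (g : VarComp) : Set (ℝ × ℝ) :=
  {a | a ∈ weights α abar D μ g ∧
    ∀ b ∈ weights α abar D μ g, maxRegret α abar D μ g a ≤ maxRegret α abar D μ g b}

/-- The two estimators of the noncentrality parameter. -/
inductive PlugIn
  | pp
  | krs

/-- `r̂_pp` and `r̂_krs` as functions of `r̂`. -/
def PlugIn.rHat : PlugIn → ℝ → ℝ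
  | .pp, r => max (r - 1) 0
  | .krs, r => r - 1 + Real.exp (-r / 2) *
      (∑' j : ℕ, (-r / 2) ^ j * (1 / ((j.factorial : ℝ) * (1 + 2 * (j : ℝ)))))⁻¹

/-- `f_s(D, γ) = σ_D (r̂_s)^{1/2}` with `r̂ = D² / σ_D²`. -/
def PlugIn.f (s : PlugIn) (D : ℝ) (g : VarComp) : ℝ := g.σD * √(s.rHat (D ^ 2 / g.σD ^ 2))

/-! ### The statistics and the feasible test -/

namespace IVArray

variable {Ω : Type*} [MeasurableSpace Ω] {P : Measure Ω} (M : IVArray Ω P) (g : ℕ → Ω → VarComp)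

/-- The jackknife AR statistic at `β₀`. -/
def AR (n : ℕ) (ω : Ω) : ℝ := M.Qee₀ n ω / √(g n ω).Φ₁

/-- The jackknife LM statistic at `β₀`. -/
def LM (n : ℕ) (ω : Ω) : ℝ := M.QXe₀ n ω / √(g n ω).Ψ

/-- The orthogonalized jackknife LM statistic at `β₀`. -/
def LMstar (n : ℕ) (ω : Ω) : ℝ :=
  (√(1 - (g n ω).ρ ^ 2))⁻¹ * (M.LM g n ω - (g n ω).ρ * M.AR g n ω)

/-- `D̂`, the residual of the projection of `Q_{X,X}` on `(Q_{e(β₀),e(β₀)}, Q_{X,e(β₀)})`. -/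
def Dhat (n : ℕ) (ω : Ω) : ℝ := M.QXX n ω - ![M.Qee₀ n ω, M.QXe₀ n ω] ⬝ᵥ (g n ω).coef

/-- The feasible set `𝔸(f_s(D̂, γ̂), γ̂)`. -/
def feasible (α abar : ℝ) (B : Set ℝ) (s : PlugIn) (n : ℕ) (ω : Ω) : Set (ℝ × ℝ) :=
  weights α abar (altSet B (M.β₀ n)) (s.f (M.Dhat g n ω) (g n ω)) (g n ω)

/-- The set of minimizers from which the weights `𝒜_s(D̂, γ̂)` are taken. -/
def argminSet (α abar : ℝ) (B : Set ℝ) (s : PlugIn) (n : ℕ) (ω : Ω) : Set (ℝ × ℝ) :=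
  minimaxWeights α abar (altSet B (M.β₀ n)) (s.f (M.Dhat g n ω) (g n ω)) (g n ω)

open Classical in
/-- The feasible jackknife CLC test with weights `A n ω`. -/
def clcTest (α : ℝ) (A : ℕ → Ω → ℝ × ℝ) (n : ℕ) (ω : Ω) : ℝ :=
  if critVal α (A n ω) (g n ω).ρ ≤
      (A n ω).1 * M.AR g n ω ^ 2 + (A n ω).2 * M.LM g n ω ^ 2
        + (1 - (A n ω).1 - (A n ω).2) * M.LMstar g n ω ^ 2
  then 1 else 0

end IVArray

/-! ### Tests in the limit experiment -/

/-- `𝔼 φ(𝒩₁, 𝒩₂)` where `(𝒩₁, 𝒩₂)` is normal with mean `(0, θ)`, unit variances and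
correlation `ρ`. -/
def limitExp (θ ρ : ℝ) (φ : ℝ × ℝ → ℝ) : ℝ :=
  ∫ x, φ (x 0, x 1) ∂(multivariateGaussian !₂[0, θ] !![1, ρ; ρ, 1])

/-- Level-`α` tests `φ(𝒩₁, 𝒩₂)` of `θ = 0` whose discontinuities have zero Lebesgue measure. -/
def IsLevelTest (α ρ : ℝ) (φ : ℝ × ℝ → ℝ) : Prop :=
  Measurable φ ∧ (∀ x, φ x ∈ Set.Icc 0 1) ∧ limitExp 0 ρ φ ≤ α ∧
    volume {x | ¬ ContinuousAt φ x} = 0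

/-- Tests invariant to the sign change `𝒩₂* ↦ -𝒩₂*`, `𝒩₁ ↦ 𝒩₁`, where
`𝒩₂* = (1 - ρ²)^{-1/2} (𝒩₂ - ρ 𝒩₁)`; in terms of `(𝒩₁, 𝒩₂)` it is the map
`(x, y) ↦ (x, 2 ρ x - y)`. -/
def invariantTests (α ρ : ℝ) : Set (ℝ × ℝ → ℝ) :=
  {φ | IsLevelTest α ρ φ ∧ ∀ x y, φ (x, y) = φ (x, 2 * ρ * x - y)}

/-- Unbiased tests of `θ = 0` against `θ ≠ 0`. -/
def unbiasedTests (α ρ : ℝ) : Set (ℝ × ℝ → ℝ) :=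
  {φ | IsLevelTest α ρ φ ∧ ∀ θ, θ ≠ 0 → α ≤ limitExp θ ρ φ}

end JackknifeCLC

end

namespace JackknifeCLC

/-! ### Quantiles -/

/-! Everything rests on what happens when the noncentrality plugged into the calibration diverges.
Since `d n * M.conc n` tends to `Ct ≠ 0` while `d n → 0`, the product `d n * Dhat` tends to `Ct` in
probability, so `|Dhat|`, and with it `s.f`, explodes. The choice of weights is analysed
deterministically, along sequences with `g n → g₀` and `μ n → ∞` (`Calibration`), and carried back
to probability through almost sure convergence along subsequences (`exists_subseq`,
`tendstoInMeasure_of_forall`).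

The heart is that the weights `(aLower, 0)`, which tend to `0`, have vanishing maximum regret
(`eventually_maxRegret_candidate_le`). Take any alternatives `δ n` and pass to subsequences. If both
means `C₁ μ`, `C₂ μ` stay bounded, then `δ n → 0` and the first mean, quadratic in `δ`, vanishes;
the limit problem is a shift of `z₂` alone, where no quadratic test beats `z₂²`. If the second mean
diverges, the weight of `z₂²` drives the power to one. If only the first diverges, `δ n` must
approach `Δstar`, and the lower bound of the first weight is calibrated so that this weight times
the squared first mean exceeds every critical value. Hence minimax weights have vanishing regret
too. At `δ = ±1/μ n` the means tend to `(0, η)` with `η ≠ 0`, and strict optimality of `z₂²` there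
forces `a₁ = 0` and `a₂ ρ = 0` at every limit point (`eq_zero_of_tendsto_minimaxWeights`).

Optimality is a generalised Neyman–Pearson argument. The exponential lies below its chord over `[-c,
c]` inside that interval and above it outside, so `{z₂² ≥ c²}` maximizes power among level-`α` tests
with `∫ z₂ φ = 0` under the null (`integral_le_chiRegion`). Central symmetry, evenness in `z₂` and
unbiasedness each imply this constraint, so one inequality serves the quadratic tests as well as the
invariant and unbiased classes.

Finally `(AR, LM)` converges to `corrMap` of two independent normals with means `0` and `drift`.
Slutsky's argument gives the limit of the CLC test, and the continuous mapping theorem those of its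
competitors. -/

lemma quantile_le_iff (μ : Measure ℝ) [IsProbabilityMeasure μ] {p : ℝ} (hp0 : 0 < p) (hp1 : p < 1)
    (c : ℝ) : sInf {c | p ≤ μ.real (Set.Iic c)} ≤ c ↔ p ≤ μ.real (Set.Iic c) := by
  simp_rw [← cdf_eq_real]
  have hbdd : BddBelow {c | p ≤ cdf μ c} := by
    obtain ⟨b, hb⟩ := ((tendsto_cdf_atBot μ).eventually_lt_const hp0).exists
    refine ⟨b, fun c hc => ?_⟩
    by_contra! h
    exact absurd (hc.trans (monotone_cdf μ h.le)) (not_le.2 hb)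
  have hne : {c | p ≤ cdf μ c}.Nonempty :=
    ((tendsto_cdf_atTop μ).eventually_const_lt hp1).exists.imp fun _ h => h.le
  refine ⟨fun h => ?_, fun h => csInf_le hbdd h⟩
  have hr : Tendsto (cdf μ) (𝓝[>] c) (𝓝 (cdf μ c)) :=
    ((cdf μ).right_continuous c).mono_left (nhdsWithin_mono _ Set.Ioi_subset_Ici_self)
  refine ge_of_tendsto hr ?_
  filter_upwards [self_mem_nhdsWithin] with x hx
  obtain ⟨y, hy, hyx⟩ := (csInf_lt_iff hbdd hne).1 (h.trans_lt hx)
  exact le_trans hy (monotone_cdf μ hyx.le)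

instance isProbabilityMeasure_normalPair (m₁ m₂ : ℝ) : IsProbabilityMeasure (normalPair m₁ m₂) := by
  unfold normalPair; infer_instance

lemma continuous_quadForm :
    Continuous fun x : ((ℝ × ℝ) × ℝ) × (ℝ × ℝ) => quadForm x.1.1 x.1.2 x.2.1 x.2.2 := by
  unfold quadForm
  fun_prop

lemma continuous_quadForm_apply (a : ℝ × ℝ) (ρ : ℝ) :
    Continuous fun z : ℝ × ℝ => quadForm a ρ z.1 z.2 := by
  unfold quadForm
  fun_prop

/-- Turns questions about the critical value into questions about the distribution function of the
form; measurability, positivity and continuity are all derived from it. -/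
lemma critVal_le_iff {α : ℝ} (hα : α ∈ Set.Ioo (0 : ℝ) 1) (a : ℝ × ℝ) (ρ c : ℝ) :
    critVal α a ρ ≤ c ↔ 1 - α ≤ (normalPair 0 0).real {z | quadForm a ρ z.1 z.2 ≤ c} := by
  have hm := (continuous_quadForm_apply a ρ).measurable
  have h (c : ℝ) : (normalPair 0 0).real {z | quadForm a ρ z.1 z.2 ≤ c} =
      ((normalPair 0 0).map fun z => quadForm a ρ z.1 z.2).real (Set.Iic c) := by
    rw [map_measureReal_apply hm measurableSet_Iic]; rfl
  have : IsProbabilityMeasure ((normalPair 0 0).map fun z => quadForm a ρ z.1 z.2) :=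
    Measure.isProbabilityMeasure_map hm.aemeasurable
  unfold critVal
  simp_rw [h]
  exact quantile_le_iff _ (by linarith [hα.2]) (by linarith [hα.1]) c

lemma measurable_critVal {α : ℝ} (hα : α ∈ Set.Ioo (0 : ℝ) 1) :
    Measurable fun x : (ℝ × ℝ) × ℝ => critVal α x.1 x.2 := by
  refine measurable_of_Iic fun c => ?_
  have hs : MeasurableSet {x : ((ℝ × ℝ) × ℝ) × (ℝ × ℝ) |
      quadForm x.1.1 x.1.2 x.2.1 x.2.2 ≤ c} :=
    measurableSet_le continuous_quadForm.measurable measurable_const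
  have := (measurable_measure_prodMk_left (ν := normalPair 0 0) hs).ennreal_toReal
  have h2 : (fun x : (ℝ × ℝ) × ℝ => critVal α x.1 x.2) ⁻¹' Set.Iic c =
      {x | 1 - α ≤ (normalPair 0 0).real {z | quadForm x.1 x.2 z.1 z.2 ≤ c}} := by
    ext x
    simp [critVal_le_iff hα]
  rw [h2]
  exact measurableSet_le measurable_const this

/-! ### The law of the quadratic form -/

/-- Weights which leave a positive weight on `z₂²`. -/
def admissible : Set (ℝ × ℝ) := {a | 0 ≤ a.1 ∧ 0 ≤ a.2 ∧ a.1 + a.2 < 1}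

lemma weights₀_subset_admissible {abar : ℝ} (h : abar < 1) : weights₀ abar ⊆ admissible :=
  fun _ ha => ⟨ha.1.1, ha.2.1.1, ha.2.2.trans_lt h⟩

lemma quadForm_nonneg {a : ℝ × ℝ} (ha : a ∈ admissible) (ρ z₁ z₂ : ℝ) :
    0 ≤ quadForm a ρ z₁ z₂ := by
  obtain ⟨h1, h2, h3⟩ := ha
  have : 0 ≤ 1 - a.1 - a.2 := by linarith
  unfold quadForm
  positivity

lemma nullSingletonClass_gaussian_one (m : ℝ) : NullSingletonClass (gaussianReal m 1) :=
  nullSingletonClass_gaussianReal one_ne_zero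

/-- By Fubini: for fixed `z₁` the level set consists of roots of a quadratic in `z₂` whose leading
coefficient is at least `1 - a.1 - a.2 > 0`, hence is finite. No bound on `ρ` is needed. -/
lemma normalPair_quadForm_eq {a : ℝ × ℝ} (ha : a ∈ admissible) (ρ c m₁ m₂ : ℝ) :
    normalPair m₁ m₂ {z | quadForm a ρ z.1 z.2 = c} = 0 := by
  have hm : MeasurableSet {z : ℝ × ℝ | quadForm a ρ z.1 z.2 = c} :=
    measurableSet_eq_fun (continuous_quadForm_apply a ρ).measurable measurable_const
  unfold normalPair
  rw [Measure.measure_prod_null hm]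
  refine ae_of_all _ fun x => ?_
  have := nullSingletonClass_gaussian_one m₂
  refine Set.Finite.measure_zero ?_ _
  set k := a.2 * √(1 - ρ ^ 2) ^ 2 + (1 - a.1 - a.2) with hk
  have hkpos : 0 < k := by
    have := ha.2.2
    have := mul_nonneg ha.2.1 (sq_nonneg √(1 - ρ ^ 2))
    rw [hk]; linarith
  set p : Polynomial ℝ := Polynomial.C k * Polynomial.X ^ 2 +
    Polynomial.C (2 * a.2 * ρ * x * √(1 - ρ ^ 2)) * Polynomial.X +
    Polynomial.C (a.1 * x ^ 2 + a.2 * ρ ^ 2 * x ^ 2 - c) with hp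
  have hp0 : p ≠ 0 := fun h => by
    have h2 := Polynomial.natDegree_quadratic (b := 2 * a.2 * ρ * x * √(1 - ρ ^ 2))
      (c := a.1 * x ^ 2 + a.2 * ρ ^ 2 * x ^ 2 - c) hkpos.ne'
    rw [← hp, h] at h2
    simp at h2
  refine (Polynomial.finite_setOfPred_isRoot hp0).subset fun y hy => ?_
  have hy' : quadForm a ρ x y = c := hy
  simp only [Set.mem_ofPred_eq, Polynomial.IsRoot.def, hp, Polynomial.eval_add, Polynomial.eval_mul,
    Polynomial.eval_C, Polynomial.eval_pow, Polynomial.eval_X]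
  rw [← hy', quadForm, hk]
  ring

lemma normalPair_eq_map (m₁ m₂ : ℝ) :
    normalPair m₁ m₂ = (normalPair 0 0).map fun z => (z.1 + m₁, z.2 + m₂) := by
  have h (m : ℝ) : gaussianReal m 1 = (gaussianReal 0 1).map (· + m) := by
    rw [gaussianReal_map_add_const, zero_add]
  unfold normalPair
  rw [h m₁, h m₂, Measure.map_prod_map _ _ (by fun_prop) (by fun_prop)]
  rfl

lemma normalPair_real_apply (m₁ m₂ : ℝ) {s : Set (ℝ × ℝ)} (hs : MeasurableSet s) :
    (normalPair m₁ m₂).real s = (normalPair 0 0).real {z | (z.1 + m₁, z.2 + m₂) ∈ s} := by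
  rw [normalPair_eq_map, map_measureReal_apply (by fun_prop) hs]; rfl

lemma absolutelyContinuous_normalPair (m₁ m₂ : ℝ) : volume ≪ normalPair m₁ m₂ := by
  unfold normalPair
  rw [Measure.volume_eq_prod]
  exact (gaussianReal_absolutelyContinuous' _ one_ne_zero).prod
    (gaussianReal_absolutelyContinuous' _ one_ne_zero)

lemma normalPair_pos_of_isOpen (m₁ m₂ : ℝ) {s : Set (ℝ × ℝ)} (hs : IsOpen s) (hne : s.Nonempty) :
    0 < normalPair m₁ m₂ s :=
  pos_iff_ne_zero.2 fun h => (hs.measure_pos volume hne).ne' (absolutelyContinuous_normalPair _ _ h)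

section limits

variable {ι : Type*} {l : Filter ι}

lemma tendsto_measureReal_of_ae [l.IsCountablyGenerated] {E : Type*} [MeasurableSpace E] {μ : Measure E} [IsFiniteMeasure μ]
    {s : ι → Set E} {t : Set E} (hs : ∀ i, MeasurableSet (s i)) (ht : MeasurableSet t)
    (h : ∀ᵐ x ∂μ, ∀ᶠ i in l, x ∈ s i ↔ x ∈ t) :
    Tendsto (fun i => μ.real (s i)) l (𝓝 (μ.real t)) :=
  (ENNReal.tendsto_toReal (measure_ne_top _ _)).comp
    (tendsto_measure_of_ae_tendsto_indicator_of_isFiniteMeasure l ht hs h)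

variable {a : ι → ℝ × ℝ} {ρ c m₁ m₂ : ι → ℝ} {a' : ℝ × ℝ} {ρ' c' m₁' m₂' : ℝ}

lemma tendsto_quadForm (ha : Tendsto a l (𝓝 a')) (hρ : Tendsto ρ l (𝓝 ρ'))
    (h1 : Tendsto m₁ l (𝓝 m₁')) (h2 : Tendsto m₂ l (𝓝 m₂')) :
    Tendsto (fun i => quadForm (a i) (ρ i) (m₁ i) (m₂ i)) l (𝓝 (quadForm a' ρ' m₁' m₂')) :=
  (continuous_quadForm.tendsto ((a', ρ'), (m₁', m₂'))).comp
    ((ha.prodMk_nhds hρ).prodMk_nhds (h1.prodMk_nhds h2))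

/-- The means are moved from the measure into the set, which fixes the measure; the indicators then
converge off the limiting level set, a null set. -/
lemma tendsto_normalPair_quadForm_le [l.IsCountablyGenerated] (ha' : a' ∈ admissible) (ha : Tendsto a l (𝓝 a'))
    (hρ : Tendsto ρ l (𝓝 ρ')) (hc : Tendsto c l (𝓝 c'))
    (h1 : Tendsto m₁ l (𝓝 m₁')) (h2 : Tendsto m₂ l (𝓝 m₂')) :
    Tendsto (fun i => (normalPair (m₁ i) (m₂ i)).real {z | quadForm (a i) (ρ i) z.1 z.2 ≤ c i}) l
      (𝓝 ((normalPair m₁' m₂').real {z | quadForm a' ρ' z.1 z.2 ≤ c'})) := by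
  have hq (a : ℝ × ℝ) (ρ c : ℝ) : MeasurableSet {z : ℝ × ℝ | quadForm a ρ z.1 z.2 ≤ c} :=
    measurableSet_le (continuous_quadForm_apply a ρ).measurable measurable_const
  simp_rw [fun m₁ m₂ a ρ c => normalPair_real_apply m₁ m₂ (hq a ρ c)]
  refine tendsto_measureReal_of_ae (fun i => (hq _ _ _).preimage (by fun_prop))
    ((hq _ _ _).preimage (by fun_prop)) ?_
  have h0 : ∀ᵐ z ∂(normalPair 0 0), quadForm a' ρ' (z.1 + m₁') (z.2 + m₂') ≠ c' := by
    have := normalPair_quadForm_eq ha' ρ' c' m₁' m₂'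
    rw [normalPair_eq_map, Measure.map_apply (by fun_prop)
      (measurableSet_eq_fun (continuous_quadForm_apply a' ρ').measurable measurable_const)] at this
    simpa [ae_iff] using this
  filter_upwards [h0] with z hz
  have ht := tendsto_quadForm ha hρ (h1.const_add z.1) (h2.const_add z.2)
  rcases lt_or_gt_of_ne hz with hlt | hgt
  · filter_upwards [ht.eventually_lt hc hlt] with i hi
    exact iff_of_true hi.le hlt.le
  · filter_upwards [hc.eventually_lt ht hgt] with i hi
    exact iff_of_false (not_le.2 hi) (not_le.2 hgt)

end limits

lemma normalPair_real_le_quadForm {a : ℝ × ℝ} (ha : a ∈ admissible) (ρ c m₁ m₂ : ℝ) :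
    (normalPair m₁ m₂).real {z | c ≤ quadForm a ρ z.1 z.2} =
      1 - (normalPair m₁ m₂).real {z | quadForm a ρ z.1 z.2 ≤ c} := by
  have hq : MeasurableSet {z : ℝ × ℝ | quadForm a ρ z.1 z.2 ≤ c} :=
    measurableSet_le (continuous_quadForm_apply a ρ).measurable measurable_const
  rw [← probReal_compl_eq_one_sub hq]
  refine measureReal_congr ?_
  have h0 : ∀ᵐ z ∂(normalPair m₁ m₂), quadForm a ρ z.1 z.2 ≠ c := by
    simpa [ae_iff] using normalPair_quadForm_eq ha ρ c m₁ m₂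
  filter_upwards [h0] with z hz
  refine propext (Iff.trans (b := ¬ quadForm a ρ z.1 z.2 ≤ c) ?_ Iff.rfl)
  exact ⟨fun h => not_le.2 (lt_of_le_of_ne h hz.symm), fun h => (not_le.1 h).le⟩

/-- The open set where the form lies strictly between the two levels meets the axis `z₁ = 0`, so it
has positive mass. This strictness is what makes the quantile continuous in its parameters. -/
lemma normalPair_real_quadForm_lt {a : ℝ × ℝ} (ha : a ∈ admissible) (ρ : ℝ) {c c' : ℝ}
    (hc : 0 ≤ c) (hcc : c < c') :
    (normalPair 0 0).real {z | quadForm a ρ z.1 z.2 ≤ c} <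
      (normalPair 0 0).real {z | quadForm a ρ z.1 z.2 ≤ c'} := by
  have hcont := continuous_quadForm_apply a ρ
  set U := {z : ℝ × ℝ | quadForm a ρ z.1 z.2 ∈ Set.Ioo c c'} with hU
  have hUo : IsOpen U := isOpen_Ioo.preimage hcont
  have hne : U.Nonempty := by
    set k := a.2 * √(1 - ρ ^ 2) ^ 2 + (1 - a.1 - a.2) with hk
    have hkpos : 0 < k := by
      have := ha.2.2
      have := mul_nonneg ha.2.1 (sq_nonneg √(1 - ρ ^ 2))
      rw [hk]; linarith
    refine ⟨(0, √((c + c') / 2 / k)), ?_⟩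
    have : quadForm a ρ 0 √((c + c') / 2 / k) = (c + c') / 2 := by
      have h2 : √((c + c') / 2 / k) ^ 2 = (c + c') / 2 / k := Real.sq_sqrt (by
        have : 0 ≤ c + c' := by linarith
        positivity)
      calc _ = k * √((c + c') / 2 / k) ^ 2 := by rw [quadForm, hk]; ring
        _ = _ := by rw [h2]; field_simp
    simp only [hU, Set.mem_ofPred_eq, this]
    constructor <;> linarith
  have hpos : 0 < (normalPair 0 0).real U :=
    ENNReal.toReal_pos (normalPair_pos_of_isOpen 0 0 hUo hne).ne' (measure_ne_top _ _)
  have hd : Disjoint {z : ℝ × ℝ | quadForm a ρ z.1 z.2 ≤ c} U :=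
    Set.disjoint_left.2 fun z h1 h2 => absurd h2.1 (not_lt.2 h1)
  have := measureReal_union (μ := normalPair 0 0) hd hUo.measurableSet
  have h3 : (normalPair 0 0).real ({z : ℝ × ℝ | quadForm a ρ z.1 z.2 ≤ c} ∪ U) ≤
      (normalPair 0 0).real {z | quadForm a ρ z.1 z.2 ≤ c'} :=
    measureReal_mono (fun z hz => hz.elim (fun h => le_trans h hcc.le) fun h => h.2.le)
  linarith

/-! ### Critical values -/

lemma critVal_pos {α : ℝ} (hα : α ∈ Set.Ioo (0 : ℝ) 1) {a : ℝ × ℝ} (ha : a ∈ admissible) (ρ : ℝ) :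
    0 < critVal α a ρ := by
  by_contra! h
  rw [critVal_le_iff hα] at h
  have h0 : (normalPair 0 0).real {z | quadForm a ρ z.1 z.2 ≤ 0} = 0 := by
    have hset : {z : ℝ × ℝ | quadForm a ρ z.1 z.2 ≤ 0} = {z | quadForm a ρ z.1 z.2 = 0} := by
      ext z
      exact ⟨fun h => le_antisymm h (quadForm_nonneg ha _ _ _), le_of_eq⟩
    rw [hset, measureReal_def, normalPair_quadForm_eq ha, ENNReal.toReal_zero]
  rw [h0] at h
  linarith [hα.2]

lemma normalPair_real_quadForm_le_critVal {α : ℝ} (hα : α ∈ Set.Ioo (0 : ℝ) 1) {a : ℝ × ℝ}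
    (ha : a ∈ admissible) (ρ : ℝ) :
    (normalPair 0 0).real {z | quadForm a ρ z.1 z.2 ≤ critVal α a ρ} = 1 - α := by
  refine le_antisymm ?_ ((critVal_le_iff hα a ρ _).1 le_rfl)
  -- Strictly below the quantile the distribution function is less than `1 - α`; continuity carries
  -- the bound to the quantile itself.
  have hc : Tendsto (fun n : ℕ => critVal α a ρ - 1 / ((n : ℝ) + 1)) atTop (𝓝 (critVal α a ρ)) := by
    simpa using tendsto_const_nhds.sub (tendsto_one_div_add_atTop_nhds_zero_nat (𝕜 := ℝ))
  refine le_of_tendsto (tendsto_normalPair_quadForm_le ha tendsto_const_nhds tendsto_const_nhds hc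
    tendsto_const_nhds tendsto_const_nhds) (Eventually.of_forall fun n => ?_)
  by_contra! h
  have := (critVal_le_iff hα a ρ _).2 h.le
  have h2 : 0 < 1 / ((n : ℝ) + 1) := by positivity
  linarith

/-- Levels below the limit are excluded by convergence of the distribution functions alone; levels
above it need that the limiting distribution function exceeds `1 - α` immediately to the right of
its quantile. -/
lemma tendsto_critVal {ι : Type*} {l : Filter ι} [l.IsCountablyGenerated] {α : ℝ}
    (hα : α ∈ Set.Ioo (0 : ℝ) 1) {a : ι → ℝ × ℝ} {ρ : ι → ℝ} {a' : ℝ × ℝ} {ρ' : ℝ}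
    (ha' : a' ∈ admissible) (ha : Tendsto a l (𝓝 a')) (hρ : Tendsto ρ l (𝓝 ρ')) :
    Tendsto (fun i => critVal α (a i) (ρ i)) l (𝓝 (critVal α a' ρ')) := by
  have hG (c : ℝ) := tendsto_normalPair_quadForm_le (c := fun _ => c) ha' ha hρ tendsto_const_nhds
    (tendsto_const_nhds (x := (0 : ℝ))) (tendsto_const_nhds (x := (0 : ℝ)))
  refine tendsto_order.2 ⟨fun c hc => ?_, fun c hc => ?_⟩
  · have : (normalPair 0 0).real {z | quadForm a' ρ' z.1 z.2 ≤ c} < 1 - α := by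
      rw [← not_le, ← critVal_le_iff hα]; exact not_le.2 hc
    filter_upwards [(hG c).eventually_lt_const this] with i hi
    rwa [← not_le, ← critVal_le_iff hα, not_le] at hi
  · obtain ⟨c₁, h1, h2⟩ := exists_between hc
    have : 1 - α < (normalPair 0 0).real {z | quadForm a' ρ' z.1 z.2 ≤ c₁} := by
      rw [← normalPair_real_quadForm_le_critVal hα ha' ρ']
      exact normalPair_real_quadForm_lt ha' ρ' (critVal_pos hα ha' ρ').le h1
    filter_upwards [(hG c₁).eventually_const_lt this] with i hi
    exact ((critVal_le_iff hα _ _ _).2 hi.le).trans_lt h2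

/-- A bound of the critical values which is locally uniform in the correlation. -/
lemma exists_critVal_le {α : ℝ} (hα : α ∈ Set.Ioo (0 : ℝ) 1) :
    ∃ c₀, ∀ a ∈ admissible, ∀ ρ, critVal α a ρ ≤ (3 + 2 * ρ ^ 2) * c₀ := by
  have hm : Measurable fun z : ℝ × ℝ => z.1 ^ 2 + z.2 ^ 2 := by fun_prop
  have : IsProbabilityMeasure ((normalPair 0 0).map fun z : ℝ × ℝ => z.1 ^ 2 + z.2 ^ 2) :=
    Measure.isProbabilityMeasure_map hm.aemeasurable
  obtain ⟨c₀, h0⟩ := ((tendsto_cdf_atTop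
    ((normalPair 0 0).map fun z : ℝ × ℝ => z.1 ^ 2 + z.2 ^ 2)).eventually_const_lt
      (show 1 - α < 1 by linarith [hα.1])).exists
  rw [cdf_eq_real, map_measureReal_apply hm measurableSet_Iic] at h0
  -- `c₀` bounds `z₁² + z₂²` with probability above `1 - α`, and the form is at most `(3 + 2ρ²)(z₁²
  -- + z₂²)`.
  refine ⟨c₀, fun a ha ρ => (critVal_le_iff hα a ρ _).2 (h0.le.trans ?_)⟩
  refine measureReal_mono fun z hz => ?_
  have hz' : z.1 ^ 2 + z.2 ^ 2 ≤ c₀ := hz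
  obtain ⟨h1, h2, h3⟩ := ha
  have hs0 := Real.sqrt_nonneg (1 - ρ ^ 2)
  have hs : √(1 - ρ ^ 2) ≤ 1 := by
    exact Real.sqrt_le_one.2 (by nlinarith)
  have hs2 : √(1 - ρ ^ 2) ^ 2 ≤ 1 := by nlinarith
  have hb : (ρ * z.1 + √(1 - ρ ^ 2) * z.2) ^ 2 ≤ 2 * ρ ^ 2 * z.1 ^ 2 + 2 * z.2 ^ 2 := by
    nlinarith [sq_nonneg (ρ * z.1 - √(1 - ρ ^ 2) * z.2),
      mul_le_mul_of_nonneg_right hs2 (sq_nonneg z.2)]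
  have hb2 : a.2 * (ρ * z.1 + √(1 - ρ ^ 2) * z.2) ^ 2 ≤ 2 * ρ ^ 2 * z.1 ^ 2 + 2 * z.2 ^ 2 :=
    (mul_le_of_le_one_left (sq_nonneg _) (by linarith)).trans hb
  have hb1 : a.1 * z.1 ^ 2 ≤ z.1 ^ 2 := mul_le_of_le_one_left (sq_nonneg _) (by linarith)
  have hb3 : (1 - a.1 - a.2) * z.2 ^ 2 ≤ z.2 ^ 2 := mul_le_of_le_one_left (sq_nonneg _) (by linarith)
  show quadForm a ρ z.1 z.2 ≤ _
  have := mul_le_mul_of_nonneg_left hz' (show (0 : ℝ) ≤ 3 + 2 * ρ ^ 2 by positivity)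
  unfold quadForm
  nlinarith [sq_nonneg z.1, sq_nonneg z.2, mul_nonneg (sq_nonneg ρ) (sq_nonneg z.2)]

lemma quadForm_eq_sq {a : ℝ × ℝ} {ρ : ℝ} (h1 : a.1 = 0) (h2 : a.2 * ρ = 0) (z₁ z₂ : ℝ) :
    quadForm a ρ z₁ z₂ = z₂ ^ 2 := by
  rcases mul_eq_zero.1 h2 with h | h
  · simp [quadForm, h1, h]
  · simp only [quadForm, h1, h]
    norm_num
    ring

lemma critVal_eq_chiSqCrit (α : ℝ) {a : ℝ × ℝ} {ρ : ℝ} (h1 : a.1 = 0) (h2 : a.2 * ρ = 0) :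
    critVal α a ρ = chiSqCrit α := by
  unfold critVal chiSqCrit
  simp_rw [quadForm_eq_sq h1 h2]
  congr! 4 with c
  have hm : MeasurableSet {z : ℝ | z ^ 2 ≤ c} := measurableSet_le (by fun_prop) measurable_const
  exact (measurePreserving_snd (μ := gaussianReal 0 1) (ν := gaussianReal 0 1)).measureReal_preimage
    hm.nullMeasurableSet

/-! ### Power of the quadratic tests -/

/-- The power of the quadratic test with weights `a` at the means `m₁`, `m₂`. -/
noncomputable def quadPower (α : ℝ) (a : ℝ × ℝ) (ρ m₁ m₂ : ℝ) : ℝ :=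
  (normalPair m₁ m₂).real {z | critVal α a ρ ≤ quadForm a ρ z.1 z.2}

lemma power_eq_quadPower (α μ : ℝ) (g : VarComp) (δ : ℝ) (a : ℝ × ℝ) :
    power α μ g δ a = quadPower α a g.ρ (g.C₁ δ * μ) (g.C₂ δ * μ) := rfl

lemma quadPower_zero {α : ℝ} (hα : α ∈ Set.Ioo (0 : ℝ) 1) {a : ℝ × ℝ} (ha : a ∈ admissible)
    (ρ : ℝ) : quadPower α a ρ 0 0 = α := by
  rw [quadPower, normalPair_real_le_quadForm ha, normalPair_real_quadForm_le_critVal hα ha]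
  ring

lemma tendsto_quadPower {ι : Type*} {l : Filter ι} [l.IsCountablyGenerated] {α : ℝ}
    (hα : α ∈ Set.Ioo (0 : ℝ) 1) {a : ι → ℝ × ℝ} {ρ m₁ m₂ : ι → ℝ} {a' : ℝ × ℝ} {ρ' m₁' m₂' : ℝ}
    (hadm : ∀ᶠ i in l, a i ∈ admissible)
    (ha' : a' ∈ admissible) (ha : Tendsto a l (𝓝 a')) (hρ : Tendsto ρ l (𝓝 ρ'))
    (h1 : Tendsto m₁ l (𝓝 m₁')) (h2 : Tendsto m₂ l (𝓝 m₂')) :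
    Tendsto (fun i => quadPower α (a i) (ρ i) (m₁ i) (m₂ i)) l (𝓝 (quadPower α a' ρ' m₁' m₂')) := by
  rw [quadPower, normalPair_real_le_quadForm ha']
  refine Tendsto.congr' ?_ ((tendsto_normalPair_quadForm_le ha' ha hρ
    (tendsto_critVal hα ha' ha hρ) h1 h2).const_sub 1)
  filter_upwards [hadm] with i hi
  rw [quadPower, normalPair_real_le_quadForm hi]

/-- If the quadratic form exceeds the critical value eventually at every point, then the power
tends to one. -/
lemma tendsto_quadPower_one {ι : Type*} {l : Filter ι} [l.IsCountablyGenerated] {α : ℝ}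
    {a : ι → ℝ × ℝ} {ρ m₁ m₂ : ι → ℝ}
    (h : ∀ z₁ z₂ : ℝ, ∀ᶠ i in l, critVal α (a i) (ρ i) ≤
      quadForm (a i) (ρ i) (z₁ + m₁ i) (z₂ + m₂ i)) :
    Tendsto (fun i => quadPower α (a i) (ρ i) (m₁ i) (m₂ i)) l (𝓝 1) := by
  have hq (a : ℝ × ℝ) (ρ c : ℝ) : MeasurableSet {z : ℝ × ℝ | c ≤ quadForm a ρ z.1 z.2} :=
    measurableSet_le measurable_const (continuous_quadForm_apply a ρ).measurable
  have h1 : (normalPair 0 0).real Set.univ = 1 := probReal_univ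
  unfold quadPower
  simp_rw [fun m₁ m₂ a ρ c => normalPair_real_apply m₁ m₂ (hq a ρ c), ← h1]
  refine tendsto_measureReal_of_ae (fun i => (hq _ _ _).preimage (by fun_prop))
    MeasurableSet.univ (ae_of_all _ fun z => ?_)
  filter_upwards [h z.1 z.2] with i hi
  exact iff_of_true hi trivial


/-! ### The most powerful test against a shift of the second coordinate -/

/-- The chord of `x ↦ exp (η x)` over `[-c, c]`. -/
noncomputable def expChord (η c x : ℝ) : ℝ := Real.cosh (η * c) + Real.sinh (η * c) / c * x

lemma expChord_eq {c : ℝ} (hc : 0 < c) (η x : ℝ) : expChord η c x =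
    (c - x) / (2 * c) * Real.exp (-(η * c)) + (c + x) / (2 * c) * Real.exp (η * c) := by
  rw [expChord, Real.cosh_eq, Real.sinh_eq]
  field_simp
  ring

lemma exp_le_expChord {c x : ℝ} (hc : 0 < c) (hx : |x| ≤ c) (η : ℝ) :
    Real.exp (η * x) ≤ expChord η c x := by
  rw [expChord_eq hc]
  obtain ⟨h1, h2⟩ := abs_le.1 hx
  have := convexOn_exp.2 (Set.mem_univ (-(η * c))) (Set.mem_univ (η * c))
    (show 0 ≤ (c - x) / (2 * c) from div_nonneg (by linarith) (by linarith))
    (show 0 ≤ (c + x) / (2 * c) from div_nonneg (by linarith) (by linarith)) (by field_simp; ring)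
  have he : (c - x) / (2 * c) * -(η * c) + (c + x) / (2 * c) * (η * c) = η * x := by
    field_simp
    ring
  simpa only [smul_eq_mul, he] using this

lemma exp_lt_expChord {c x : ℝ} (hc : 0 < c) (hx : |x| < c) {η : ℝ} (hη : η ≠ 0) :
    Real.exp (η * x) < expChord η c x := by
  rw [expChord_eq hc]
  obtain ⟨h1, h2⟩ := abs_lt.1 hx
  have hne : -(η * c) ≠ η * c := fun h => mul_ne_zero hη hc.ne' (by linarith)
  have := strictConvexOn_exp.2 (Set.mem_univ (-(η * c))) (Set.mem_univ (η * c)) hne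
    (show 0 < (c - x) / (2 * c) from div_pos (by linarith) (by linarith))
    (show 0 < (c + x) / (2 * c) from div_pos (by linarith) (by linarith)) (by field_simp; ring)
  have he : (c - x) / (2 * c) * -(η * c) + (c + x) / (2 * c) * (η * c) = η * x := by
    field_simp
    ring
  simpa only [smul_eq_mul, he] using this

/-- Here `c` is a convex combination of `-c` and `x`. Convexity bounds the exponential at `c` by its
values at `-c` and `x`; solving for the value at `x` gives the claim. -/
lemma expChord_le_exp_of_le {c x : ℝ} (hc : 0 < c) (hx : c ≤ x) (η : ℝ) :
    expChord η c x ≤ Real.exp (η * x) := by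
  rw [expChord_eq hc]
  have hp : 0 < x + c := by linarith
  have := convexOn_exp.2 (Set.mem_univ (-(η * c))) (Set.mem_univ (η * x))
    (show 0 ≤ (x - c) / (x + c) from div_nonneg (by linarith) hp.le)
    (show 0 ≤ 2 * c / (x + c) by positivity) (by field_simp; ring)
  have he : ((x - c) / (x + c)) • (-(η * c)) + (2 * c / (x + c)) • (η * x) = η * c := by
    simp only [smul_eq_mul]
    field_simp
    ring
  rw [he, smul_eq_mul, smul_eq_mul] at this
  have h2 : (c + x) / (2 * c) * Real.exp (η * c) ≤ (c + x) / (2 * c) *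
      ((x - c) / (x + c) * Real.exp (-(η * c)) + 2 * c / (x + c) * Real.exp (η * x)) :=
    mul_le_mul_of_nonneg_left this (div_nonneg (by linarith) (by linarith))
  have h3 : (c + x) / (2 * c) *
      ((x - c) / (x + c) * Real.exp (-(η * c)) + 2 * c / (x + c) * Real.exp (η * x)) =
      Real.exp (η * x) - (c - x) / (2 * c) * Real.exp (-(η * c)) := by
    field_simp
    ring
  linarith

lemma expChord_le_exp {c x : ℝ} (hc : 0 < c) (hx : c ≤ |x|) (η : ℝ) :
    expChord η c x ≤ Real.exp (η * x) := by
  rcases le_abs.1 hx with h | h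
  · exact expChord_le_exp_of_le hc h η
  -- Reflection: replacing `(η, x)` by `(-η, -x)` changes neither the chord nor the exponential.
  · have h1 := expChord_le_exp_of_le hc h (-η)
    have h2 : expChord (-η) c (-x) = expChord η c x := by
      simp only [expChord, neg_mul, Real.cosh_neg, Real.sinh_neg]
      ring
    rwa [h2, neg_mul_neg] at h1

lemma gaussianReal_eq_withDensity (η : ℝ) : gaussianReal η 1 =
    (gaussianReal 0 1).withDensity fun x => ENNReal.ofReal (Real.exp (η * x - η ^ 2 / 2)) := by
  rw [gaussianReal_of_var_ne_zero _ one_ne_zero, gaussianReal_of_var_ne_zero _ one_ne_zero,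
    ← withDensity_mul _ (measurable_gaussianPDF _ _) (by fun_prop)]
  congr 1
  ext x
  rw [Pi.mul_apply, gaussianPDF, gaussianPDF, ← ENNReal.ofReal_mul (gaussianPDFReal_nonneg _ _ _)]
  congr 1
  simp only [gaussianPDFReal]
  rw [mul_assoc (_)⁻¹, ← Real.exp_add]
  congr 2
  simp only [NNReal.coe_one]
  ring

lemma normalPair_zero_eq_withDensity (η : ℝ) : normalPair 0 η =
    (normalPair 0 0).withDensity fun z => ENNReal.ofReal (Real.exp (η * z.2 - η ^ 2 / 2)) := by
  unfold normalPair
  rw [gaussianReal_eq_withDensity η, prod_withDensity_right (by fun_prop)]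

lemma integral_normalPair_zero (η : ℝ) (φ : ℝ × ℝ → ℝ) : ∫ z, φ z ∂(normalPair 0 η) =
    ∫ z, Real.exp (η * z.2 - η ^ 2 / 2) * φ z ∂(normalPair 0 0) := by
  rw [normalPair_zero_eq_withDensity, integral_withDensity_eq_integral_toReal_smul (by fun_prop)
    (ae_of_all _ fun _ => ENNReal.ofReal_lt_top)]
  simp_rw [ENNReal.toReal_ofReal (Real.exp_pos _).le, smul_eq_mul]

lemma integrable_exp_snd (η : ℝ) : Integrable (fun z : ℝ × ℝ => Real.exp (η * z.2)) (normalPair 0 0) :=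
  (integrable_exp_mul_gaussianReal η).comp_snd _

lemma integrable_exp_snd_sub (η : ℝ) :
    Integrable (fun z : ℝ × ℝ => Real.exp (η * z.2 - η ^ 2 / 2)) (normalPair 0 0) := by
  simp_rw [sub_eq_add_neg, Real.exp_add]
  exact (integrable_exp_snd η).mul_const _

lemma integrable_snd_normalPair : Integrable (fun z : ℝ × ℝ => z.2) (normalPair 0 0) :=
  ((memLp_id_gaussianReal 1).integrable le_rfl).comp_snd _

lemma integrable_mul_test {μ : Measure (ℝ × ℝ)} {f φ : ℝ × ℝ → ℝ} (hf : Integrable f μ)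
    (hm : Measurable φ) (h01 : ∀ z, φ z ∈ Set.Icc (0 : ℝ) 1) : Integrable (fun z => f z * φ z) μ :=
  hf.mul_bdd (c := 1) hm.aestronglyMeasurable (ae_of_all _ fun z => by
    rw [Real.norm_of_nonneg (h01 z).1]; exact (h01 z).2)

lemma integrable_test {μ : Measure (ℝ × ℝ)} [IsFiniteMeasure μ] {φ : ℝ × ℝ → ℝ}
    (hm : Measurable φ) (h01 : ∀ z, φ z ∈ Set.Icc (0 : ℝ) 1) : Integrable φ μ := by
  simpa using integrable_mul_test (integrable_const (1 : ℝ)) hm h01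

lemma chiSqCrit_pos {α : ℝ} (hα : α ∈ Set.Ioo (0 : ℝ) 1) : 0 < chiSqCrit α := by
  rw [← critVal_eq_chiSqCrit α (a := (0, 0)) (ρ := 0) rfl (by simp)]
  exact critVal_pos hα ⟨le_rfl, le_rfl, by norm_num⟩ 0

/-- The rejection region of the test based on the square of the second coordinate. -/
def chiRegion (α : ℝ) : Set (ℝ × ℝ) := {z | chiSqCrit α ≤ z.2 ^ 2}

lemma measurableSet_chiRegion (α : ℝ) : MeasurableSet (chiRegion α) :=
  measurableSet_le measurable_const (by fun_prop)

lemma quadPower_of_eq_zero {α : ℝ} {a : ℝ × ℝ} {ρ : ℝ} (h1 : a.1 = 0) (h2 : a.2 * ρ = 0)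
    (m₁ m₂ : ℝ) : quadPower α a ρ m₁ m₂ = (normalPair m₁ m₂).real (chiRegion α) := by
  unfold quadPower chiRegion
  simp_rw [quadForm_eq_sq h1 h2, critVal_eq_chiSqCrit α h1 h2]

lemma zero_mem_admissible : (0 : ℝ × ℝ) ∈ admissible := ⟨le_rfl, le_rfl, by simp⟩

lemma normalPair_chiRegion_zero {α : ℝ} (hα : α ∈ Set.Ioo (0 : ℝ) 1) :
    (normalPair 0 0).real (chiRegion α) = α := by
  rw [← quadPower_of_eq_zero (a := 0) (ρ := 0) rfl (by simp),
    quadPower_zero hα zero_mem_admissible]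

lemma indicator_chiRegion_mem (α : ℝ) (z : ℝ × ℝ) :
    (chiRegion α).indicator (1 : ℝ × ℝ → ℝ) z ∈ Set.Icc (0 : ℝ) 1 := by
  by_cases h : z ∈ chiRegion α <;> simp [h]

/-- A symmetry of the null law that flips `z₂` and preserves `φ` makes `z₂ φ` odd. -/
lemma integral_snd_mul_of_symm {φ : ℝ × ℝ → ℝ} (T : ℝ × ℝ → ℝ × ℝ)
    (hT : MeasurePreserving T (normalPair 0 0) (normalPair 0 0)) (hemb : MeasurableEmbedding T)
    (hsnd : ∀ z, (T z).2 = -z.2) (hφ : ∀ z, φ (T z) = φ z) :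
    ∫ z, z.2 * φ z ∂(normalPair 0 0) = 0 := by
  have h := hT.integral_comp hemb fun z => z.2 * φ z
  simp_rw [hsnd, hφ, neg_mul, integral_neg] at h
  linarith

lemma measurePreserving_neg_gaussian : MeasurePreserving (fun x : ℝ => -x) (gaussianReal 0 1)
    (gaussianReal 0 1) :=
  ⟨by fun_prop, by rw [gaussianReal_map_neg, neg_zero]⟩

lemma integral_snd_mul_of_even_snd {φ : ℝ × ℝ → ℝ} (hφ : ∀ x y, φ (x, -y) = φ (x, y)) :
    ∫ z, z.2 * φ z ∂(normalPair 0 0) = 0 :=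
  integral_snd_mul_of_symm (Prod.map id fun x => -x)
    ((MeasurePreserving.id _).prod measurePreserving_neg_gaussian)
    (MeasurableEmbedding.id.prodMap (MeasurableEquiv.neg ℝ).measurableEmbedding)
    (fun _ => rfl) fun z => hφ z.1 z.2

lemma integral_snd_mul_of_even {φ : ℝ × ℝ → ℝ} (hφ : ∀ x y, φ (-x, -y) = φ (x, y)) :
    ∫ z, z.2 * φ z ∂(normalPair 0 0) = 0 :=
  integral_snd_mul_of_symm (Prod.map (fun x => -x) fun x => -x)
    (measurePreserving_neg_gaussian.prod measurePreserving_neg_gaussian)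
    ((MeasurableEquiv.neg ℝ).measurableEmbedding.prodMap
      (MeasurableEquiv.neg ℝ).measurableEmbedding)
    (fun _ => rfl) fun z => hφ z.1 z.2

/-- Up to the factor `exp (-η²/2)`, the power at the shift `η` is the moment generating function of
`z₂` under the null law weighted by `φ`. Unbiasedness makes this function minimal at `0`, and its
derivative there is the integral in question. -/
lemma integral_snd_mul_of_unbiased {φ : ℝ × ℝ → ℝ} (hm : Measurable φ)
    (h01 : ∀ z, φ z ∈ Set.Icc (0 : ℝ) 1)
    (hub : ∀ η, ∫ z, φ z ∂(normalPair 0 0) ≤ ∫ z, φ z ∂(normalPair 0 η)) :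
    ∫ z, z.2 * φ z ∂(normalPair 0 0) = 0 := by
  set κ := (normalPair 0 0).withDensity fun z => ENNReal.ofReal (φ z) with hκ
  have hint (f : ℝ × ℝ → ℝ) : ∫ z, f z ∂κ = ∫ z, f z * φ z ∂(normalPair 0 0) := by
    rw [hκ, integral_withDensity_eq_integral_toReal_smul (by fun_prop)
      (ae_of_all _ fun _ => ENNReal.ofReal_lt_top)]
    simp_rw [ENNReal.toReal_ofReal (h01 _).1, smul_eq_mul, mul_comm]
  have hle : κ ≤ normalPair 0 0 := by
    conv_rhs => rw [← withDensity_one (μ := normalPair 0 0)]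
    exact withDensity_mono (ae_of_all _ fun z => by
      simpa using ENNReal.ofReal_le_ofReal (h01 z).2)
  have hset : integrableExpSet (fun z : ℝ × ℝ => z.2) κ = Set.univ :=
    Set.eq_univ_of_forall fun t => (integrable_exp_snd t).mono_measure hle
  have hd := hasDerivAt_mgf (X := fun z : ℝ × ℝ => z.2) (μ := κ) (t := 0) (by simp [hset])
  have hmin : IsLocalMin (mgf (fun z : ℝ × ℝ => z.2) κ) 0 := by
    refine Eventually.of_forall fun η => ?_
    have h1 := hub η
    rw [integral_normalPair_zero η] at h1
    simp only [mgf, zero_mul, Real.exp_zero]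
    rw [hint, hint]
    -- Dropping the factor `exp (-η²/2) ≤ 1` only increases the right side, so the minimum at `0`
    -- survives.
    have h2 : ∫ z, Real.exp (η * z.2 - η ^ 2 / 2) * φ z ∂(normalPair 0 0) ≤
        ∫ z, Real.exp (η * z.2) * φ z ∂(normalPair 0 0) := by
      refine integral_mono (integrable_mul_test (integrable_exp_snd_sub η) hm h01)
        (integrable_mul_test (integrable_exp_snd η) hm h01) fun z => ?_
      refine mul_le_mul_of_nonneg_right (Real.exp_le_exp.2 ?_) (h01 z).1
      linarith [sq_nonneg η]
    simpa using (show _ from h1).trans h2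
  have h0 := hmin.hasDerivAt_eq_zero hd
  simpa [hint] using h0

section optimality

variable {α : ℝ} (hα : α ∈ Set.Ioo (0 : ℝ) 1) {φ : ℝ × ℝ → ℝ} (hm : Measurable φ)
  (h01 : ∀ z, φ z ∈ Set.Icc (0 : ℝ) 1) (hsize : ∫ z, φ z ∂(normalPair 0 0) ≤ α)
  (horth : ∫ z, z.2 * φ z ∂(normalPair 0 0) = 0) (η : ℝ)

/-- The pointwise gain of the test `chiRegion` over `φ` in the Neyman–Pearson argument. -/
noncomputable def npGain (α : ℝ) (φ : ℝ × ℝ → ℝ) (η : ℝ) (z : ℝ × ℝ) : ℝ :=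
  ((chiRegion α).indicator (1 : ℝ × ℝ → ℝ) z - φ z) *
    (Real.exp (η * z.2) - expChord η √(chiSqCrit α) z.2)

include hα h01 in
-- Both factors change sign together: on the region the indicator is `1 ≥ φ` and the chord lies
-- below the exponential; off it both inequalities are reversed.
lemma npGain_nonneg (z : ℝ × ℝ) : 0 ≤ npGain α φ η z := by
  have hc := Real.sqrt_pos.2 (chiSqCrit_pos hα)
  unfold npGain
  by_cases hz : z ∈ chiRegion α
  · rw [Set.indicator_of_mem hz, Pi.one_apply]
    have hz' : √(chiSqCrit α) ≤ |z.2| := Real.sqrt_le_iff.2 ⟨abs_nonneg _, by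
      rw [sq_abs]; exact hz⟩
    exact mul_nonneg (sub_nonneg.2 (h01 z).2) (sub_nonneg.2 (expChord_le_exp hc hz' η))
  · rw [Set.indicator_of_notMem hz, zero_sub]
    have hz' : |z.2| ≤ √(chiSqCrit α) := Real.le_sqrt_of_sq_le (by
      rw [sq_abs]; exact (not_le.1 hz).le)
    exact mul_nonneg_of_nonpos_of_nonpos (neg_nonpos.2 (h01 z).1)
      (sub_nonpos.2 (exp_le_expChord hc hz' η))

include hα in
lemma npGain_pos (hη : η ≠ 0) {z : ℝ × ℝ} (hz : z ∉ chiRegion α) (hφ : 0 < φ z) :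
    0 < npGain α φ η z := by
  have hc := Real.sqrt_pos.2 (chiSqCrit_pos hα)
  unfold npGain
  rw [Set.indicator_of_notMem hz, zero_sub]
  have hz' : |z.2| < √(chiSqCrit α) := Real.lt_sqrt_of_sq_lt (by
    rw [sq_abs]; exact not_le.1 hz)
  exact mul_pos_of_neg_of_neg (neg_neg_of_pos hφ) (sub_neg.2 (exp_lt_expChord hc hz' hη))

include hm h01 in
lemma integrable_npGain : Integrable (npGain α φ η) (normalPair 0 0) := by
  have hf : Integrable (fun z : ℝ × ℝ => Real.exp (η * z.2) - expChord η √(chiSqCrit α) z.2)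
      (normalPair 0 0) :=
    (integrable_exp_snd η).sub ((integrable_const _).add (integrable_snd_normalPair.const_mul _))
  refine ((integrable_mul_test hf (measurable_one.indicator (measurableSet_chiRegion α))
    (indicator_chiRegion_mem α)).sub (integrable_mul_test hf hm h01)).congr (ae_of_all _ fun z => ?_)
  simp only [npGain, Pi.sub_apply]
  ring

include hα hm h01 hsize horth in
-- When the chord is expanded, its linear term integrates to zero against both tests, and its
-- constant term multiplies the difference of the sizes, which has the favourable sign. What remains
-- is `exp (η²/2)` times the difference of the powers.
lemma exp_mul_integral_npGain_le : Real.exp (-(η ^ 2 / 2)) * ∫ z, npGain α φ η z ∂(normalPair 0 0) ≤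
    (normalPair 0 η).real (chiRegion α) - ∫ z, φ z ∂(normalPair 0 η) := by
  set φs := (chiRegion α).indicator (1 : ℝ × ℝ → ℝ) with hφs
  have hms : Measurable φs := measurable_one.indicator (measurableSet_chiRegion α)
  have h01s : ∀ z, φs z ∈ Set.Icc (0 : ℝ) 1 := indicator_chiRegion_mem α
  set c := √(chiSqCrit α)
  have horths : ∫ z, z.2 * φs z ∂(normalPair 0 0) = 0 := by
    refine integral_snd_mul_of_even_snd fun x y => ?_
    simp [hφs, Set.indicator, chiRegion]
  have hsizes : ∫ z, φs z ∂(normalPair 0 0) = α := by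
    rw [hφs, integral_indicator_one (measurableSet_chiRegion α), normalPair_chiRegion_zero hα]
  have key (ψ : ℝ × ℝ → ℝ) (hψm : Measurable ψ) (hψ : ∀ z, ψ z ∈ Set.Icc (0 : ℝ) 1)
      (ho : ∫ z, z.2 * ψ z ∂(normalPair 0 0) = 0) :
      Integrable (fun z => (Real.exp (η * z.2) - expChord η c z.2) * ψ z) (normalPair 0 0) ∧
      ∫ z, (Real.exp (η * z.2) - expChord η c z.2) * ψ z ∂(normalPair 0 0) =
        Real.exp (η ^ 2 / 2) * ∫ z, ψ z ∂(normalPair 0 η) -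
          Real.cosh (η * c) * ∫ z, ψ z ∂(normalPair 0 0) := by
    have i1 := integrable_mul_test (integrable_exp_snd η) hψm hψ
    have i2 := (integrable_test (μ := normalPair 0 0) hψm hψ).const_mul (Real.cosh (η * c))
    have i3 := (integrable_mul_test integrable_snd_normalPair hψm hψ).const_mul
      (Real.sinh (η * c) / c)
    have he : (fun z : ℝ × ℝ => (Real.exp (η * z.2) - expChord η c z.2) * ψ z) = fun z =>
        Real.exp (η * z.2) * ψ z - Real.cosh (η * c) * ψ z -
          Real.sinh (η * c) / c * (z.2 * ψ z) := by
      ext z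
      rw [expChord]
      ring
    refine ⟨he ▸ (i1.sub i2).sub i3, ?_⟩
    have e4 : Real.exp (η ^ 2 / 2) * ∫ z, ψ z ∂(normalPair 0 η) =
        ∫ z, Real.exp (η * z.2) * ψ z ∂(normalPair 0 0) := by
      rw [integral_normalPair_zero η, ← integral_const_mul]
      simp_rw [← mul_assoc, ← Real.exp_add, add_sub_cancel]
    have e3 := integral_sub (i1.sub i2) i3
    simp only [Pi.sub_apply] at e3
    rw [he, e3, integral_sub i1 i2, integral_const_mul, integral_const_mul,
      ho, e4]
    ring
  obtain ⟨j1, e1⟩ := key φs hms h01s horths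
  obtain ⟨j2, e2⟩ := key φ hm h01 horth
  have hD : ∫ z, npGain α φ η z ∂(normalPair 0 0) =
      Real.exp (η ^ 2 / 2) * ∫ z, φs z ∂(normalPair 0 η) - Real.cosh (η * c) * α -
      (Real.exp (η ^ 2 / 2) * ∫ z, φ z ∂(normalPair 0 η) -
        Real.cosh (η * c) * ∫ z, φ z ∂(normalPair 0 0)) := by
    rw [show Real.cosh (η * c) * α = Real.cosh (η * c) * ∫ z, φs z ∂(normalPair 0 0) by rw [hsizes],
      ← e1, ← e2, ← integral_sub j1 j2]
    refine integral_congr_ae (ae_of_all _ fun z => ?_)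
    show (φs z - φ z) * (Real.exp (η * z.2) - expChord η c z.2) = _
    ring
  have hE : Real.exp (-(η ^ 2 / 2)) * Real.exp (η ^ 2 / 2) = 1 := by
    rw [← Real.exp_add, neg_add_cancel, Real.exp_zero]
  have hφsint : ∫ z, φs z ∂(normalPair 0 η) = (normalPair 0 η).real (chiRegion α) :=
    integral_indicator_one (measurableSet_chiRegion α)
  rw [hD, ← hφsint]
  have hcosh : 0 ≤ Real.exp (-(η ^ 2 / 2)) * (Real.cosh (η * c) *
      (α - ∫ z, φ z ∂(normalPair 0 0))) :=
    mul_nonneg (Real.exp_pos _).le (mul_nonneg (Real.cosh_pos _).le (by linarith))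
  linear_combination hcosh + (∫ z, φs z ∂(normalPair 0 η) - ∫ z, φ z ∂(normalPair 0 η)) * hE

include hα hm h01 hsize horth in
/-- The test based on the square of the second coordinate is most powerful among the level-`α`
tests uncorrelated with the second coordinate under the null hypothesis. -/
theorem integral_le_chiRegion :
    ∫ z, φ z ∂(normalPair 0 η) ≤ (normalPair 0 η).real (chiRegion α) := by
  have := exp_mul_integral_npGain_le hα hm h01 hsize horth η
  have h2 : 0 ≤ Real.exp (-(η ^ 2 / 2)) * ∫ z, npGain α φ η z ∂(normalPair 0 0) :=
    mul_nonneg (Real.exp_pos _).le (integral_nonneg (npGain_nonneg hα h01 η))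
  linarith

include hα hm h01 hsize horth in
-- Off the region the chord strictly exceeds the exponential, so a test rejecting there with
-- positive probability loses a positive amount.
theorem integral_lt_chiRegion {η : ℝ} (hη : η ≠ 0)
    (hpos : 0 < normalPair 0 0 {z | z ∉ chiRegion α ∧ 0 < φ z}) :
    ∫ z, φ z ∂(normalPair 0 η) < (normalPair 0 η).real (chiRegion α) := by
  have := exp_mul_integral_npGain_le hα hm h01 hsize horth η
  have h2 : 0 < ∫ z, npGain α φ η z ∂(normalPair 0 0) := by
    rw [integral_pos_iff_support_of_nonneg (npGain_nonneg hα h01 η) (integrable_npGain hm h01 η)]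
    exact hpos.trans_le (measure_mono fun z hz => (npGain_pos hα η hη hz.1 hz.2).ne')
  have h3 := mul_pos (Real.exp_pos (-(η ^ 2 / 2))) h2
  linarith

end optimality

lemma quadPower_eq_integral (α : ℝ) (a : ℝ × ℝ) (ρ m₁ m₂ : ℝ) : quadPower α a ρ m₁ m₂ =
    ∫ z, {z : ℝ × ℝ | critVal α a ρ ≤ quadForm a ρ z.1 z.2}.indicator (1 : ℝ × ℝ → ℝ) z
      ∂(normalPair m₁ m₂) :=
  (integral_indicator_one (measurableSet_le measurable_const
    (continuous_quadForm_apply a ρ).measurable)).symm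

/-- A quadratic form need not be even in `z₂` alone, but it is invariant under `z ↦ -z`, which
already gives orthogonality to `z₂`. -/
lemma quadPower_optimality_aux {α : ℝ} (hα : α ∈ Set.Ioo (0 : ℝ) 1) {a : ℝ × ℝ}
    (ha : a ∈ admissible) (ρ : ℝ) (φ : ℝ × ℝ → ℝ)
    (hφ : φ = {z : ℝ × ℝ | critVal α a ρ ≤ quadForm a ρ z.1 z.2}.indicator 1) :
    Measurable φ ∧ (∀ z, φ z ∈ Set.Icc (0 : ℝ) 1) ∧ ∫ z, φ z ∂(normalPair 0 0) ≤ α ∧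
      ∫ z, z.2 * φ z ∂(normalPair 0 0) = 0 := by
  refine ⟨?_, fun z => ?_, ?_, integral_snd_mul_of_even fun x y => ?_⟩
  · rw [hφ]
    exact measurable_one.indicator (measurableSet_le measurable_const
      (continuous_quadForm_apply a ρ).measurable)
  · rw [hφ]
    by_cases h : z ∈ {z : ℝ × ℝ | critVal α a ρ ≤ quadForm a ρ z.1 z.2} <;> simp [Set.indicator_of_mem, Set.indicator_of_notMem, h]
  · rw [hφ, ← quadPower_eq_integral, quadPower_zero hα ha]
  · have : quadForm a ρ (-x) (-y) = quadForm a ρ x y := by unfold quadForm; ring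
    simp [hφ, Set.indicator, this]

/-- No quadratic test has more power than the test based on `z₂²` against a shift of `z₂`. -/
lemma quadPower_le_chiRegion {α : ℝ} (hα : α ∈ Set.Ioo (0 : ℝ) 1) {a : ℝ × ℝ}
    (ha : a ∈ admissible) (ρ η : ℝ) :
    quadPower α a ρ 0 η ≤ (normalPair 0 η).real (chiRegion α) := by
  obtain ⟨h1, h2, h3, h4⟩ := quadPower_optimality_aux hα ha ρ _ rfl
  rw [quadPower_eq_integral]
  exact integral_le_chiRegion hα h1 h2 h3 h4 η

lemma quadPower_lt_chiRegion {α : ℝ} (hα : α ∈ Set.Ioo (0 : ℝ) 1) {a : ℝ × ℝ}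
    (ha : a ∈ admissible) {ρ η : ℝ} (hη : η ≠ 0) (hne : ¬ (a.1 = 0 ∧ a.2 * ρ = 0)) :
    quadPower α a ρ 0 η < (normalPair 0 η).real (chiRegion α) := by
  obtain ⟨h1, h2, h3, h4⟩ := quadPower_optimality_aux hα ha ρ _ rfl
  rw [quadPower_eq_integral]
  refine integral_lt_chiRegion hα h1 h2 h3 h4 hη ?_
  have hU : IsOpen {z : ℝ × ℝ | z.2 ^ 2 < chiSqCrit α ∧ critVal α a ρ < quadForm a ρ z.1 z.2} :=
    (isOpen_lt (f := fun z : ℝ × ℝ => z.2 ^ 2) (by fun_prop) continuous_const).inter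
      (isOpen_lt continuous_const (continuous_quadForm_apply a ρ))
  -- This is the coefficient of `x²` in the form at `(x, 0)`. Being positive, it makes the quadratic
  -- test reject near a point with `z₂ = 0`, where `z₂²` does not.
  have hk : 0 < a.1 + a.2 * ρ ^ 2 := by
    rcases ha.1.lt_or_eq with h | h
    · have := mul_nonneg ha.2.1 (sq_nonneg ρ)
      linarith
    · have h5 : a.2 * ρ ≠ 0 := fun h6 => hne ⟨h.symm, h6⟩
      have h6 := ha.2.1.lt_of_ne' (left_ne_zero_of_mul h5)
      have h7 := right_ne_zero_of_mul h5
      have : 0 < a.2 * ρ ^ 2 := by positivity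
      linarith
  have hcp := critVal_pos hα ha ρ
  refine (normalPair_pos_of_isOpen 0 0 hU
    ⟨(√((critVal α a ρ + 1) / (a.1 + a.2 * ρ ^ 2)), 0), ?_, ?_⟩).trans_le (measure_mono ?_)
  · simpa using chiSqCrit_pos hα
  · have h5 : √((critVal α a ρ + 1) / (a.1 + a.2 * ρ ^ 2)) ^ 2 =
        (critVal α a ρ + 1) / (a.1 + a.2 * ρ ^ 2) := Real.sq_sqrt (by positivity)
    have : quadForm a ρ √((critVal α a ρ + 1) / (a.1 + a.2 * ρ ^ 2)) 0 = critVal α a ρ + 1 := by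
      calc _ = (a.1 + a.2 * ρ ^ 2) * √((critVal α a ρ + 1) / (a.1 + a.2 * ρ ^ 2)) ^ 2 := by
            unfold quadForm; ring
        _ = _ := by rw [h5]; field_simp
    show critVal α a ρ < quadForm a ρ _ 0
    rw [this]
    linarith
  · rintro z ⟨hz1, hz2⟩
    refine ⟨not_le.2 hz1, ?_⟩
    rw [Set.indicator_of_mem (show z ∈ {z : ℝ × ℝ | critVal α a ρ ≤ quadForm a ρ z.1 z.2} from hz2.le)]
    exact one_pos


/-! ### Convergence of the variance components -/

namespace VarComp

lemma coef_zero (g : VarComp) :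
    g.coef 0 = (g.Φ₁ * g.Ψ - g.Φ₁₂ * g.Φ₁₂)⁻¹ * (g.Ψ * g.Φ₁₃ - g.Φ₁₂ * g.τ) := by
  simp [coef, Matrix.inv_def, Matrix.det_fin_two, Matrix.adjugate_fin_two, Matrix.mulVec,
    dotProduct, Fin.sum_univ_two]
  ring

lemma coef_one (g : VarComp) :
    g.coef 1 = (g.Φ₁ * g.Ψ - g.Φ₁₂ * g.Φ₁₂)⁻¹ * (g.Φ₁ * g.τ - g.Φ₁₂ * g.Φ₁₃) := by
  simp [coef, Matrix.inv_def, Matrix.det_fin_two, Matrix.adjugate_fin_two, Matrix.mulVec,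
    dotProduct, Fin.sum_univ_two]
  ring

lemma bracket_eq (g : VarComp) (δ : ℝ) : g.bracket δ = 1 - (δ ^ 2 * g.coef 0 + δ * g.coef 1) := by
  simp [bracket, dotProduct, Fin.sum_univ_two]

lemma σD_eq (g : VarComp) : g.σD = √(g.Υ - (g.Φ₁₃ * g.coef 0 + g.τ * g.coef 1)) := by
  simp [σD, dotProduct, Fin.sum_univ_two]

/-- The limiting variance components are nondegenerate. -/
structure Regular (g : VarComp) : Prop where
  Φ₁_pos : 0 < g.Φ₁
  Ψ_pos : 0 < g.Ψ
  det_pos : 0 < g.Φ₁ * g.Ψ - g.Φ₁₂ * g.Φ₁₂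
  ρ_sq_lt : g.ρ ^ 2 < 1
  σD_pos : 0 < g.σD

/-- Coordinatewise convergence of variance components. -/
structure ConvergesTo {ι : Type*} (g : ι → VarComp) (l : Filter ι) (g₀ : VarComp) : Prop where
  Φ₁ : Tendsto (fun i => (g i).Φ₁) l (𝓝 g₀.Φ₁)
  Φ₁₂ : Tendsto (fun i => (g i).Φ₁₂) l (𝓝 g₀.Φ₁₂)
  Φ₁₃ : Tendsto (fun i => (g i).Φ₁₃) l (𝓝 g₀.Φ₁₃)
  Ψ : Tendsto (fun i => (g i).Ψ) l (𝓝 g₀.Ψ)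
  τ : Tendsto (fun i => (g i).τ) l (𝓝 g₀.τ)
  Υ : Tendsto (fun i => (g i).Υ) l (𝓝 g₀.Υ)
  ρ : Tendsto (fun i => (g i).ρ) l (𝓝 g₀.ρ)

lemma convergesTo_of_toVec {ι : Type*} {g : ι → VarComp} {l : Filter ι} {g₀ : VarComp}
    (h : Tendsto (fun i => (g i).toVec) l (𝓝 g₀.toVec)) : ConvergesTo g l g₀ := by
  have hj (j : Fin 7) : Tendsto (fun i => (g i).toVec j) l (𝓝 (g₀.toVec j)) :=
    ((EuclideanSpace.proj (𝕜 := ℝ) j).continuous.tendsto _).comp h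
  exact ⟨hj 0, hj 1, hj 2, hj 3, hj 4, hj 5, hj 6⟩

namespace ConvergesTo

variable {ι κ : Type*} {g : ι → VarComp} {l : Filter ι} {g₀ : VarComp}

lemma comp (h : ConvergesTo g l g₀) {k : Filter κ} {u : κ → ι} (hu : Tendsto u k l) :
    ConvergesTo (g ∘ u) k g₀ :=
  ⟨h.Φ₁.comp hu, h.Φ₁₂.comp hu, h.Φ₁₃.comp hu, h.Ψ.comp hu, h.τ.comp hu, h.Υ.comp hu, h.ρ.comp hu⟩

lemma coef_zero (h : ConvergesTo g l g₀) (hr : g₀.Regular) :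
    Tendsto (fun i => (g i).coef 0) l (𝓝 (g₀.coef 0)) := by
  simp_rw [VarComp.coef_zero]
  exact (((h.Φ₁.mul h.Ψ).sub (h.Φ₁₂.mul h.Φ₁₂)).inv₀ hr.det_pos.ne').mul
    ((h.Ψ.mul h.Φ₁₃).sub (h.Φ₁₂.mul h.τ))

lemma coef_one (h : ConvergesTo g l g₀) (hr : g₀.Regular) :
    Tendsto (fun i => (g i).coef 1) l (𝓝 (g₀.coef 1)) := by
  simp_rw [VarComp.coef_one]
  exact (((h.Φ₁.mul h.Ψ).sub (h.Φ₁₂.mul h.Φ₁₂)).inv₀ hr.det_pos.ne').mul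
    ((h.Φ₁.mul h.τ).sub (h.Φ₁₂.mul h.Φ₁₃))

lemma σD (h : ConvergesTo g l g₀) (hr : g₀.Regular) :
    Tendsto (fun i => (g i).σD) l (𝓝 g₀.σD) := by
  simp_rw [VarComp.σD_eq]
  exact (h.Υ.sub ((h.Φ₁₃.mul (h.coef_zero hr)).add (h.τ.mul (h.coef_one hr)))).sqrt

lemma sqrt_Φ₁_inv (h : ConvergesTo g l g₀) (hr : g₀.Regular) :
    Tendsto (fun i => (√(g i).Φ₁)⁻¹) l (𝓝 (√g₀.Φ₁)⁻¹) :=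
  h.Φ₁.sqrt.inv₀ (Real.sqrt_pos.2 hr.Φ₁_pos).ne'

lemma sqrt_Ψ_inv (h : ConvergesTo g l g₀) (hr : g₀.Regular) :
    Tendsto (fun i => (√(g i).Ψ)⁻¹) l (𝓝 (√g₀.Ψ)⁻¹) :=
  h.Ψ.sqrt.inv₀ (Real.sqrt_pos.2 hr.Ψ_pos).ne'

lemma sqrt_ρ (h : ConvergesTo g l g₀) :
    Tendsto (fun i => √(1 - (g i).ρ ^ 2)) l (𝓝 √(1 - g₀.ρ ^ 2)) :=
  ((h.ρ.pow 2).const_sub 1).sqrt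

lemma _root_.JackknifeCLC.VarComp.Regular.sqrt_ρ_pos (hr : g₀.Regular) : 0 < √(1 - g₀.ρ ^ 2) :=
  Real.sqrt_pos.2 (by linarith [hr.ρ_sq_lt])

lemma sqrt_ρ_inv (h : ConvergesTo g l g₀) (hr : g₀.Regular) :
    Tendsto (fun i => (√(1 - (g i).ρ ^ 2))⁻¹) l (𝓝 (√(1 - g₀.ρ ^ 2))⁻¹) :=
  h.sqrt_ρ.inv₀ hr.sqrt_ρ_pos.ne'

lemma eventually_pos (h : ConvergesTo g l g₀) (hr : g₀.Regular) :
    ∀ᶠ i in l, 0 < (g i).Φ₁ ∧ 0 < (g i).Ψ ∧ (g i).ρ ^ 2 < 1 := by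
  filter_upwards [h.Φ₁.eventually_const_lt hr.Φ₁_pos, h.Ψ.eventually_const_lt hr.Ψ_pos,
    (h.ρ.pow 2).eventually_lt_const hr.ρ_sq_lt] with i h1 h2 h3
  exact ⟨h1, h2, h3⟩

lemma bracket (h : ConvergesTo g l g₀) (hr : g₀.Regular) {δ : ι → ℝ} {δ₀ : ℝ}
    (hδ : Tendsto δ l (𝓝 δ₀)) : Tendsto (fun i => (g i).bracket (δ i)) l (𝓝 (g₀.bracket δ₀)) := by
  simp_rw [bracket_eq]
  exact (((hδ.pow 2).mul (h.coef_zero hr)).add (hδ.mul (h.coef_one hr))).const_sub 1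

end ConvergesTo

/-- A bound of the bracket over `[-R, R]`. -/
noncomputable def bracketBound (g : VarComp) (R : ℝ) : ℝ := 1 + (R ^ 2 * |g.coef 0| + R * |g.coef 1|)

lemma abs_bracket_le (g : VarComp) {R δ : ℝ} (hδ : |δ| ≤ R) : |g.bracket δ| ≤ g.bracketBound R := by
  rw [bracket_eq, bracketBound]
  refine (abs_sub _ _).trans ?_
  rw [abs_one]
  refine add_le_add_right ((abs_add_le _ _).trans ?_) 1
  rw [abs_mul, abs_mul, abs_pow]
  gcongr

lemma ConvergesTo.bracketBound {ι : Type*} {g : ι → VarComp} {l : Filter ι} {g₀ : VarComp}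
    (h : ConvergesTo g l g₀) (hr : g₀.Regular) (R : ℝ) :
    Tendsto (fun i => (g i).bracketBound R) l (𝓝 (g₀.bracketBound R)) := by
  unfold VarComp.bracketBound
  exact (((h.coef_zero hr).abs.const_mul _).add ((h.coef_one hr).abs.const_mul _)).const_add 1

lemma bracket_sq_le (g : VarComp) {R δ : ℝ} (hδ : |δ| ≤ R) :
    g.bracket δ ^ 2 ≤ g.bracketBound R ^ 2 := by
  rw [← sq_abs]
  exact pow_le_pow_left₀ (abs_nonneg _) (g.abs_bracket_le hδ) 2

end VarComp

/-! ### Bounds of the suprema entering the lower bound of the first weight. -/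

lemma bracket_sq_le_cB {D : Set ℝ} {R : ℝ} (hD : ∀ δ ∈ D, |δ| ≤ R) (g : VarComp) {δ : ℝ}
    (hδ : δ ∈ D) : g.bracket δ ^ 2 ≤ cB D g :=
  le_csSup ⟨g.bracketBound R ^ 2, by
    rintro _ ⟨x, hx, rfl⟩
    exact g.bracket_sq_le (hD x hx)⟩ ⟨δ, hδ, rfl⟩

lemma cB_le {D : Set ℝ} {R : ℝ} (hD : ∀ δ ∈ D, |δ| ≤ R) (hne : D.Nonempty) (g : VarComp) :
    cB D g ≤ g.bracketBound R ^ 2 :=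
  csSup_le (hne.image _) (by
    rintro _ ⟨x, hx, rfl⟩
    exact g.bracket_sq_le (hD x hx))

section critMax

variable {α abar : ℝ} (hα : α ∈ Set.Ioo (0 : ℝ) 1) (habar : abar ∈ Set.Ioo (0 : ℝ) 1)

include habar in
lemma zero_mem_weights₀ : (0 : ℝ × ℝ) ∈ weights₀ abar :=
  ⟨⟨le_rfl, zero_le_one⟩, ⟨le_rfl, zero_le_one⟩, by simpa using habar.1.le⟩

include hα habar in
lemma critVal_le_critMax {a : ℝ × ℝ} (ha : a ∈ weights₀ abar) (ρ : ℝ) :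
    critVal α a ρ ≤ critMax α abar ρ := by
  obtain ⟨c₀, h⟩ := exists_critVal_le hα
  refine le_csSup ⟨(3 + 2 * ρ ^ 2) * c₀, ?_⟩ ⟨a, ha, rfl⟩
  rintro _ ⟨b, hb, rfl⟩
  exact h b (weights₀_subset_admissible habar.2 hb) ρ

include hα habar in
lemma critMax_pos (ρ : ℝ) : 0 < critMax α abar ρ :=
  (critVal_pos hα zero_mem_admissible ρ).trans_le
    (critVal_le_critMax hα habar (zero_mem_weights₀ habar) ρ)

include habar in
lemma critMax_le {c₀ : ℝ} (h : ∀ a ∈ admissible, ∀ ρ, critVal α a ρ ≤ (3 + 2 * ρ ^ 2) * c₀)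
    (ρ : ℝ) : critMax α abar ρ ≤ (3 + 2 * ρ ^ 2) * c₀ :=
  csSup_le (Set.Nonempty.image _ ⟨0, zero_mem_weights₀ habar⟩) (by
    rintro _ ⟨b, hb, rfl⟩
    exact h b (weights₀_subset_admissible habar.2 hb) ρ)

end critMax

lemma isCompact_weights₀ (abar : ℝ) : IsCompact (weights₀ abar) := by
  have h : weights₀ abar =
      (Set.Icc (0 : ℝ) 1 ×ˢ Set.Icc (0 : ℝ) 1) ∩ {a | a.1 + a.2 ≤ abar} := by
    ext a
    exact ⟨fun h => ⟨⟨h.1, h.2.1⟩, h.2.2⟩, fun h => ⟨h.1.1, h.1.2, h.2⟩⟩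
  rw [h]
  exact (isCompact_Icc.prod isCompact_Icc).inter_right (isClosed_le (by fun_prop) continuous_const)

/-! ### Minimax weights when the noncentrality parameter diverges -/

/-- Sequences of calibration problems with converging variance components and diverging
noncentrality parameter. -/
structure Calibration (r R : ℝ) (g₀ : VarComp) (g : ℕ → VarComp) (μ : ℕ → ℝ) (D : ℕ → Set ℝ) :
    Prop where
  regular : g₀.Regular
  conv : VarComp.ConvergesTo g atTop g₀
  tendsto_μ : Tendsto μ atTop atTop
  r_pos : 0 < r
  bound : ∀ n, ∀ δ ∈ D n, |δ| ≤ R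
  rich : ∀ n, Set.Icc 0 r ⊆ D n ∨ Set.Icc (-r) 0 ⊆ D n

namespace Calibration

variable {α abar r R : ℝ} {g₀ : VarComp} {g : ℕ → VarComp} {μ : ℕ → ℝ} {D : ℕ → Set ℝ}

lemma comp (h : Calibration r R g₀ g μ D) {u : ℕ → ℕ} (hu : Tendsto u atTop atTop) :
    Calibration r R g₀ (g ∘ u) (μ ∘ u) (D ∘ u) :=
  ⟨h.regular, h.conv.comp hu, h.tendsto_μ.comp hu, h.r_pos, fun n => h.bound (u n),
    fun n => h.rich (u n)⟩

lemma zero_mem (h : Calibration r R g₀ g μ D) (n : ℕ) : (0 : ℝ) ∈ D n :=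
  (h.rich n).elim (fun h' => h' ⟨le_rfl, h.r_pos.le⟩) fun h' => h' ⟨by linarith [h.r_pos], le_rfl⟩

lemma cB_nonneg (h : Calibration r R g₀ g μ D) (n : ℕ) : 0 ≤ cB (D n) (g n) :=
  (sq_nonneg _).trans (bracket_sq_le_cB (h.bound n) (g n) (h.zero_mem n))

/-- In this form the inverse is visibly continuous at `ρ = 0`, where it is `0`, in accordance with
`Δ_* = ±∞`. -/
lemma Δstar_inv (g : VarComp) : g.Δstar⁻¹ = (√g.Φ₁)⁻¹ * √g.Ψ * g.ρ := by
  simp only [VarComp.Δstar, mul_inv, inv_inv]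

/-- The quotient in the definition of `aLower`. -/
noncomputable def aQuot (α abar : ℝ) (D : Set ℝ) (μ : ℝ) (g : VarComp) : ℝ :=
  1.1 * critMax α abar g.ρ * g.Φ₁ * cB D g * g.Δstar⁻¹ ^ 4 * μ⁻¹ ^ 2

lemma aLower_eq {μ : ℝ} (hμ : μ ≠ 0) (α abar : ℝ) (D : Set ℝ) (g : VarComp) :
    aLower α abar D μ g = min 0.01 (aQuot α abar D μ g) := by
  rw [aLower, if_neg hμ, aQuot, div_eq_mul_inv, mul_inv, inv_pow, inv_pow]
  ring_nf

variable (hα : α ∈ Set.Ioo (0 : ℝ) 1) (habar : abar ∈ Set.Ioo (0 : ℝ) 1)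

include hα habar in
lemma aLower_nonneg (h : Calibration r R g₀ g μ D) :
    ∀ᶠ n in atTop, 0 ≤ aLower α abar (D n) (μ n) (g n) := by
  filter_upwards [h.conv.eventually_pos h.regular, h.tendsto_μ.eventually_gt_atTop 0] with n hn hμ
  rw [aLower_eq hμ.ne']
  have h1 := h.cB_nonneg n
  have h2 := (critMax_pos hα habar (g n).ρ).le
  have h3 := hn.1.le
  refine le_min (by norm_num) ?_
  unfold aQuot
  positivity

include hα habar in
-- All factors of the quotient stay bounded except `μ⁻¹ ^ 2`, which vanishes. The suprema `critMax`
-- and `cB` are replaced by continuous majorants, so their own convergence is not needed.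
lemma tendsto_aLower (h : Calibration r R g₀ g μ D) :
    Tendsto (fun n => aLower α abar (D n) (μ n) (g n)) atTop (𝓝 0) := by
  obtain ⟨c₀, hc₀⟩ := exists_critVal_le hα
  have hlim : Tendsto (fun n => 1.1 * ((3 + 2 * (g n).ρ ^ 2) * c₀) * (g n).Φ₁ *
      (g n).bracketBound R ^ 2 * ((√(g n).Φ₁)⁻¹ * √(g n).Ψ * (g n).ρ) ^ 4 * (μ n)⁻¹ ^ 2) atTop
      (𝓝 (1.1 * ((3 + 2 * g₀.ρ ^ 2) * c₀) * g₀.Φ₁ *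
      g₀.bracketBound R ^ 2 * ((√g₀.Φ₁)⁻¹ * √g₀.Ψ * g₀.ρ) ^ 4 * 0 ^ 2)) := by
    refine Tendsto.mul (Tendsto.mul (Tendsto.mul (Tendsto.mul (Tendsto.const_mul _ ?_) h.conv.Φ₁)
      ((h.conv.bracketBound h.regular R).pow 2)) (((h.conv.sqrt_Φ₁_inv h.regular).mul
      h.conv.Ψ.sqrt).mul h.conv.ρ |>.pow 4)) ((tendsto_inv_atTop_zero.comp h.tendsto_μ).pow 2)
    exact (((h.conv.ρ.pow 2).const_mul 2).const_add 3).mul_const _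
  have hz : (0 : ℝ) ^ 2 = 0 := by norm_num
  rw [hz, mul_zero] at hlim
  refine tendsto_of_tendsto_of_tendsto_of_le_of_le' tendsto_const_nhds hlim
    (h.aLower_nonneg hα habar) ?_
  filter_upwards [h.conv.eventually_pos h.regular, h.tendsto_μ.eventually_gt_atTop 0] with n hn hμ
  rw [aLower_eq hμ.ne']
  refine (min_le_right _ _).trans ?_
  rw [aQuot, Δstar_inv]
  have h1 := h.cB_nonneg n
  have h2 := (critMax_pos hα habar (g n).ρ).le
  have h3 := hn.1.le
  have h4 := critMax_le habar hc₀ (g n).ρ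
  have h5 := cB_le (h.bound n) ⟨0, h.zero_mem n⟩ (g n)
  have h6 : 0 ≤ ((√(g n).Φ₁)⁻¹ * √(g n).Ψ * (g n).ρ) ^ 4 := by positivity
  have h7 := h2.trans h4
  gcongr

include hα habar in
-- These weights are the comparison point for the minimax regret, and they show that the admissible
-- set is eventually nonempty.
lemma eventually_candidate_mem (h : Calibration r R g₀ g μ D) : ∀ᶠ n in atTop,
    ((aLower α abar (D n) (μ n) (g n), 0) : ℝ × ℝ) ∈ weights α abar (D n) (μ n) (g n) := by
  filter_upwards [h.aLower_nonneg hα habar,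
    (h.tendsto_aLower hα habar).eventually_lt_const habar.1] with n h0 h1
  exact ⟨⟨⟨h0, by linarith [habar.2]⟩, ⟨le_rfl, zero_le_one⟩, by simpa using h1.le⟩, le_rfl, h1.le⟩

include hα habar in
lemma tendsto_candidate (h : Calibration r R g₀ g μ D) : Tendsto (fun n =>
    ((aLower α abar (D n) (μ n) (g n), 0) : ℝ × ℝ)) atTop (𝓝 0) :=
  (h.tendsto_aLower hα habar).prodMk_nhds tendsto_const_nhds

include hα habar in
/-- The power of the candidate weights tends to one if the second mean diverges. -/
lemma tendsto_power_candidate_of_C₂ (h : Calibration r R g₀ g μ D) {δ : ℕ → ℝ}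
    (hp : Tendsto (fun n => |(g n).C₂ (δ n) * μ n|) atTop atTop) :
    Tendsto (fun n => power α (μ n) (g n) (δ n) (aLower α abar (D n) (μ n) (g n), 0)) atTop
      (𝓝 1) := by
  simp_rw [power_eq_quadPower]
  obtain ⟨c₀, hc₀⟩ := exists_critVal_le hα
  refine tendsto_quadPower_one fun z₁ z₂ => ?_
  have hcb : Tendsto (fun n => (3 + 2 * (g n).ρ ^ 2) * c₀) atTop (𝓝 ((3 + 2 * g₀.ρ ^ 2) * c₀)) :=
    (((h.conv.ρ.pow 2).const_mul 2).const_add 3).mul_const _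
  set K := (3 + 2 * g₀.ρ ^ 2) * c₀ + 1 with hK
  have hb : 0 < 1 - abar := by linarith [habar.2]
  -- The weight of `z₂²` is at least `1 - abar`, so past this threshold its term alone exceeds the
  -- bound `K` of the critical values. The extra `1` permits passing from `t` to `t² ≥ t`.
  filter_upwards [h.eventually_candidate_mem hα habar, hcb.eventually_lt_const (by linarith : _ < K),
    hp.eventually_ge_atTop (|z₂| + (1 + |K| / (1 - abar)))] with n hmem hcn hpn
  refine (hc₀ _ (weights₀_subset_admissible habar.2 hmem.1) _).trans (hcn.le.trans ?_)
  set L := aLower α abar (D n) (μ n) (g n)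
  set p := (g n).C₂ (δ n) * μ n
  have h1 : 1 + |K| / (1 - abar) ≤ |z₂ + p| := by
    have h2 := abs_sub_abs_le_abs_sub p (-z₂)
    rw [abs_neg, sub_neg_eq_add, add_comm p] at h2
    linarith
  have h0 : 0 ≤ |K| / (1 - abar) := by positivity
  have h2 : |K| / (1 - abar) ≤ (z₂ + p) ^ 2 := by
    rw [← sq_abs]
    nlinarith
  have h3 : K ≤ (1 - abar) * (z₂ + p) ^ 2 := by
    rw [div_le_iff₀ hb] at h2
    linarith [le_abs_self K]
  have h4 : 0 ≤ L * (z₁ + (g n).C₁ (δ n) * μ n) ^ 2 := mul_nonneg hmem.1.1.1 (sq_nonneg _)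
  have h5 : (1 - abar) * (z₂ + p) ^ 2 ≤ (1 - L) * (z₂ + p) ^ 2 :=
    mul_le_mul_of_nonneg_right (by linarith [show L ≤ abar from hmem.2.2]) (sq_nonneg _)
  simp only [quadForm]
  linarith

include hα habar in
/-- The power of the candidate weights tends to one if the first mean diverges and the second one
stays bounded: this is what the lower bound of the first weight ensures. -/
lemma tendsto_power_candidate_of_C₁ (h : Calibration r R g₀ g μ D) {δ : ℕ → ℝ}
    (hδ : ∀ n, δ n ∈ D n) (hm : Tendsto (fun n => |(g n).C₁ (δ n) * μ n|) atTop atTop) {M : ℝ}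
    (hp : ∀ᶠ n in atTop, |(g n).C₂ (δ n) * μ n| ≤ M) :
    Tendsto (fun n => power α (μ n) (g n) (δ n) (aLower α abar (D n) (μ n) (g n), 0)) atTop
      (𝓝 1) := by
  simp_rw [power_eq_quadPower]
  obtain ⟨c₀, hc₀⟩ := exists_critVal_le hα
  set m := fun n => (g n).C₁ (δ n) * μ n with hm_def
  set p := fun n => (g n).C₂ (δ n) * μ n with hp_def
  have hminv : Tendsto (fun n => (m n)⁻¹) atTop (𝓝 0) := by
    rw [tendsto_zero_iff_abs_tendsto_zero]
    simp_rw [Function.comp_def, abs_inv]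
    exact tendsto_inv_atTop_zero.comp hm
  have hpos := h.conv.eventually_pos h.regular
  have hμ := h.tendsto_μ.eventually_gt_atTop 0
  have hm0 : ∀ᶠ n in atTop, m n ≠ 0 := (hm.eventually_gt_atTop 0).mono fun n hn => abs_pos.1 hn
  -- One has `δ p / m = (√Φ₁ / √Ψ - ρ δ) / √(1 - ρ²)`. With `δ`, `p` bounded and `m` divergent this
  -- tends to zero, so `δ` approaches `Δstar`.
  have hratio : Tendsto (fun n => δ n * (g n).Δstar⁻¹) atTop (𝓝 1) := by
    have e1 : Tendsto (fun n => (δ n * p n) * (m n)⁻¹) atTop (𝓝 0) := by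
      refine bdd_le_mul_tendsto_zero' (R * M) ?_ hminv
      filter_upwards [hp] with n hn
      rw [abs_mul]
      have := h.bound n _ (hδ n)
      exact mul_le_mul this hn (abs_nonneg _) ((abs_nonneg _).trans this)
    have e2 : Tendsto (fun n => 1 - √(g n).Ψ * √(1 - (g n).ρ ^ 2) * (√(g n).Φ₁)⁻¹ *
        ((δ n * p n) * (m n)⁻¹)) atTop (𝓝 1) := by
      simpa using (((h.conv.Ψ.sqrt.mul h.conv.sqrt_ρ).mul
        (h.conv.sqrt_Φ₁_inv h.regular)).mul e1).const_sub 1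
    refine e2.congr' ?_
    filter_upwards [hpos, hμ, hm0] with n hn hμn hmn
    rw [Δstar_inv]
    have hs : √(1 - (g n).ρ ^ 2) ≠ 0 := (Real.sqrt_pos.2 (by linarith [hn.2.2])).ne'
    have h1 : √(g n).Φ₁ ≠ 0 := (Real.sqrt_pos.2 hn.1).ne'
    have h2 : √(g n).Ψ ≠ 0 := (Real.sqrt_pos.2 hn.2.1).ne'
    have hb : (g n).bracket (δ n) ≠ 0 := fun hb => hmn (by simp [hm_def, VarComp.C₁, hb])
    have hd : δ n ≠ 0 := fun hb => hmn (by simp [hm_def, VarComp.C₁, hb])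
    simp only [hm_def, hp_def, VarComp.C₁, VarComp.C₂]
    field_simp
    ring
  -- If the minimum is `0.01`, divergence of `m` suffices. Otherwise the product is `1.1 critMax
  -- (δ/Δstar)⁴ cB / bracket²`, where the fourth power tends to `1` and `cB ≥ bracket²`. Retaining
  -- `1.05` of the `1.1` leaves room both for this limit and for the perturbation of `m` by `z₁`
  -- below.
  have hLm : ∀ᶠ n in atTop, 1.05 * critMax α abar (g n).ρ ≤
      aLower α abar (D n) (μ n) (g n) * m n ^ 2 := by
    have hcb : Tendsto (fun n => 1.05 * ((3 + 2 * (g n).ρ ^ 2) * c₀)) atTop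
        (𝓝 (1.05 * ((3 + 2 * g₀.ρ ^ 2) * c₀))) :=
      ((((h.conv.ρ.pow 2).const_mul 2).const_add 3).mul_const _).const_mul _
    have hm2 : Tendsto (fun n => 0.01 * |m n| ^ 2) atTop atTop :=
      ((tendsto_pow_atTop two_ne_zero).comp hm).const_mul_atTop (by norm_num)
    have hr4 : ∀ᶠ n in atTop, 1.05 / 1.1 < (δ n * (g n).Δstar⁻¹) ^ 4 :=
      (hratio.pow 4).eventually_const_lt (by norm_num)
    filter_upwards [hpos, hμ, hm0, hr4, hcb.eventually_lt_const (lt_add_one _),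
      hm2.eventually_ge_atTop (1.05 * ((3 + 2 * g₀.ρ ^ 2) * c₀) + 1)] with n hn hμn hmn hrn hc1 hc2
    have hcp := critMax_pos hα habar (g n).ρ
    rw [aLower_eq hμn.ne', min_mul_of_nonneg _ _ (sq_nonneg _)]
    refine le_min ?_ ?_
    · have := critMax_le habar hc₀ (g n).ρ
      rw [sq_abs] at hc2
      linarith
    · have hb : (g n).bracket (δ n) ≠ 0 := fun hb => hmn (by simp [hm_def, VarComp.C₁, hb])
      have h1 : √(g n).Φ₁ ≠ 0 := (Real.sqrt_pos.2 hn.1).ne'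
      have hbp : 0 < (g n).bracket (δ n) ^ 2 := by positivity
      have hcb : 1 ≤ cB (D n) (g n) / (g n).bracket (δ n) ^ 2 :=
        (one_le_div hbp).2 (bracket_sq_le_cB (h.bound n) (g n) (hδ n))
      have e : aQuot α abar (D n) (μ n) (g n) * m n ^ 2 = 1.1 * critMax α abar (g n).ρ *
          ((δ n * (g n).Δstar⁻¹) ^ 4 * (cB (D n) (g n) / (g n).bracket (δ n) ^ 2)) := by
        have hsq : √(g n).Φ₁ ^ 2 = (g n).Φ₁ := Real.sq_sqrt hn.1.le
        have e1 : m n ^ 2 = (g n).Φ₁⁻¹ * δ n ^ 4 * ((g n).bracket (δ n) ^ 2)⁻¹ * μ n ^ 2 := by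
          simp only [hm_def, VarComp.C₁]
          rw [mul_pow, mul_pow, mul_pow, inv_pow, hsq]
          ring
        rw [e1, aQuot]
        have := hn.1.ne'
        have := hμn.ne'
        field_simp
      rw [e]
      have h3 : 1.05 / 1.1 ≤ (δ n * (g n).Δstar⁻¹) ^ 4 *
          (cB (D n) (g n) / (g n).bracket (δ n) ^ 2) :=
        hrn.le.trans (le_mul_of_one_le_right (by positivity) hcb)
      calc 1.05 * critMax α abar (g n).ρ = 1.1 * critMax α abar (g n).ρ * (1.05 / 1.1) := by ring
        _ ≤ _ := mul_le_mul_of_nonneg_left h3 (by positivity)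
  refine tendsto_quadPower_one fun z₁ z₂ => ?_
  have hz : ∀ᶠ n in atTop, 1 / 1.05 < (1 + z₁ * (m n)⁻¹) ^ 2 := by
    have : Tendsto (fun n => (1 + z₁ * (m n)⁻¹) ^ 2) atTop (𝓝 ((1 + z₁ * 0) ^ 2)) :=
      ((hminv.const_mul z₁).const_add 1).pow 2
    exact this.eventually_const_lt (by norm_num)
  filter_upwards [h.eventually_candidate_mem hα habar, hLm, hz, hm0] with n hmem hL hzn hmn
  refine (critVal_le_critMax hα habar hmem.1 _).trans ?_
  have hcp := critMax_pos hα habar (g n).ρ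
  set L := aLower α abar (D n) (μ n) (g n)
  have h1 : L * (z₁ + m n) ^ 2 = L * m n ^ 2 * (1 + z₁ * (m n)⁻¹) ^ 2 := by
    field_simp
    ring
  have h2 : critMax α abar (g n).ρ ≤ L * (z₁ + m n) ^ 2 := by
    rw [h1]
    calc critMax α abar (g n).ρ = 1.05 * critMax α abar (g n).ρ * (1 / 1.05) := by ring
      _ ≤ _ := mul_le_mul hL hzn.le (by norm_num) (by nlinarith)
  have h3 : 0 ≤ (1 - L) * (z₂ + p n) ^ 2 :=
    mul_nonneg (by linarith [show L ≤ abar from hmem.2.2, habar.2]) (sq_nonneg _)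
  simp only [quadForm]
  linarith

/-- If both means stay bounded, then the first one vanishes in the limit. -/
lemma tendsto_C₁_zero (h : Calibration r R g₀ g μ D) {δ : ℕ → ℝ}
    (hδ : ∀ n, δ n ∈ D n) (hb : ∀ n, (g n).bracket (δ n) ≠ 0) {M : ℝ}
    (hm : ∀ n, |(g n).C₁ (δ n) * μ n| ≤ M) (hp : ∀ n, |(g n).C₂ (δ n) * μ n| ≤ M) :
    Tendsto (fun n => (g n).C₁ (δ n) * μ n) atTop (𝓝 0) := by
  have hpos := h.conv.eventually_pos h.regular
  have hμ := h.tendsto_μ.eventually_gt_atTop 0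
  have hμinv : Tendsto (fun n => (μ n)⁻¹) atTop (𝓝 0) := tendsto_inv_atTop_zero.comp h.tendsto_μ
  -- `δ²` is the bounded first mean times bounded factors, divided by `μ`.
  have hδ0 : Tendsto δ atTop (𝓝 0) := by
    have h1 : Tendsto (fun n => M * √(g n).Φ₁ * (g n).bracketBound R * (μ n)⁻¹) atTop (𝓝 0) := by
      simpa using ((h.conv.Φ₁.sqrt.const_mul M).mul
        (h.conv.bracketBound h.regular R)).mul hμinv
    have h2 : Tendsto (fun n => δ n ^ 2) atTop (𝓝 0) := by
      refine tendsto_of_tendsto_of_tendsto_of_le_of_le' tendsto_const_nhds h1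
        (Eventually.of_forall fun n => sq_nonneg _) ?_
      filter_upwards [hpos, hμ] with n hn hμn
      have h3 := hm n
      have h4 := (g n).abs_bracket_le (h.bound n _ (hδ n))
      have h5 : √(g n).Φ₁ ≠ 0 := (Real.sqrt_pos.2 hn.1).ne'
      have h6 : δ n ^ 2 = |(g n).C₁ (δ n) * μ n| * √(g n).Φ₁ * |(g n).bracket (δ n)| * (μ n)⁻¹ := by
        rw [VarComp.C₁, abs_mul, abs_mul, abs_mul, abs_inv, abs_inv, abs_of_pos hμn,
          abs_of_nonneg (Real.sqrt_nonneg (g n).Φ₁), abs_of_nonneg (sq_nonneg (δ n))]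
        have := abs_ne_zero.2 (hb n)
        have := hμn.ne'
        field_simp
      rw [h6]
      have hM : 0 ≤ M := (abs_nonneg _).trans h3
      have := inv_nonneg.2 hμn.le
      gcongr
    have h3 := h2.sqrt
    simp only [Real.sqrt_sq_eq_abs, Real.sqrt_zero] at h3
    exact (tendsto_zero_iff_abs_tendsto_zero _).2 h3
  have hbr : Tendsto (fun n => (g n).bracket (δ n)) atTop (𝓝 1) := by
    have := h.conv.bracket h.regular hδ0
    simpa [VarComp.bracket_eq] using this
  have hfac : Tendsto (fun n => (√(g n).Ψ)⁻¹ - (g n).ρ * (√(g n).Φ₁)⁻¹ * δ n) atTop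
      (𝓝 (√g₀.Ψ)⁻¹) := by
    simpa using (h.conv.sqrt_Ψ_inv h.regular).sub
      ((h.conv.ρ.mul (h.conv.sqrt_Φ₁_inv h.regular)).mul hδ0)
  have hfac0 : (√g₀.Ψ)⁻¹ ≠ 0 := inv_ne_zero (Real.sqrt_pos.2 h.regular.Ψ_pos).ne'
  -- The first mean is the second times this factor, because near `0` the first is quadratic in `δ`
  -- and the second linear.
  have he : Tendsto (fun n => (√(g n).Φ₁)⁻¹ * δ n * √(1 - (g n).ρ ^ 2) *
      ((√(g n).Ψ)⁻¹ - (g n).ρ * (√(g n).Φ₁)⁻¹ * δ n)⁻¹) atTop (𝓝 0) := by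
    simpa using (((h.conv.sqrt_Φ₁_inv h.regular).mul hδ0).mul h.conv.sqrt_ρ).mul (hfac.inv₀ hfac0)
  refine (bdd_le_mul_tendsto_zero' M (Eventually.of_forall hp) he).congr' ?_
  filter_upwards [hpos, hfac.eventually_ne hfac0] with n hn hf
  have hs : √(1 - (g n).ρ ^ 2) ≠ 0 := (Real.sqrt_pos.2 (by linarith [hn.2.2])).ne'
  have e : (√(g n).Ψ)⁻¹ * δ n - (g n).ρ * (√(g n).Φ₁)⁻¹ * δ n ^ 2 =
      δ n * ((√(g n).Ψ)⁻¹ - (g n).ρ * (√(g n).Φ₁)⁻¹ * δ n) := by ring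
  rw [VarComp.C₁, VarComp.C₂, e]
  generalize (√(g n).Ψ)⁻¹ - (g n).ρ * (√(g n).Φ₁)⁻¹ * δ n = f at hf
  field_simp

end Calibration


/-! ### Regret of the candidate weights and limit points of the minimax weights. -/

lemma power_nonneg (α μ : ℝ) (g : VarComp) (δ : ℝ) (a : ℝ × ℝ) : 0 ≤ power α μ g δ a :=
  measureReal_nonneg

lemma power_le_one (α μ : ℝ) (g : VarComp) (δ : ℝ) (a : ℝ × ℝ) : power α μ g δ a ≤ 1 :=
  measureReal_le_one

lemma power_le_maxPower (α abar : ℝ) (D : Set ℝ) (μ : ℝ) (g : VarComp) (δ : ℝ) {a : ℝ × ℝ}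
    (ha : a ∈ weights α abar D μ g) : power α μ g δ a ≤ maxPower α abar D μ g δ :=
  le_csSup ⟨1, by rintro _ ⟨b, -, rfl⟩; exact power_le_one _ _ _ _ _⟩ ⟨a, ha, rfl⟩

lemma maxPower_le_one (α abar : ℝ) (D : Set ℝ) (μ : ℝ) (g : VarComp) (δ : ℝ) :
    maxPower α abar D μ g δ ≤ 1 :=
  Real.sSup_le (by rintro _ ⟨b, -, rfl⟩; exact power_le_one _ _ _ _ _) zero_le_one

lemma regret_le_maxRegret (α abar : ℝ) {D : Set ℝ} (μ : ℝ) (g : VarComp) {δ : ℝ} (a : ℝ × ℝ)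
    (hδ : δ ∈ D) :
    maxPower α abar D μ g δ - power α μ g δ a ≤ maxRegret α abar D μ g a :=
  le_csSup ⟨1, by
    rintro _ ⟨x, -, rfl⟩
    show maxPower α abar D μ g x - power α μ g x a ≤ 1
    linarith [maxPower_le_one α abar D μ g x, power_nonneg α μ g x a]⟩ ⟨δ, hδ, rfl⟩

namespace Calibration

variable {α abar r R : ℝ} {g₀ : VarComp} {g : ℕ → VarComp} {μ : ℕ → ℝ} {D : ℕ → Set ℝ}
  (hα : α ∈ Set.Ioo (0 : ℝ) 1) (habar : abar ∈ Set.Ioo (0 : ℝ) 1)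

lemma tendsto_max_sub_of_tendsto_one {u v : ℕ → ℝ} (hu : ∀ n, u n ≤ 1)
    (hv : Tendsto v atTop (𝓝 1)) : Tendsto (fun n => max (u n - v n) 0) atTop (𝓝 0) := by
  have h1 : Tendsto (fun n => |1 - v n|) atTop (𝓝 0) := by
    simpa using (hv.const_sub 1).abs
  refine tendsto_of_tendsto_of_tendsto_of_le_of_le tendsto_const_nhds h1
    (fun n => le_max_right _ _) fun n => max_le ?_ (abs_nonneg _)
  linarith [hu n, le_abs_self (1 - v n)]

include hα habar in
/-- Along a subsequence, the candidate weights do asymptotically at least as well as any others. -/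
lemma exists_subseq_regret_candidate (h : Calibration r R g₀ g μ D) {δ : ℕ → ℝ}
    (hδ : ∀ n, δ n ∈ D n) {a : ℕ → ℝ × ℝ} (ha : ∀ n, a n ∈ weights₀ abar) :
    ∃ u : ℕ → ℕ, Tendsto u atTop atTop ∧ Tendsto (fun n =>
      max (power α (μ (u n)) (g (u n)) (δ (u n)) (a (u n)) -
        power α (μ (u n)) (g (u n)) (δ (u n))
          (aLower α abar (D (u n)) (μ (u n)) (g (u n)), 0)) 0) atTop (𝓝 0) := by
  have hadm (n) : a n ∈ admissible := weights₀_subset_admissible habar.2 (ha n)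
  have hcand := h.eventually_candidate_mem hα habar
  -- Where the bracket vanishes its inverse is `0` by convention, so both means are `0` and every
  -- admissible quadratic test has power `α`.
  by_cases hA : ∃ᶠ n in atTop, (g n).bracket (δ n) = 0
  · obtain ⟨u, hu, hu0⟩ := extraction_of_frequently_atTop hA
    refine ⟨u, hu.tendsto_atTop, tendsto_const_nhds.congr' ?_⟩
    filter_upwards [hu.tendsto_atTop.eventually hcand] with n hn
    have h1 : (g (u n)).C₁ (δ (u n)) = 0 := by simp [VarComp.C₁, hu0 n]
    have h2 : (g (u n)).C₂ (δ (u n)) = 0 := by simp [VarComp.C₂, hu0 n]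
    rw [power_eq_quadPower, power_eq_quadPower, h1, h2, zero_mul, quadPower_zero hα (hadm _),
      quadPower_zero hα (weights₀_subset_admissible habar.2 hn.1), sub_self, max_self]
  rw [not_frequently] at hA
  -- Both means bounded infinitely often: the first one vanishes, the rival weights and the second
  -- mean converge along a further subsequence, and in the limit `chiRegion` is optimal.
  by_cases hB : ∃ M, ∃ᶠ n in atTop, (|(g n).C₁ (δ n) * μ n| ≤ M ∧ |(g n).C₂ (δ n) * μ n| ≤ M)
  · obtain ⟨M, hM⟩ := hB
    obtain ⟨u, hu, hu0⟩ := extraction_of_frequently_atTop (hM.and_eventually hA)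
    have hcomp := h.comp hu.tendsto_atTop
    have hm0 := hcomp.tendsto_C₁_zero (fun n => hδ (u n)) (fun n => (hu0 n).2)
      (fun n => (hu0 n).1.1) fun n => (hu0 n).1.2
    obtain ⟨x, hx, v, hv, hvx⟩ := ((isCompact_weights₀ abar).prod
      (isCompact_Icc (a := -M) (b := M))).tendsto_subseq
        (x := fun n => (a (u n), (g (u n)).C₂ (δ (u n)) * μ (u n)))
        fun n => ⟨ha _, abs_le.1 (hu0 n).1.2⟩
    have hx1 : x.1 ∈ admissible := weights₀_subset_admissible habar.2 hx.1
    have huv : Tendsto (u ∘ v) atTop atTop := hu.tendsto_atTop.comp hv.tendsto_atTop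
    refine ⟨u ∘ v, huv, ?_⟩
    have l1 := tendsto_quadPower hα (Eventually.of_forall fun n => hadm (u (v n))) hx1
      ((continuous_fst.tendsto x).comp hvx) (h.conv.ρ.comp huv) (hm0.comp hv.tendsto_atTop)
      ((continuous_snd.tendsto x).comp hvx)
    have l2 := tendsto_quadPower hα ((huv.eventually hcand).mono fun n hn =>
      weights₀_subset_admissible habar.2 hn.1) zero_mem_admissible
      ((h.tendsto_candidate hα habar).comp huv) (h.conv.ρ.comp huv) (hm0.comp hv.tendsto_atTop)
      ((continuous_snd.tendsto x).comp hvx)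
    have l3 := (l1.sub l2).max (tendsto_const_nhds (x := (0 : ℝ)))
    rwa [max_eq_right (sub_nonpos.2 ?_)] at l3
    rw [quadPower_of_eq_zero (a := 0) rfl (by simp)]
    exact quadPower_le_chiRegion hα hx1 _ _
  push Not at hB
  -- An unbounded second mean diverges along a subsequence.
  by_cases hC : ∀ k : ℕ, ∃ᶠ n in atTop, (k : ℝ) ≤ |(g n).C₂ (δ n) * μ n|
  · obtain ⟨u, hu, hu0⟩ := extraction_forall_of_frequently hC
    have ht : Tendsto (fun n => |(g (u n)).C₂ (δ (u n)) * μ (u n)|) atTop atTop :=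
      tendsto_atTop_mono hu0 tendsto_natCast_atTop_atTop
    exact ⟨u, hu.tendsto_atTop, tendsto_max_sub_of_tendsto_one (fun n => power_le_one _ _ _ _ _)
      ((h.comp hu.tendsto_atTop).tendsto_power_candidate_of_C₂ hα habar (δ := δ ∘ u) ht)⟩
  -- The second mean is eventually bounded, but the two are not jointly bounded along any
  -- subsequence; hence the first diverges.
  · push Not at hC
    obtain ⟨k, hk⟩ := hC
    refine ⟨id, tendsto_id, tendsto_max_sub_of_tendsto_one (fun n => power_le_one _ _ _ _ _)
      (h.tendsto_power_candidate_of_C₁ hα habar hδ ?_ (M := k) (hk.mono fun n hn => hn.le))⟩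
    refine tendsto_atTop.2 fun b => ?_
    filter_upwards [hB (max b k), hk] with n hn hkn
    by_contra! hlt
    exact absurd (hn (hlt.le.trans (le_max_left _ _))) (not_lt.2 (hkn.le.trans (le_max_right _ _)))

include hα habar in
lemma eventually_maxRegret_candidate_le (h : Calibration r R g₀ g μ D) {ε : ℝ} (hε : 0 < ε) :
    ∀ᶠ n in atTop, maxRegret α abar (D n) (μ n) (g n)
      (aLower α abar (D n) (μ n) (g n), 0) ≤ ε := by
  set b : ℕ → ℝ × ℝ := fun n => (aLower α abar (D n) (μ n) (g n), 0)
  -- The suprema over alternatives and over weights need not be attained, so a maximum regret above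
  -- `ε` is witnessed by near-maximizers of both; elsewhere zeros serve as fillers.
  have key (n) : ∃ x : ℝ × (ℝ × ℝ), x.1 ∈ D n ∧ x.2 ∈ weights₀ abar ∧
      (b n ∈ weights α abar (D n) (μ n) (g n) → ε < maxRegret α abar (D n) (μ n) (g n) (b n) →
        ε < power α (μ n) (g n) x.1 x.2 - power α (μ n) (g n) x.1 (b n)) := by
    by_cases hc : b n ∈ weights α abar (D n) (μ n) (g n) ∧
        ε < maxRegret α abar (D n) (μ n) (g n) (b n)
    · obtain ⟨_, ⟨δ, hδ, rfl⟩, h1⟩ := exists_lt_of_lt_csSup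
        (Set.Nonempty.image _ ⟨0, h.zero_mem n⟩) hc.2
      have h2 : ε + power α (μ n) (g n) δ (b n) < maxPower α abar (D n) (μ n) (g n) δ :=
        lt_sub_iff_add_lt.1 h1
      obtain ⟨_, ⟨a, ha, rfl⟩, h3⟩ := exists_lt_of_lt_csSup (Set.Nonempty.image _ ⟨b n, hc.1⟩) h2
      exact ⟨(δ, a), hδ, ha.1, fun _ _ => lt_sub_iff_add_lt.2 h3⟩
    · exact ⟨(0, 0), h.zero_mem n, zero_mem_weights₀ habar, fun h1 h2 => absurd ⟨h1, h2⟩ hc⟩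
  choose x hxD hxw hx using key
  by_contra hcon
  rw [not_eventually] at hcon
  obtain ⟨u, hu, hu0⟩ := extraction_of_frequently_atTop hcon
  obtain ⟨v, hv, hlim⟩ := (h.comp hu.tendsto_atTop).exists_subseq_regret_candidate hα habar
    (δ := fun n => (x (u n)).1) (fun n => hxD (u n)) (a := fun n => (x (u n)).2)
    fun n => hxw (u n)
  have h1 := (hu.tendsto_atTop.comp hv).eventually (h.eventually_candidate_mem hα habar)
  obtain ⟨n, hn1, hn2⟩ := (h1.and (hlim.eventually_lt_const hε)).exists
  have h3 := hx (u (v n)) hn1 (not_le.1 (hu0 (v n)))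
  exact absurd (h3.trans_le (le_max_left _ _)) (not_lt.2 hn2.le)

include hα habar in
/-- A limit point of minimax weights puts no weight on the other two statistics, up to the
degenerate case of a vanishing correlation. -/
lemma eq_zero_of_tendsto_minimaxWeights (h : Calibration r R g₀ g μ D) {a : ℕ → ℝ × ℝ}
    (ha : ∀ n, a n ∈ minimaxWeights α abar (D n) (μ n) (g n)) {a' : ℝ × ℝ}
    (ha' : a' ∈ weights₀ abar) (hlim : Tendsto a atTop (𝓝 a')) : a'.1 = 0 ∧ a'.2 * g₀.ρ = 0 := by
  have hcand := h.eventually_candidate_mem hα habar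
  -- Alternatives at distance `1/μ` from `0` keep the second mean of order one. Their sign depends
  -- on which half-interval `D n` contains, so it may vary with `n` and is stabilized along a
  -- subsequence.
  have hσ (n) : ∃ σ : ℝ, |σ| = 1 ∧ (r⁻¹ ≤ μ n → σ * (μ n)⁻¹ ∈ D n) := by
    have hr (hμ : r⁻¹ ≤ μ n) : 0 ≤ (μ n)⁻¹ ∧ (μ n)⁻¹ ≤ r :=
      ⟨inv_nonneg.2 ((inv_pos.2 h.r_pos).le.trans hμ), inv_le_of_inv_le₀ h.r_pos hμ⟩
    rcases h.rich n with h1 | h1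
    · exact ⟨1, by simp, fun hμ => h1 (by simpa using hr hμ)⟩
    · exact ⟨-1, by simp, fun hμ => h1 ⟨by linarith [(hr hμ).2], by linarith [(hr hμ).1]⟩⟩
  choose σ hσ1 hσD using hσ
  obtain ⟨σ', -, u, hu, huσ⟩ := (isCompact_Icc (a := (-1 : ℝ)) (b := 1)).tendsto_subseq (x := σ)
    fun n => abs_le.1 (hσ1 n).le
  have hσ' : |σ'| = 1 := tendsto_nhds_unique huσ.abs (by
    simp_rw [Function.comp_apply, hσ1]; exact tendsto_const_nhds)
  have hut := hu.tendsto_atTop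
  have hc := (h.comp hut).conv
  have hreg := h.regular
  have hμ : Tendsto (μ ∘ u) atTop atTop := h.tendsto_μ.comp hut
  have hμinv : Tendsto (fun n => (μ (u n))⁻¹) atTop (𝓝 0) := tendsto_inv_atTop_zero.comp hμ
  set δ : ℕ → ℝ := fun n => σ (u n) * (μ (u n))⁻¹ with hδ_def
  have hδ : Tendsto δ atTop (𝓝 0) := by simpa using huσ.mul hμinv
  have hbr : Tendsto (fun n => ((g (u n)).bracket (δ n))⁻¹) atTop (𝓝 1) := by
    have h1 := hc.bracket hreg hδ
    have h2 : g₀.bracket 0 = 1 := by simp [VarComp.bracket_eq]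
    rw [h2] at h1
    simpa using h1.inv₀ one_ne_zero
  set η := (√(1 - g₀.ρ ^ 2))⁻¹ * ((√g₀.Ψ)⁻¹ * σ') with hη_def
  have hη : η ≠ 0 := by
    have h1 := hreg.sqrt_ρ_pos
    have h2 := Real.sqrt_pos.2 hreg.Ψ_pos
    have h3 : σ' ≠ 0 := fun h0 => by simp [h0] at hσ'
    positivity
  have hm : Tendsto (fun n => (g (u n)).C₁ (δ n) * μ (u n)) atTop (𝓝 0) := by
    have h1 := (((hc.sqrt_Φ₁_inv hreg).mul hδ).mul huσ).mul hbr
    rw [mul_zero, zero_mul, zero_mul] at h1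
    refine h1.congr' ?_
    filter_upwards [hμ.eventually_gt_atTop 0] with n hn
    have : μ (u n) ≠ 0 := hn.ne'
    simp only [VarComp.C₁, hδ_def, Function.comp_apply]
    field_simp
  have hp : Tendsto (fun n => (g (u n)).C₂ (δ n) * μ (u n)) atTop (𝓝 η) := by
    have h1 := ((hc.sqrt_ρ_inv hreg).mul (((hc.sqrt_Ψ_inv hreg).mul huσ).sub
      (((hc.ρ.mul (hc.sqrt_Φ₁_inv hreg)).mul hδ).mul huσ))).mul hbr
    rw [mul_zero, zero_mul, sub_zero, mul_one] at h1
    refine h1.congr' ?_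
    filter_upwards [hμ.eventually_gt_atTop 0] with n hn
    have : μ (u n) ≠ 0 := hn.ne'
    simp only [VarComp.C₂, hδ_def, Function.comp_apply]
    field_simp
  -- Otherwise the limiting weights are strictly worse than `z₂²` at the means `(0, η)`. The
  -- candidate then beats `a` by more than `ε` at `δ n`, while its own maximum regret is at most
  -- `ε`, contradicting the minimality of `a`.
  by_contra hne
  have hadm := weights₀_subset_admissible habar.2 ha'
  have l1 := tendsto_quadPower hα (Eventually.of_forall fun n =>
    weights₀_subset_admissible habar.2 (ha (u n)).1.1) hadm (hlim.comp hut) hc.ρ hm hp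
  have l2 := tendsto_quadPower hα ((hut.eventually hcand).mono fun n hn =>
    weights₀_subset_admissible habar.2 hn.1) zero_mem_admissible
    ((h.tendsto_candidate hα habar).comp hut) hc.ρ hm hp
  have hlt := quadPower_lt_chiRegion hα hadm hη hne
  rw [← quadPower_of_eq_zero (a := 0) (ρ := g₀.ρ) rfl (by simp)] at hlt
  have l3 := l2.sub l1
  obtain ⟨ε, hε0, hε⟩ := exists_between (sub_pos.2 hlt)
  obtain ⟨n, hn1, hn2, hn3, hn4⟩ := ((l3.eventually_const_lt hε).and
    ((hut.eventually (h.eventually_maxRegret_candidate_le hα habar hε0)).and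
    ((hut.eventually hcand).and (hμ.eventually_ge_atTop r⁻¹)))).exists
  have h1 := regret_le_maxRegret α abar (μ (u n)) (g (u n)) (a (u n)) (hσD (u n) hn4)
  have h2 := power_le_maxPower α abar (D (u n)) (μ (u n)) (g (u n)) (δ n) hn3
  have h3 := (ha (u n)).2 _ hn3
  have h4 : ε < power α (μ (u n)) (g (u n)) (δ n)
      (aLower α abar (D (u n)) (μ (u n)) (g (u n)), 0) -
      power α (μ (u n)) (g (u n)) (δ n) (a (u n)) := hn1
  linarith

include hα habar in
/-- The minimax weights concentrate on the orthogonalized statistic, and their critical value tends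
to the chi-square quantile. -/
theorem tendsto_minimaxWeights (h : Calibration r R g₀ g μ D) {a : ℕ → ℝ × ℝ}
    (ha : ∀ᶠ n in atTop, a n ∈ minimaxWeights α abar (D n) (μ n) (g n)) :
    Tendsto (fun n => ((a n).1, (a n).2 * g₀.ρ, (a n).2 * (g n).ρ, critVal α (a n) (g n).ρ)) atTop
      (𝓝 (0, 0, 0, chiSqCrit α)) := by
  -- If `g₀.ρ = 0`, limit points of the second weight are not determined, but the four quantities
  -- listed have the same limit along all subsequences.
  refine tendsto_of_subseq_tendsto fun u hu => ?_
  obtain ⟨N, hN⟩ := eventually_atTop.1 (hu.eventually ha)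
  have hu' : Tendsto (fun n => u (n + N)) atTop atTop := hu.comp (tendsto_add_atTop_nat N)
  obtain ⟨a', ha', v, hv, hva⟩ := (isCompact_weights₀ abar).tendsto_subseq
    (x := fun n => a (u (n + N))) fun n => (hN (n + N) (Nat.le_add_left _ _)).1.1
  have huv := hu'.comp hv.tendsto_atTop
  obtain ⟨h1, h2⟩ := (h.comp huv).eq_zero_of_tendsto_minimaxWeights hα habar
    (a := fun n => a (u (v n + N))) (fun n => hN (v n + N) (Nat.le_add_left _ _)) ha' hva
  refine ⟨fun n => v n + N, ?_⟩
  have l1 := (continuous_fst.tendsto a').comp hva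
  have l2 := ((continuous_snd.tendsto a').comp hva).mul_const g₀.ρ
  have l3 := tendsto_critVal hα (weights₀_subset_admissible habar.2 ha') hva (h.conv.ρ.comp huv)
  rw [h1] at l1
  have l4 := ((continuous_snd.tendsto a').comp hva).mul (h.conv.ρ.comp huv)
  rw [h2] at l2 l4
  rw [critVal_eq_chiSqCrit α h1 h2] at l3
  exact l1.prodMk_nhds (l2.prodMk_nhds (l4.prodMk_nhds l3))

end Calibration


/-! ### The plug-in noncentrality parameters -/

/-- With `x = -r / 2` the series is the termwise integral of `exp (x t²)` over `[0, 1]`. -/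
lemma tsum_krs_nonneg (r : ℝ) :
    0 ≤ ∑' j : ℕ, (-r / 2) ^ j * (1 / ((j.factorial : ℝ) * (1 + 2 * (j : ℝ)))) := by
  set x := -r / 2
  have hS : HasSum (fun j : ℕ => ∫ t in (0 : ℝ)..1, (x * t ^ 2) ^ j / (j.factorial : ℝ))
      (∫ t in (0 : ℝ)..1, Real.exp (x * t ^ 2)) := by
    refine intervalIntegral.hasSum_integral_of_dominated_convergence
      (fun j _ => |x| ^ j / (j.factorial : ℝ)) (fun j => ?_) (fun j => ?_) ?_ ?_ ?_
    · exact (by fun_prop : Continuous fun t : ℝ => (x * t ^ 2) ^ j / (j.factorial : ℝ)).aestronglyMeasurable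
    · refine ae_of_all _ fun t ht => ?_
      rw [Set.uIoc_of_le zero_le_one] at ht
      rw [Real.norm_eq_abs, abs_div, abs_pow, abs_mul, Nat.abs_cast]
      have : |t ^ 2| ≤ 1 := by
        rw [abs_of_nonneg (sq_nonneg t)]
        nlinarith [ht.1, ht.2]
      gcongr
      exact mul_le_of_le_one_right (abs_nonneg _) this
    · exact ae_of_all _ fun t _ => Real.summable_pow_div_factorial _
    · exact intervalIntegrable_const
    · refine ae_of_all _ fun t _ => ?_
      rw [Real.exp_eq_exp_ℝ]
      exact NormedSpace.expSeries_div_hasSum_exp _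
  have he (j : ℕ) : ∫ t in (0 : ℝ)..1, (x * t ^ 2) ^ j / (j.factorial : ℝ) =
      x ^ j * (1 / ((j.factorial : ℝ) * (1 + 2 * (j : ℝ)))) := by
    have h1 (t : ℝ) : (x * t ^ 2) ^ j / (j.factorial : ℝ) =
        x ^ j / (j.factorial : ℝ) * t ^ (2 * j) := by
      rw [mul_pow, ← pow_mul]
      ring
    simp_rw [h1]
    rw [intervalIntegral.integral_const_mul, integral_pow]
    have : (j.factorial : ℝ) ≠ 0 := by positivity
    have : (1 + 2 * (j : ℝ)) ≠ 0 := by positivity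
    push_cast
    simp only [one_pow, ne_eq, Nat.add_eq_zero_iff, one_ne_zero, and_false, not_false_eq_true, zero_pow, sub_zero]
    field_simp
    ring
  simp_rw [he] at hS
  rw [hS.tsum_eq]
  exact intervalIntegral.integral_nonneg zero_le_one fun t _ => (Real.exp_pos _).le

/-- The common lower bound of both estimators; it is all that is needed for the plug-in
noncentrality to diverge. -/
lemma PlugIn.sub_one_le_rHat (s : PlugIn) (r : ℝ) : r - 1 ≤ s.rHat r := by
  cases s with
  | pp => exact le_max_left _ _
  | krs =>
    have := mul_nonneg (Real.exp_pos (-r / 2)).le (inv_nonneg.2 (tsum_krs_nonneg r))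
    simp only [PlugIn.rHat]
    linarith

lemma PlugIn.tendsto_f (s : PlugIn) {ι : Type*} {l : Filter ι} {D : ι → ℝ} {g : ι → VarComp}
    {g₀ : VarComp} (hr : g₀.Regular) (hg : VarComp.ConvergesTo g l g₀)
    (hD : Tendsto (fun i => |D i|) l atTop) : Tendsto (fun i => s.f (D i) (g i)) l atTop := by
  have hσ := hg.σD hr
  refine hσ.pos_mul_atTop hr.σD_pos (Real.tendsto_sqrt_atTop.comp ?_)
  refine tendsto_atTop_mono (fun i => s.sub_one_le_rHat _) (tendsto_atTop_add_const_right _ _ ?_)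
  have h1 : Tendsto (fun i => D i ^ 2) l atTop := by
    simpa [Function.comp_def] using (tendsto_pow_atTop (α := ℝ) two_ne_zero).comp hD
  have h2 := h1.atTop_mul_pos (inv_pos.2 (pow_pos hr.σD_pos 2))
    ((hσ.pow 2).inv₀ (pow_pos hr.σD_pos 2).ne')
  simpa only [div_eq_mul_inv] using h2

/-! ### Convergence in distribution -/

section distribution

variable {Ω Ω' Ω'' E F : Type*} [MeasurableSpace Ω] [MeasurableSpace Ω'] [MeasurableSpace Ω'']
  {P : Measure Ω} [IsProbabilityMeasure P] {P' : Measure Ω'} [IsProbabilityMeasure P']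
  {P'' : Measure Ω''} [IsProbabilityMeasure P'']
  [TopologicalSpace E] [MeasurableSpace E] [BorelSpace E]
  [TopologicalSpace F] [MeasurableSpace F] [BorelSpace F]
  {X : ℕ → Ω → E} {Z : Ω' → E}

lemma tendstoInDistribution_of_map_eq (h : TendstoInDistribution X atTop Z (fun _ => P) P')
    {Z' : Ω'' → E} (hZ' : AEMeasurable Z' P'') (hmap : P'.map Z = P''.map Z') :
    TendstoInDistribution X atTop Z' (fun _ => P) P'' where
  forall_aemeasurable := h.forall_aemeasurable
  aemeasurable_limit := hZ'
  tendsto := by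
    have he : (⟨P''.map Z', Measure.isProbabilityMeasure_map hZ'⟩ : ProbabilityMeasure E) =
        ⟨P'.map Z, Measure.isProbabilityMeasure_map h.aemeasurable_limit⟩ := Subtype.ext hmap.symm
    rw [he]
    exact h.tendsto

/-- The continuous mapping theorem for maps whose discontinuities are negligible in the limit. -/
lemma tendstoInDistribution_comp_of_ae_continuousAt [HasOuterApproxClosed E]
    [HasOuterApproxClosed F]
    (h : TendstoInDistribution X atTop Z (fun _ => P) P') {φ : E → F} (hφ : Measurable φ)
    (hc : P'.map Z {x | ¬ ContinuousAt φ x} = 0) :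
    TendstoInDistribution (fun n ω => φ (X n ω)) atTop (fun ω => φ (Z ω)) (fun _ => P) P' where
  forall_aemeasurable n := hφ.comp_aemeasurable (h.forall_aemeasurable n)
  aemeasurable_limit := hφ.comp_aemeasurable h.aemeasurable_limit
  tendsto := by
    refine tendsto_of_forall_isClosed_limsup_le' fun C hC => ?_
    have hX (n) : (P.map fun ω => φ (X n ω)) C = P.map (X n) (φ ⁻¹' C) := by
      rw [← Measure.map_apply hφ hC.measurableSet,
        AEMeasurable.map_map_of_aemeasurable hφ.aemeasurable (h.forall_aemeasurable n)]
      rfl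
    have hZ : (P'.map fun ω => φ (Z ω)) C = P'.map Z (φ ⁻¹' C) := by
      rw [← Measure.map_apply hφ hC.measurableSet,
        AEMeasurable.map_map_of_aemeasurable hφ.aemeasurable h.aemeasurable_limit]
      rfl
    -- A point of the closure at which `φ` is continuous is mapped into the closed set `C`.
    have hcl : closure (φ ⁻¹' C) ⊆ φ ⁻¹' C ∪ {x | ¬ ContinuousAt φ x} := by
      intro x hx
      by_cases hcx : ContinuousAt φ x
      · left
        have h1 : φ x ∈ closure (φ '' (φ ⁻¹' C)) :=
          hcx.continuousWithinAt.mem_closure_image hx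
        exact hC.closure_subset_iff.2 (Set.image_preimage_subset _ _) h1
      · exact Or.inr hcx
    simp only [ProbabilityMeasure.coe_mk, hX, hZ]
    calc limsup (fun n => P.map (X n) (φ ⁻¹' C)) atTop
        ≤ limsup (fun n => P.map (X n) (closure (φ ⁻¹' C))) atTop :=
          limsup_le_limsup (Eventually.of_forall fun n => measure_mono subset_closure)
      _ ≤ P'.map Z (closure (φ ⁻¹' C)) :=
          ProbabilityMeasure.limsup_measure_closed_le_of_tendsto h.tendsto isClosed_closure
      _ ≤ P'.map Z (φ ⁻¹' C ∪ {x | ¬ ContinuousAt φ x}) := measure_mono hcl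
      _ ≤ P'.map Z (φ ⁻¹' C) + P'.map Z {x | ¬ ContinuousAt φ x} := measure_union_le _ _
      _ = P'.map Z (φ ⁻¹' C) := by rw [hc, add_zero]

lemma tendsto_integral_of_tendstoInDistribution {Y : ℕ → Ω → ℝ} {W : Ω' → ℝ}
    (h : TendstoInDistribution Y atTop W (fun _ => P) P') (hY : ∀ n ω, Y n ω ∈ Set.Icc (0 : ℝ) 1)
    (hW : ∀ ω, W ω ∈ Set.Icc (0 : ℝ) 1) :
    Tendsto (fun n => ∫ ω, Y n ω ∂P) atTop (𝓝 (∫ ω, W ω ∂P')) := by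
  set f : BoundedContinuousFunction ℝ ℝ :=
    BoundedContinuousFunction.ofNormedAddCommGroup (fun x : ℝ => max 0 (min x 1)) (by fun_prop) 1
      (fun x => by
        rw [Real.norm_of_nonneg (le_max_left _ _)]
        exact max_le zero_le_one (min_le_right _ _)) with hf
  have hfx {x : ℝ} (hx : x ∈ Set.Icc (0 : ℝ) 1) : f x = x := by
    show max 0 (min x 1) = x
    rw [min_eq_left hx.2, max_eq_right hx.1]
  have := (ProbabilityMeasure.tendsto_iff_forall_integral_tendsto.1 h.tendsto) f
  simp only [ProbabilityMeasure.coe_mk] at this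
  rw [integral_map h.aemeasurable_limit f.continuous.aestronglyMeasurable] at this
  simp_rw [hfx (hW _)] at this
  refine this.congr fun n => ?_
  rw [integral_map (h.forall_aemeasurable n) f.continuous.aestronglyMeasurable]
  simp_rw [hfx (hY n _)]

end distribution

/-- Portmanteau theorem for the closed set `{ε ≤ ‖x‖}`, which the limit never meets. -/
lemma tendstoInMeasure_of_tendstoInDistribution_zero {Ω Ω' E : Type*} [MeasurableSpace Ω]
    [MeasurableSpace Ω'] {P : Measure Ω} [IsProbabilityMeasure P] {P' : Measure Ω'}
    [IsProbabilityMeasure P'] [NormedAddCommGroup E] [MeasurableSpace E] [BorelSpace E]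
    {X : ℕ → Ω → E} (h : TendstoInDistribution X atTop (fun _ => (0 : E)) (fun _ => P) P') :
    TendstoInMeasure P X atTop fun _ => 0 := by
  rw [tendstoInMeasure_iff_norm]
  intro ε hε
  have hC : IsClosed {x : E | ε ≤ ‖x‖} := isClosed_le continuous_const continuous_norm
  have h1 := ProbabilityMeasure.limsup_measure_closed_le_of_tendsto h.tendsto hC
  simp only [ProbabilityMeasure.coe_mk] at h1
  rw [Measure.map_apply_of_aemeasurable h.aemeasurable_limit hC.measurableSet] at h1
  have h2 : (fun _ : Ω' => (0 : E)) ⁻¹' {x : E | ε ≤ ‖x‖} = ∅ := by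
    ext x
    simp [hε]
  rw [h2, measure_empty] at h1
  refine tendsto_of_le_liminf_of_limsup_le zero_le (le_trans (le_of_eq ?_) h1)
  congr 1
  ext n
  rw [Measure.map_apply_of_aemeasurable (h.forall_aemeasurable n) hC.measurableSet]
  simp

/-- A uniformly integrable sequence asymptotically equivalent to a `[0, 1]`-valued one has the same
limit of expectations. -/
lemma tendsto_integral_of_uniformIntegrable {Ω : Type*} [MeasurableSpace Ω] {P : Measure Ω}
    [IsProbabilityMeasure P] {ψ Y : ℕ → Ω → ℝ} (hY : ∀ n, AEStronglyMeasurable (Y n) P)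
    (h01 : ∀ n ω, Y n ω ∈ Set.Icc (0 : ℝ) 1) (hui : UniformIntegrable ψ 1 P)
    (hlim : TendstoInMeasure P (fun n ω => ψ n ω - Y n ω) atTop fun _ => 0) {l : ℝ}
    (hl : Tendsto (fun n => ∫ ω, Y n ω ∂P) atTop (𝓝 l)) :
    Tendsto (fun n => ∫ ω, ψ n ω ∂P) atTop (𝓝 l) := by
  have hYn (n ω) : ‖Y n ω‖ ≤ 1 := by
    rw [Real.norm_of_nonneg (h01 n ω).1]; exact (h01 n ω).2
  have hYui : UnifIntegrable Y 1 P := by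
    intro ε hε
    refine ⟨ε, hε, fun n s hs hsε => ?_⟩
    rw [eLpNorm_indicator_eq_eLpNorm_restrict hs]
    refine (eLpNorm_le_of_ae_bound (ae_of_all _ (hYn n))).trans ?_
    simpa using hsε
  have hYi (n) : Integrable (Y n) P := Integrable.of_bound (hY n) 1 (ae_of_all _ (hYn n))
  have hψi (n) : Integrable (ψ n) P := memLp_one_iff_integrable.1 (hui.memLp n)
  have h1 := tendsto_Lp_finite_of_tendstoInMeasure le_rfl ENNReal.one_ne_top
    (fun n => (hui.1 n).sub (hY n)) (MemLp.zero' (p := 1))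
    (hui.2.1.sub hYui le_rfl hui.1 hY) hlim
  have h2 := tendsto_integral_of_L1' (μ := P) (fun _ => (0 : ℝ)) aestronglyMeasurable_const
    (Eventually.of_forall fun n => (hψi n).sub (hYi n)) h1
  rw [integral_zero] at h2
  have h3 := h2.add hl
  rw [zero_add] at h3
  refine h3.congr fun n => ?_
  have := integral_sub (hψi n) (hYi n)
  simp only [Pi.sub_apply]
  rw [this]
  ring

/-! ### Gaussian laws -/

lemma posSemidef_corr {ρ : ℝ} (hρ : ρ ^ 2 < 1) : (!![1, ρ; ρ, 1] : Matrix (Fin 2) (Fin 2) ℝ).PosSemidef := by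
  refine Matrix.PosSemidef.of_dotProduct_mulVec_nonneg ?_ fun x => ?_
  · ext i j
    fin_cases i <;> fin_cases j <;> simp
  · simp [Matrix.mulVec, dotProduct, Fin.sum_univ_two]
    nlinarith [sq_nonneg (x 0 + ρ * x 1), sq_nonneg (x 1)]

/-- The map which turns a pair of independent normal variables into a correlated one. -/
noncomputable def corrMap (ρ : ℝ) (z : ℝ × ℝ) : ℝ × ℝ := (z.1, ρ * z.1 + √(1 - ρ ^ 2) * z.2)

lemma continuous_corrMap (ρ : ℝ) : Continuous (corrMap ρ) := by
  unfold corrMap; fun_prop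

open Complex in
lemma charFun_corr {ρ : ℝ} (hρ : ρ ^ 2 < 1) (θ : ℝ) (t : EuclideanSpace ℝ (Fin 2)) :
    charFun (multivariateGaussian !₂[0, θ] !![1, ρ; ρ, 1]) t =
      exp (t 1 * θ * I - (t 0 ^ 2 + 2 * ρ * t 0 * t 1 + t 1 ^ 2) / 2) := by
  rw [charFun_multivariateGaussian (posSemidef_corr hρ)]
  congr 1
  simp [Matrix.mulVec, dotProduct, Fin.sum_univ_two, PiLp.inner_apply]
  ring

open Complex in
-- Verified on characteristic functions. In these coordinates `z₂` is the orthogonalized statistic,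
-- and the limit experiment is a shift of `z₂` alone.
lemma map_corrMap_normalPair {ρ : ℝ} (hρ : ρ ^ 2 < 1) (η : ℝ) :
    (normalPair 0 η).map (fun z => (!₂[(corrMap ρ z).1, (corrMap ρ z).2] :
      EuclideanSpace ℝ (Fin 2))) =
      multivariateGaussian !₂[0, √(1 - ρ ^ 2) * η] !![1, ρ; ρ, 1] := by
  have hm : Measurable fun z : ℝ × ℝ => (!₂[(corrMap ρ z).1, (corrMap ρ z).2] :
      EuclideanSpace ℝ (Fin 2)) := by
    have := (continuous_corrMap ρ).measurable
    fun_prop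
  have : IsProbabilityMeasure ((normalPair 0 η).map fun z =>
      (!₂[(corrMap ρ z).1, (corrMap ρ z).2] : EuclideanSpace ℝ (Fin 2))) :=
    Measure.isProbabilityMeasure_map hm.aemeasurable
  refine Measure.ext_of_charFun ?_
  ext t
  rw [charFun_corr hρ, charFun_apply, integral_map hm.aemeasurable (by fun_prop)]
  set s := √(1 - ρ ^ 2) with hs
  have hs2 : (s : ℂ) ^ 2 = 1 - (ρ : ℂ) ^ 2 := by
    rw [← ofReal_pow, hs, Real.sq_sqrt (by linarith)]
    push_cast
    ring
  have h1 (z : ℝ × ℝ) : exp ((inner ℝ (!₂[(corrMap ρ z).1, (corrMap ρ z).2] :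
      EuclideanSpace ℝ (Fin 2)) t : ℝ) * I) =
      exp (((t 0 + ρ * t 1 : ℝ) : ℂ) * z.1 * I) * exp (((s * t 1 : ℝ) : ℂ) * z.2 * I) := by
    rw [← exp_add]
    congr 1
    simp [PiLp.inner_apply, Fin.sum_univ_two, corrMap, ← hs]
    ring
  simp_rw [h1]
  unfold normalPair
  rw [integral_prod_mul (fun x : ℝ => exp (((t 0 + ρ * t 1 : ℝ) : ℂ) * x * I))
    (fun y : ℝ => exp (((s * t 1 : ℝ) : ℂ) * y * I)), ← charFun_apply_real, ← charFun_apply_real,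
    charFun_gaussianReal, charFun_gaussianReal, ← exp_add]
  congr 1
  push_cast
  linear_combination (-(t 1 : ℂ) ^ 2 / 2) * hs2

lemma limitExp_eq {ρ : ℝ} (hρ : ρ ^ 2 < 1) (η : ℝ) {φ : ℝ × ℝ → ℝ} (hφ : Measurable φ) :
    limitExp (√(1 - ρ ^ 2) * η) ρ φ = ∫ z, φ (corrMap ρ z) ∂(normalPair 0 η) := by
  have := (continuous_corrMap ρ).measurable
  rw [limitExp, ← map_corrMap_normalPair hρ, integral_map (by fun_prop)
    (Measurable.aestronglyMeasurable (by fun_prop))]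
  rfl

open Complex in
/-- The limiting law of the two statistics. -/
lemma map_scale_multivariateGaussian {S : Matrix (Fin 3) (Fin 3) ℝ} (hS : S.PosSemidef)
    {c₀ c₁ ρ : ℝ} (hρ : ρ ^ 2 < 1) (h00 : c₀ ^ 2 * S 0 0 = 1) (h11 : c₁ ^ 2 * S 1 1 = 1)
    (h01 : c₀ * c₁ * S 0 1 = ρ) (h10 : c₀ * c₁ * S 1 0 = ρ) (η : ℝ) :
    (multivariateGaussian 0 S).map (fun w => ((c₀ * w 0, c₁ * w 1 + √(1 - ρ ^ 2) * η) : ℝ × ℝ)) =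
      (normalPair 0 η).map (corrMap ρ) := by
  set θ := √(1 - ρ ^ 2) * η with hθ
  have key : (multivariateGaussian 0 S).map (fun w => (!₂[c₀ * w 0, c₁ * w 1 + θ] :
      EuclideanSpace ℝ (Fin 2))) = multivariateGaussian !₂[0, θ] !![1, ρ; ρ, 1] := by
    have hm : Measurable fun w : EuclideanSpace ℝ (Fin 3) => (!₂[c₀ * w 0, c₁ * w 1 + θ] :
      EuclideanSpace ℝ (Fin 2)) := by fun_prop
    have : IsProbabilityMeasure ((multivariateGaussian 0 S).map fun w =>
        (!₂[c₀ * w 0, c₁ * w 1 + θ] : EuclideanSpace ℝ (Fin 2))) :=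
      Measure.isProbabilityMeasure_map hm.aemeasurable
    refine Measure.ext_of_charFun ?_
    ext t
    rw [charFun_corr hρ, charFun_apply, integral_map hm.aemeasurable (by fun_prop)]
    have h1 (w : EuclideanSpace ℝ (Fin 3)) : exp ((inner ℝ (!₂[c₀ * w 0, c₁ * w 1 + θ] :
        EuclideanSpace ℝ (Fin 2)) t : ℝ) * I) =
        exp ((inner ℝ w (!₂[c₀ * t 0, c₁ * t 1, 0] : EuclideanSpace ℝ (Fin 3)) : ℝ) * I) *
          exp (t 1 * θ * I) := by
      rw [← exp_add]
      congr 1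
      simp [PiLp.inner_apply, Fin.sum_univ_two, Fin.sum_univ_three]
      ring
    simp_rw [h1]
    rw [integral_mul_const, ← charFun_apply, charFun_multivariateGaussian hS, ← exp_add]
    congr 1
    have h00' : (c₀ : ℂ) ^ 2 * S 0 0 = 1 := by exact_mod_cast congrArg ofReal h00
    have h11' : (c₁ : ℂ) ^ 2 * S 1 1 = 1 := by exact_mod_cast congrArg ofReal h11
    have h01' : (c₀ : ℂ) * c₁ * S 0 1 = ρ := by exact_mod_cast congrArg ofReal h01
    have h10' : (c₀ : ℂ) * c₁ * S 1 0 = ρ := by exact_mod_cast congrArg ofReal h10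
    simp [Matrix.mulVec, dotProduct, Fin.sum_univ_three]
    linear_combination (-(t 0 : ℂ) ^ 2 / 2) * h00' - ((t 1 : ℂ) ^ 2 / 2) * h11' -
      (t 0 * t 1 / 2 : ℂ) * h01' - (t 0 * t 1 / 2 : ℂ) * h10'
  rw [hθ, ← map_corrMap_normalPair hρ, ← hθ] at key
  have hc := (continuous_corrMap ρ).measurable
  have hp : Measurable fun x : EuclideanSpace ℝ (Fin 2) => (x 0, x 1) := by fun_prop
  have := congrArg (Measure.map fun x : EuclideanSpace ℝ (Fin 2) => (x 0, x 1)) key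
  rw [Measure.map_map hp (by fun_prop), Measure.map_map hp (by fun_prop)] at this
  exact this

/-- Given the first coordinate, the second is a nondegenerate normal variable because `√(1 - ρ²) >
0`. Lebesgue-null sets of discontinuities are thereby negligible in the limit. -/
lemma map_corrMap_absolutelyContinuous {ρ : ℝ} (hρ : ρ ^ 2 < 1) (η : ℝ) :
    (normalPair 0 η).map (corrMap ρ) ≪ volume := by
  have hs : 0 < √(1 - ρ ^ 2) := Real.sqrt_pos.2 (by linarith)
  refine Measure.AbsolutelyContinuous.mk fun N hN h0 => ?_
  have hpre : MeasurableSet (corrMap ρ ⁻¹' N) := (continuous_corrMap ρ).measurable hN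
  rw [Measure.map_apply (continuous_corrMap ρ).measurable hN]
  unfold normalPair
  rw [Measure.measure_prod_null hpre]
  rw [Measure.volume_eq_prod, Measure.measure_prod_null hN] at h0
  refine (gaussianReal_absolutelyContinuous 0 one_ne_zero).ae_le (h0.mono fun x hx => ?_)
  have hv : (NNReal.mk (√(1 - ρ ^ 2) ^ 2) (sq_nonneg _) * 1 : NNReal) ≠ 0 :=
    mul_ne_zero (fun h => (pow_pos hs 2).ne' (congrArg NNReal.toReal h)) one_ne_zero
  have h1 : (gaussianReal η 1).map (fun z => ρ * x + √(1 - ρ ^ 2) * z) =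
      gaussianReal (ρ * x + √(1 - ρ ^ 2) * η) (NNReal.mk (√(1 - ρ ^ 2) ^ 2) (sq_nonneg _) * 1) := by
    rw [add_comm (ρ * x), ← gaussianReal_map_const_add, ← gaussianReal_map_const_mul,
      Measure.map_map (by fun_prop) (by fun_prop)]
    rfl
  have h2 := gaussianReal_absolutelyContinuous (ρ * x + √(1 - ρ ^ 2) * η) hv hx
  rw [← h1, Measure.map_apply (by fun_prop) (measurable_prodMk_left hN)] at h2
  exact h2


/-! ### Algebra of the quadratic forms -/

namespace IVArray

variable {Ω : Type*} [MeasurableSpace Ω] {P : Measure Ω} (M : IVArray Ω P)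

lemma proj_comm (n : ℕ) (i j : Fin n) : M.proj n i j = M.proj n j i := by
  have h : (M.proj n)ᵀ = M.proj n := by
    simp only [proj, Matrix.transpose_mul, Matrix.transpose_transpose, Matrix.transpose_nonsing_inv,
      Matrix.mul_assoc]
  exact congrFun (congrFun h.symm i) j

lemma Q_comm (n : ℕ) (a b : Fin n → ℝ) : M.Q n a b = M.Q n b a := by
  unfold Q
  congr 1
  rw [Finset.sum_comm' (t' := Finset.univ) (s' := fun j => Finset.univ.erase j)]
  · refine Finset.sum_congr rfl fun j _ => Finset.sum_congr rfl fun i _ => ?_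
    rw [M.proj_comm n i j]
    ring
  · intro x y
    simp [ne_comm]

lemma Q_add_mul_right (n : ℕ) (a b c : Fin n → ℝ) (t : ℝ) :
    M.Q n a (fun i => b i + t * c i) = M.Q n a b + t * M.Q n a c := by
  unfold Q
  rw [← mul_div_assoc, ← add_div, Finset.mul_sum, ← Finset.sum_add_distrib]
  congr 1
  refine Finset.sum_congr rfl fun i _ => ?_
  rw [Finset.mul_sum, ← Finset.sum_add_distrib]
  exact Finset.sum_congr rfl fun j _ => by ring

lemma e₀_eq (n : ℕ) (ω : Ω) :
    (fun i => M.e₀ n i ω) = fun i => M.e n i ω + M.Δ n * M.X n i ω := by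
  ext i
  simp only [e₀, Y, Δ]
  ring

lemma QXe₀_eq (n : ℕ) (ω : Ω) : M.QXe₀ n ω = M.QXe n ω + M.Δ n * M.QXX n ω := by
  rw [QXe₀, e₀_eq, Q_add_mul_right]
  rfl

lemma Qee₀_eq (n : ℕ) (ω : Ω) :
    M.Qee₀ n ω = M.Qee n ω + 2 * M.Δ n * M.QXe n ω + M.Δ n ^ 2 * M.QXX n ω := by
  have h1 : M.Q n (fun i => M.e n i ω + M.Δ n * M.X n i ω) (fun i => M.X n i ω) =
      M.QXe n ω + M.Δ n * M.QXX n ω := by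
    rw [Q_comm, Q_add_mul_right]
    rfl
  rw [Qee₀, e₀_eq, Q_add_mul_right, h1, Q_comm, Q_add_mul_right,
    M.Q_comm n (fun i => M.e n i ω) (fun i => M.X n i ω)]
  change M.Qee n ω + M.Δ n * M.QXe n ω + M.Δ n * (M.QXe n ω + M.Δ n * M.QXX n ω) = _
  ring

lemma Dhat_eq (g : ℕ → Ω → VarComp) (n : ℕ) (ω : Ω) : M.Dhat g n ω =
    M.QXX n ω - (M.Qee₀ n ω * (g n ω).coef 0 + M.QXe₀ n ω * (g n ω).coef 1) := by
  simp [Dhat, dotProduct, Fin.sum_univ_two]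

end IVArray

/-! ### The limiting variance components -/

lemma LimitCov.gamma_zero (S : LimitCov) :
    S.gamma 0 = ⟨S.Φ₁, S.Φ₁₂, S.Φ₁₃, S.Ψ, S.τ, S.Υ, S.ρ⟩ := by
  simp [LimitCov.gamma, LimitCov.shift, LimitCov.ρ]

/-- The positive definite form is evaluated at the first two unit vectors, at `(-Φ₁₂, Φ₁, 0)` for
the determinant, and at `(-k₀, -k₁, 1)`, where its value is the Schur complement, the square of
`σD`. -/
lemma LimitCov.regular {S : LimitCov} (hS : S.mat.PosDef) : (S.gamma 0).Regular := by
  have hq (x y z : ℝ) (h : ¬ (x = 0 ∧ y = 0 ∧ z = 0)) : 0 < x * (S.Φ₁ * x + S.Φ₁₂ * y + S.Φ₁₃ * z) +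
      y * (S.Φ₁₂ * x + S.Ψ * y + S.τ * z) + z * (S.Φ₁₃ * x + S.τ * y + S.Υ * z) := by
    have h1 := hS.dotProduct_mulVec_pos (x := ![x, y, z]) fun h0 =>
      h ⟨congrFun h0 0, congrFun h0 1, congrFun h0 2⟩
    simpa [LimitCov.mat, Matrix.mulVec, dotProduct, Fin.sum_univ_three] using h1
  have hΦ : 0 < S.Φ₁ := by simpa using hq 1 0 0 (by simp)
  have hΨ : 0 < S.Ψ := by simpa using hq 0 1 0 (by simp)
  have hdet : 0 < S.Φ₁ * S.Ψ - S.Φ₁₂ * S.Φ₁₂ := by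
    have h1 := hq (-S.Φ₁₂) S.Φ₁ 0 fun h => hΦ.ne' h.2.1
    have h2 : 0 < S.Φ₁ * (S.Φ₁ * S.Ψ - S.Φ₁₂ * S.Φ₁₂) := by linarith
    exact (mul_pos_iff_of_pos_left hΦ).1 h2
  rw [LimitCov.gamma_zero]
  refine ⟨hΦ, hΨ, hdet, ?_, ?_⟩
  · show S.ρ ^ 2 < 1
    rw [LimitCov.ρ, div_pow, Real.sq_sqrt (mul_pos hΦ hΨ).le, div_lt_one (mul_pos hΦ hΨ)]
    linarith
  · rw [VarComp.σD_eq]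
    refine Real.sqrt_pos.2 ?_
    rw [VarComp.coef_zero, VarComp.coef_one]
    set k₀ := (S.Φ₁ * S.Ψ - S.Φ₁₂ * S.Φ₁₂)⁻¹ * (S.Ψ * S.Φ₁₃ - S.Φ₁₂ * S.τ) with hk₀
    set k₁ := (S.Φ₁ * S.Ψ - S.Φ₁₂ * S.Φ₁₂)⁻¹ * (S.Φ₁ * S.τ - S.Φ₁₂ * S.Φ₁₃) with hk₁
    have hi : (S.Φ₁ * S.Ψ - S.Φ₁₂ * S.Φ₁₂)⁻¹ * (S.Φ₁ * S.Ψ - S.Φ₁₂ * S.Φ₁₂) = 1 :=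
      inv_mul_cancel₀ hdet.ne'
    have e0 : S.Φ₁ * k₀ + S.Φ₁₂ * k₁ = S.Φ₁₃ := by
      rw [hk₀, hk₁]
      linear_combination S.Φ₁₃ * hi
    have e1 : S.Φ₁₂ * k₀ + S.Ψ * k₁ = S.τ := by
      rw [hk₀, hk₁]
      linear_combination S.τ * hi
    have h1 := hq (-k₀) (-k₁) 1 (by simp)
    have h2 : -k₀ * (S.Φ₁ * -k₀ + S.Φ₁₂ * -k₁ + S.Φ₁₃ * 1) +
        -k₁ * (S.Φ₁₂ * -k₀ + S.Ψ * -k₁ + S.τ * 1) + 1 * (S.Φ₁₃ * -k₀ + S.τ * -k₁ + S.Υ * 1) =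
        S.Υ - (S.Φ₁₃ * k₀ + S.τ * k₁) := by
      linear_combination k₀ * e0 + k₁ * e1
    rwa [h2] at h1

lemma LimitCov.tendsto_gamma {S : LimitCov} (hS : S.mat.PosDef) {ι : Type*} {l : Filter ι}
    {Δ : ι → ℝ} (hΔ : Tendsto Δ l (𝓝 0)) :
    Tendsto (fun i => (S.gamma (Δ i)).toVec) l (𝓝 (S.gamma 0).toVec) := by
  have hr := LimitCov.regular hS
  have hρ : ContinuousAt (fun x => (S.gamma x).ρ) 0 := by
    have h1 : Continuous fun x => (S.shift x).Φ₁₂ := by unfold LimitCov.shift; fun_prop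
    have h2 : Continuous fun x => √((S.shift x).Φ₁ * (S.shift x).Ψ) := by
      unfold LimitCov.shift; fun_prop
    exact h1.continuousAt.div h2.continuousAt (Real.sqrt_pos.2 (mul_pos hr.Φ₁_pos hr.Ψ_pos)).ne'
  have key : ContinuousAt (fun x => (S.gamma x).toVec) 0 := by
    refine (PiLp.continuous_toLp 2 _).continuousAt.comp (continuousAt_pi.2 fun j => ?_)
    fin_cases j
    · exact (by unfold LimitCov.gamma LimitCov.shift; fun_prop :
        Continuous fun x => (S.gamma x).Φ₁).continuousAt
    · exact (by unfold LimitCov.gamma LimitCov.shift; fun_prop :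
        Continuous fun x => (S.gamma x).Φ₁₂).continuousAt
    · exact (by unfold LimitCov.gamma LimitCov.shift; fun_prop :
        Continuous fun x => (S.gamma x).Φ₁₃).continuousAt
    · exact (by unfold LimitCov.gamma LimitCov.shift; fun_prop :
        Continuous fun x => (S.gamma x).Ψ).continuousAt
    · exact (by unfold LimitCov.gamma LimitCov.shift; fun_prop :
        Continuous fun x => (S.gamma x).τ).continuousAt
    · exact (by unfold LimitCov.gamma LimitCov.shift; fun_prop :
        Continuous fun x => (S.gamma x).Υ).continuousAt
    · exact hρ
  exact key.tendsto.comp hΔ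

/-! ### Local alternatives under strong identification -/

namespace IVArray

variable {Ω : Type*} [MeasurableSpace Ω] {P : Measure Ω} [IsProbabilityMeasure P]
  {M : IVArray Ω P} {B : Set ℝ} {S : LimitCov} {g : ℕ → Ω → VarComp} {d : ℕ → ℝ} {Ct Δt : ℝ}

/-- The asymptotic framework: joint weak convergence, consistent variance components, strong
identification and local alternatives. -/
structure LocalAlternatives (M : IVArray Ω P) (B : Set ℝ) (S : LimitCov) (g : ℕ → Ω → VarComp)
    (d : ℕ → ℝ) (Ct Δt : ℝ) : Prop where
  compact : IsCompact B
  rich : ∃ r : ℝ, 0 < r ∧ ∀ n, Set.Icc (M.β₀ n) (M.β₀ n + r) ⊆ B ∨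
    Set.Icc (M.β₀ n - r) (M.β₀ n) ⊆ B
  posDef : S.mat.PosDef
  weak : TendstoInDistribution
    (fun n ω => (!₂[M.Qee n ω, M.QXe n ω, M.QXX n ω - M.conc n] : EuclideanSpace ℝ (Fin 3)))
    atTop id (fun _ => P) (multivariateGaussian 0 S.mat)
  meas : ∀ n, AEMeasurable (fun ω => (g n ω).toVec) P
  consistent : TendstoInMeasure P (fun n ω => (g n ω).toVec - (S.gamma (M.Δ n)).toVec) atTop
    (fun _ => 0)
  tendsto_d : Tendsto d atTop (𝓝 0)
  d_ne : ∀ᶠ n in atTop, d n ≠ 0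
  Ct_ne : Ct ≠ 0
  conc_eq : ∀ᶠ n in atTop, M.conc n = Ct / d n
  Δ_eq : ∀ᶠ n in atTop, M.Δ n = Δt * d n

namespace LocalAlternatives

variable (h : M.LocalAlternatives B S g d Ct Δt)

include h

lemma tendsto_Δ : Tendsto M.Δ atTop (𝓝 0) := by
  have := h.tendsto_d.const_mul Δt
  rw [mul_zero] at this
  exact this.congr' (h.Δ_eq.mono fun n hn => hn.symm)

lemma tendsto_d_conc : Tendsto (fun n => d n * M.conc n) atTop (𝓝 Ct) := by
  refine tendsto_const_nhds.congr' ?_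
  filter_upwards [h.d_ne, h.conc_eq] with n h1 h2
  rw [h2]
  field_simp

lemma tendsto_Δ_conc : Tendsto (fun n => M.Δ n * M.conc n) atTop (𝓝 (Δt * Ct)) := by
  refine (h.tendsto_d_conc.const_mul Δt).congr' ?_
  filter_upwards [h.Δ_eq] with n h1
  rw [h1]
  ring

lemma aemeasurable_Qee (n : ℕ) : AEMeasurable (M.Qee n) P :=
  (by fun_prop : Measurable fun x : EuclideanSpace ℝ (Fin 3) => x 0).comp_aemeasurable
    (h.weak.forall_aemeasurable n)

lemma aemeasurable_QXe (n : ℕ) : AEMeasurable (M.QXe n) P :=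
  (by fun_prop : Measurable fun x : EuclideanSpace ℝ (Fin 3) => x 1).comp_aemeasurable
    (h.weak.forall_aemeasurable n)

lemma aemeasurable_QXX (n : ℕ) : AEMeasurable (M.QXX n) P := by
  have := (by fun_prop : Measurable fun x : EuclideanSpace ℝ (Fin 3) => x 2).comp_aemeasurable
    (h.weak.forall_aemeasurable n)
  have h2 := this.add_const (M.conc n)
  refine h2.congr (ae_of_all _ fun ω => ?_)
  simp

lemma aemeasurable_toVec (n : ℕ) (j : Fin 7) : AEMeasurable (fun ω => (g n ω).toVec j) P :=
  (by fun_prop : Measurable fun x : EuclideanSpace ℝ (Fin 7) => x j).comp_aemeasurable (h.meas n)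

lemma aemeasurable_Φ₁ (n : ℕ) : AEMeasurable (fun ω => (g n ω).Φ₁) P := h.aemeasurable_toVec n 0
lemma aemeasurable_Ψ (n : ℕ) : AEMeasurable (fun ω => (g n ω).Ψ) P := h.aemeasurable_toVec n 3
lemma aemeasurable_ρ (n : ℕ) : AEMeasurable (fun ω => (g n ω).ρ) P := h.aemeasurable_toVec n 6

lemma aemeasurable_AR (n : ℕ) : AEMeasurable (M.AR g n) P := by
  have h1 := h.aemeasurable_Qee n
  have h2 := h.aemeasurable_QXe n
  have h3 := h.aemeasurable_QXX n
  have h4 := h.aemeasurable_Φ₁ n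
  have h5 : M.AR g n = fun ω => (M.Qee n ω + 2 * M.Δ n * M.QXe n ω + M.Δ n ^ 2 * M.QXX n ω) /
      √(g n ω).Φ₁ := by
    ext ω
    rw [AR, Qee₀_eq]
  rw [h5]
  fun_prop

lemma aemeasurable_LM (n : ℕ) : AEMeasurable (M.LM g n) P := by
  have h2 := h.aemeasurable_QXe n
  have h3 := h.aemeasurable_QXX n
  have h4 := h.aemeasurable_Ψ n
  have h5 : M.LM g n = fun ω => (M.QXe n ω + M.Δ n * M.QXX n ω) / √(g n ω).Ψ := by
    ext ω
    rw [LM, QXe₀_eq]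
  rw [h5]
  fun_prop

lemma aemeasurable_LMstar (n : ℕ) : AEMeasurable (M.LMstar g n) P := by
  have h1 := h.aemeasurable_AR n
  have h2 := h.aemeasurable_LM n
  have h3 := h.aemeasurable_ρ n
  unfold LMstar
  fun_prop

/-- A weakly convergent sequence times a vanishing one vanishes in probability; at the scale `d n`
only the centring of `QXX` survives. -/
lemma tendstoInMeasure_smul : TendstoInMeasure P (fun n ω =>
    d n • (!₂[M.Qee n ω, M.QXe n ω, M.QXX n ω - M.conc n] : EuclideanSpace ℝ (Fin 3))) atTop
    fun _ => 0 := by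
  have hd : TendstoInMeasure P (fun n (_ : Ω) => d n) atTop fun _ => (0 : ℝ) :=
    tendstoInMeasure_of_tendsto_ae (fun n => aestronglyMeasurable_const)
      (ae_of_all _ fun _ => h.tendsto_d)
  have := h.weak.continuous_comp_prodMk_of_tendstoInMeasure_const
    (g := fun p : EuclideanSpace ℝ (Fin 3) × ℝ => p.2 • p.1) (by fun_prop) hd
    fun n => aemeasurable_const
  simp only [zero_smul] at this
  exact tendstoInMeasure_of_tendstoInDistribution_zero this

/-- Along a subsequence of any subsequence, almost surely the estimators converge and the
noncentrality statistic diverges. -/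
lemma exists_subseq (u : ℕ → ℕ) (hu : StrictMono u) : ∃ v : ℕ → ℕ, StrictMono v ∧ ∀ᵐ ω ∂P,
    VarComp.ConvergesTo (fun i => g (u (v i)) ω) atTop (S.gamma 0) ∧
    Tendsto (fun i => |M.Dhat g (u (v i)) ω|) atTop atTop := by
  have hr := LimitCov.regular h.posDef
  obtain ⟨v₁, hv₁, h1⟩ := (h.consistent.comp hu.tendsto_atTop).exists_seq_tendsto_ae
  obtain ⟨v₂, hv₂, h2⟩ := (h.tendstoInMeasure_smul.comp
    (hu.comp hv₁).tendsto_atTop).exists_seq_tendsto_ae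
  refine ⟨v₁ ∘ v₂, hv₁.comp hv₂, ?_⟩
  set k : ℕ → ℕ := fun i => u (v₁ (v₂ i)) with hk_def
  have hk : Tendsto k atTop atTop := ((hu.comp hv₁).comp hv₂).tendsto_atTop
  filter_upwards [h1, h2] with ω hω1 hω2
  have hg : VarComp.ConvergesTo (fun i => g (k i) ω) atTop (S.gamma 0) := by
    refine VarComp.convergesTo_of_toVec ?_
    have e1 := (hω1.comp hv₂.tendsto_atTop).add
      (LimitCov.tendsto_gamma h.posDef (h.tendsto_Δ.comp hk))
    simpa [Function.comp_def, hk_def] using e1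
  refine ⟨hg, ?_⟩
  have hj (j : Fin 3) := ((EuclideanSpace.proj (𝕜 := ℝ) j).continuous.tendsto _).comp hω2
  have x0 : Tendsto (fun i => d (k i) * M.Qee (k i) ω) atTop (𝓝 0) := by
    simpa [Function.comp_def, hk_def] using hj 0
  have x1 : Tendsto (fun i => d (k i) * M.QXe (k i) ω) atTop (𝓝 0) := by
    simpa [Function.comp_def, hk_def] using hj 1
  have x2 : Tendsto (fun i => d (k i) * (M.QXX (k i) ω - M.conc (k i))) atTop (𝓝 0) := by
    simpa [Function.comp_def, hk_def] using hj 2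
  have x3 : Tendsto (fun i => d (k i) * M.QXX (k i) ω) atTop (𝓝 Ct) := by
    have := x2.add (h.tendsto_d_conc.comp hk)
    rw [zero_add] at this
    refine this.congr fun i => ?_
    simp only [Function.comp_apply]
    ring
  have hΔ := h.tendsto_Δ.comp hk
  have y0 : Tendsto (fun i => d (k i) * M.Qee₀ (k i) ω) atTop (𝓝 0) := by
    have := (x0.add ((hΔ.const_mul 2).mul x1)).add ((hΔ.pow 2).mul x3)
    norm_num at this
    refine this.congr fun i => ?_
    rw [Qee₀_eq]
    ring
  have y1 : Tendsto (fun i => d (k i) * M.QXe₀ (k i) ω) atTop (𝓝 0) := by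
    have := x1.add (hΔ.mul x3)
    norm_num at this
    refine this.congr fun i => ?_
    rw [QXe₀_eq]
    ring
  -- At the scale `d` both forms at `β₀` vanish, since `QXX` enters them with powers of `Δ → 0`; so
  -- `Dhat` inherits the limit of `QXX`.
  have y2 : Tendsto (fun i => d (k i) * M.Dhat g (k i) ω) atTop (𝓝 Ct) := by
    have := x3.sub ((y0.mul (hg.coef_zero hr)).add (y1.mul (hg.coef_one hr)))
    norm_num at this
    refine this.congr fun i => ?_
    rw [Dhat_eq]
    ring
  have hdinv : Tendsto (fun i => |d (k i)|⁻¹) atTop atTop := by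
    have e1 : Tendsto (fun i => |d (k i)|) atTop (𝓝[>] 0) := by
      refine tendsto_nhdsWithin_iff.2 ⟨?_, ?_⟩
      · simpa using (h.tendsto_d.comp hk).abs
      · filter_upwards [hk.eventually h.d_ne] with i hi
        exact abs_pos.2 hi
    exact tendsto_inv_nhdsGT_zero.comp e1
  refine (y2.abs.pos_mul_atTop (abs_pos.2 h.Ct_ne) hdinv).congr' ?_
  filter_upwards [hk.eventually h.d_ne] with i hi
  rw [abs_mul]
  have := abs_ne_zero.2 hi
  show |d (k i)| * |M.Dhat g (k i) ω| * |d (k i)|⁻¹ = |M.Dhat g (k i) ω|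
  field_simp

/-- Convergence in probability follows from convergence along every sequence on which the
estimators converge and the noncentrality statistic diverges. -/
lemma tendstoInMeasure_of_forall {E : Type*} [PseudoEMetricSpace E] {F : ℕ → Ω → E} {c : E}
    (hF : ∀ n, AEStronglyMeasurable (F n) P)
    (H : ∀ᵐ ω ∂P, ∀ k : ℕ → ℕ, Tendsto k atTop atTop →
      VarComp.ConvergesTo (fun i => g (k i) ω) atTop (S.gamma 0) →
      Tendsto (fun i => |M.Dhat g (k i) ω|) atTop atTop →
      Tendsto (fun i => F (k i) ω) atTop (𝓝 c)) :
    TendstoInMeasure P F atTop fun _ => c := by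
  rw [exists_seq_tendstoInMeasure_atTop_iff hF]
  intro u hu
  obtain ⟨v, hv, hae⟩ := h.exists_subseq u hu
  refine ⟨v, hv, ?_⟩
  filter_upwards [hae, H] with ω h1 h2
  exact h2 (fun i => u (v i)) (hu.comp hv).tendsto_atTop h1.1 h1.2

/-- The constants do not depend on `ω`. The bound of `B` is doubled because `δ` is a difference of
two of its points. -/
lemma exists_calibration (s : PlugIn) : ∃ r R : ℝ, ∀ ω, ∀ k : ℕ → ℕ,
    VarComp.ConvergesTo (fun i => g (k i) ω) atTop (S.gamma 0) →
    Tendsto (fun i => |M.Dhat g (k i) ω|) atTop atTop →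
    Calibration r R (S.gamma 0) (fun i => g (k i) ω)
      (fun i => s.f (M.Dhat g (k i) ω) (g (k i) ω)) fun i => altSet B (M.β₀ (k i)) := by
  obtain ⟨r, hr0, hr⟩ := h.rich
  obtain ⟨R, hR⟩ := h.compact.isBounded.exists_norm_le
  have hreg := LimitCov.regular h.posDef
  refine ⟨r, R + R, fun ω k h1 h2 => ⟨hreg, h1, s.tendsto_f hreg h1 h2, hr0, fun n δ hδ => ?_,
    fun n => ?_⟩⟩
  · have hβ : M.β₀ (k n) ∈ B := (hr (k n)).elim (fun h' => h' ⟨le_rfl, by linarith⟩)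
      fun h' => h' ⟨by linarith, le_rfl⟩
    have e1 := hR _ hδ
    have e2 := hR _ hβ
    rw [Real.norm_eq_abs] at e1 e2
    have e3 := abs_sub (δ + M.β₀ (k n)) (M.β₀ (k n))
    rw [add_sub_cancel_right] at e3
    linarith
  · refine (hr (k n)).imp (fun h' δ hδ => h' ?_) fun h' δ hδ => h' ?_
    · exact ⟨by linarith [hδ.1], by linarith [hδ.2]⟩
    · exact ⟨by linarith [hδ.1], by linarith [hδ.2]⟩

lemma ae_tendsto_weights {α : ℝ} (hα : α ∈ Set.Ioo (0 : ℝ) 1) {abar : ℝ}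
    (habar : abar ∈ Set.Ioo (0 : ℝ) 1) {s : PlugIn} {A : ℕ → Ω → ℝ × ℝ}
    (hA : ∀ n, ∀ᵐ ω ∂P, (M.feasible g α abar B s n ω).Nonempty →
      A n ω ∈ M.argminSet g α abar B s n ω) : ∀ᵐ ω ∂P, ∀ k : ℕ → ℕ, Tendsto k atTop atTop →
      VarComp.ConvergesTo (fun i => g (k i) ω) atTop (S.gamma 0) →
      Tendsto (fun i => |M.Dhat g (k i) ω|) atTop atTop →
      Tendsto (fun i => ((A (k i) ω).1, (A (k i) ω).2 * S.ρ, (A (k i) ω).2 * (g (k i) ω).ρ,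
        critVal α (A (k i) ω) (g (k i) ω).ρ)) atTop (𝓝 (0, 0, 0, chiSqCrit α)) := by
  obtain ⟨r, R, hcal⟩ := h.exists_calibration s
  filter_upwards [ae_all_iff.2 hA] with ω hω k _ h1 h2
  have hc := hcal ω k h1 h2
  -- The weights are minimizers only where the feasible set is nonempty, which the candidate weights
  -- ensure eventually.
  have hmem : ∀ᶠ i in atTop, A (k i) ω ∈ M.argminSet g α abar B s (k i) ω := by
    filter_upwards [hc.eventually_candidate_mem hα habar] with i hi
    exact hω (k i) ⟨_, hi⟩
  have := hc.tendsto_minimaxWeights hα habar hmem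
  rwa [LimitCov.gamma_zero] at this

end LocalAlternatives

end IVArray


/-! ### Tests in the limit experiment -/

lemma measurable_indicator_Ici : Measurable ((Set.Ici (0 : ℝ)).indicator (1 : ℝ → ℝ)) :=
  measurable_one.indicator measurableSet_Ici

lemma indicator_Ici_mem (t : ℝ) : (Set.Ici (0 : ℝ)).indicator (1 : ℝ → ℝ) t ∈ Set.Icc (0 : ℝ) 1 := by
  by_cases h : t ∈ Set.Ici (0 : ℝ) <;> simp [h]

lemma continuousAt_indicator_Ici {t : ℝ} (ht : t ≠ 0) :
    ContinuousAt ((Set.Ici (0 : ℝ)).indicator (1 : ℝ → ℝ)) t := by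
  rcases ht.lt_or_gt with h | h
  · refine (continuousAt_const (y := (0 : ℝ))).congr ?_
    filter_upwards [eventually_lt_nhds h] with x hx
    exact (Set.indicator_of_notMem (not_le.2 hx) _).symm
  · refine (continuousAt_const (y := (1 : ℝ))).congr ?_
    filter_upwards [eventually_gt_nhds h] with x hx
    exact (Set.indicator_of_mem (Set.mem_Ici.2 (le_of_lt hx)) (1 : ℝ → ℝ)).symm

lemma indicator_Ici_eq_indicator_chiRegion (α : ℝ) (z : ℝ × ℝ) :
    (Set.Ici (0 : ℝ)).indicator (1 : ℝ → ℝ) (z.2 ^ 2 - chiSqCrit α) =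
      (chiRegion α).indicator (1 : ℝ × ℝ → ℝ) z := by
  by_cases h : chiSqCrit α ≤ z.2 ^ 2
  · have h1 : z.2 ^ 2 - chiSqCrit α ∈ Set.Ici (0 : ℝ) := sub_nonneg.2 h
    have h2 : z ∈ chiRegion α := h
    rw [Set.indicator_of_mem h1, Set.indicator_of_mem h2]
    rfl
  · have h1 : z.2 ^ 2 - chiSqCrit α ∉ Set.Ici (0 : ℝ) := fun h' => h (sub_nonneg.1 h')
    have h2 : z ∉ chiRegion α := h
    rw [Set.indicator_of_notMem h1, Set.indicator_of_notMem h2]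

lemma normalPair_sub_chiSqCrit_eq (α m₁ m₂ : ℝ) :
    normalPair m₁ m₂ {z | z.2 ^ 2 - chiSqCrit α = 0} = 0 := by
  have h0 : ((0, 0) : ℝ × ℝ) ∈ admissible := by norm_num [admissible]
  refine measure_mono_null (fun z hz => ?_) (normalPair_quadForm_eq h0 0 (chiSqCrit α) m₁ m₂)
  have hz' : z.2 ^ 2 - chiSqCrit α = 0 := hz
  show quadForm (0, 0) 0 z.1 z.2 = chiSqCrit α
  simp [quadForm]
  linarith

lemma IsLevelTest.comp_corrMap_integral_le {α ρ : ℝ} {φ : ℝ × ℝ → ℝ} (hρ : ρ ^ 2 < 1)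
    (hφ : IsLevelTest α ρ φ) : ∫ z, φ (corrMap ρ z) ∂(normalPair 0 0) ≤ α := by
  have := hφ.2.2.1
  rwa [← mul_zero √(1 - ρ ^ 2), limitExp_eq hρ 0 hφ.1] at this

/-- No invariant or unbiased test has larger power than the orthogonalized test. -/
lemma integral_comp_corrMap_le {α ρ : ℝ} (hα : α ∈ Set.Ioo (0 : ℝ) 1) (hρ : ρ ^ 2 < 1)
    {φ : ℝ × ℝ → ℝ} (hφ : φ ∈ invariantTests α ρ ∪ unbiasedTests α ρ) (η : ℝ) :
    ∫ z, φ (corrMap ρ z) ∂(normalPair 0 η) ≤ (normalPair 0 η).real (chiRegion α) := by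
  have hc := (continuous_corrMap ρ).measurable
  have hs : √(1 - ρ ^ 2) ≠ 0 := (Real.sqrt_pos.2 (by linarith)).ne'
  rcases hφ with ⟨hl, hinv⟩ | ⟨hl, hub⟩
  · refine integral_le_chiRegion hα (hl.1.comp hc) (fun z => hl.2.1 _)
      (hl.comp_corrMap_integral_le hρ) (integral_snd_mul_of_even_snd fun x y => ?_) η
    simp only [corrMap, Function.comp_apply]
    -- In orthogonal coordinates the sign change `y ↦ 2ρx - y` is `z₂ ↦ -z₂`.
    rw [hinv x (ρ * x + √(1 - ρ ^ 2) * y)]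
    congr 2
    ring
  · have hle := hl.comp_corrMap_integral_le hρ
    refine integral_le_chiRegion hα (hl.1.comp hc) (fun z => hl.2.1 _) hle
      (integral_snd_mul_of_unbiased (hl.1.comp hc) (fun z => hl.2.1 _) fun η' => ?_) η
    rcases eq_or_ne η' 0 with rfl | h0
    · exact le_rfl
    · refine le_trans hle ?_
      have := hub _ (mul_ne_zero hs h0)
      rwa [limitExp_eq hρ η' hl.1] at this

/-- The two-sided test based on the second coordinate after orthogonalization. -/
noncomputable def orthTest (α ρ : ℝ) (p : ℝ × ℝ) : ℝ :=
  (Set.Ici (0 : ℝ)).indicator 1 (((√(1 - ρ ^ 2))⁻¹ * (p.2 - ρ * p.1)) ^ 2 - chiSqCrit α)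

lemma orthTest_corrMap {α ρ : ℝ} (hρ : ρ ^ 2 < 1) (z : ℝ × ℝ) :
    orthTest α ρ (corrMap ρ z) = (chiRegion α).indicator (1 : ℝ × ℝ → ℝ) z := by
  have hs : √(1 - ρ ^ 2) ≠ 0 := (Real.sqrt_pos.2 (by linarith)).ne'
  rw [← indicator_Ici_eq_indicator_chiRegion, orthTest, corrMap]
  congr 3
  field_simp
  ring

lemma measurable_orthTest (α ρ : ℝ) : Measurable (orthTest α ρ) :=
  measurable_indicator_Ici.comp (by fun_prop)

/-- The test jumps only where the squared orthogonalized coordinate equals the quantile, at most two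
points on each vertical line. -/
lemma volume_not_continuousAt_orthTest {α ρ : ℝ} (hα : α ∈ Set.Ioo (0 : ℝ) 1) (hρ : ρ ^ 2 < 1) :
    volume {p | ¬ ContinuousAt (orthTest α ρ) p} = 0 := by
  have hs : √(1 - ρ ^ 2) ≠ 0 := (Real.sqrt_pos.2 (by linarith)).ne'
  set N : Set (ℝ × ℝ) :=
    {p | ((√(1 - ρ ^ 2))⁻¹ * (p.2 - ρ * p.1)) ^ 2 - chiSqCrit α = 0} with hN_def
  have hN : MeasurableSet N := measurableSet_eq_fun (by fun_prop) (by fun_prop)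
  refine measure_mono_null (t := N) (fun p hp => ?_) ?_
  · by_contra hne
    refine hp ((continuousAt_indicator_Ici hne).comp (f := fun p : ℝ × ℝ =>
      ((√(1 - ρ ^ 2))⁻¹ * (p.2 - ρ * p.1)) ^ 2 - chiSqCrit α) ?_)
    exact (by fun_prop : Continuous fun p : ℝ × ℝ =>
      ((√(1 - ρ ^ 2))⁻¹ * (p.2 - ρ * p.1)) ^ 2 - chiSqCrit α).continuousAt
  · rw [Measure.volume_eq_prod, Measure.measure_prod_null hN]
    refine Eventually.of_forall fun x => ?_
    refine Set.Finite.measure_zero (Set.Finite.subset (Set.toFinite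
      {ρ * x + √(1 - ρ ^ 2) * √(chiSqCrit α), ρ * x - √(1 - ρ ^ 2) * √(chiSqCrit α)}) ?_) _
    intro y hy
    have h1 : ((√(1 - ρ ^ 2))⁻¹ * (y - ρ * x)) ^ 2 - chiSqCrit α = 0 := hy
    have h2 : ((√(1 - ρ ^ 2))⁻¹ * (y - ρ * x)) ^ 2 = √(chiSqCrit α) ^ 2 := by
      rw [Real.sq_sqrt (chiSqCrit_pos hα).le]
      linarith
    rcases sq_eq_sq_iff_eq_or_eq_neg.1 h2 with h3 | h3
    · left
      rw [← h3]
      field_simp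
      ring
    · right
      rw [← neg_eq_iff_eq_neg] at h3
      show y = _
      rw [← h3]
      field_simp
      ring

lemma orthTest_mem_invariantTests {α ρ : ℝ} (hα : α ∈ Set.Ioo (0 : ℝ) 1) (hρ : ρ ^ 2 < 1) :
    orthTest α ρ ∈ invariantTests α ρ := by
  refine ⟨⟨measurable_orthTest α ρ, fun p => indicator_Ici_mem _, ?_,
    volume_not_continuousAt_orthTest hα hρ⟩, fun x y => ?_⟩
  · rw [← mul_zero √(1 - ρ ^ 2), limitExp_eq hρ 0 (measurable_orthTest α ρ)]
    simp_rw [orthTest_corrMap hρ]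
    rw [integral_indicator_one (measurableSet_chiRegion α), normalPair_chiRegion_zero hα]
  · simp only [orthTest]
    congr 2
    ring

/-- The mean of the orthogonalized statistic under local alternatives. -/
noncomputable def LimitCov.drift (S : LimitCov) (Ct Δt : ℝ) : ℝ :=
  Δt * Ct / √((1 - S.ρ ^ 2) * S.Ψ)

/-- The decision becomes a fixed function of the centred statistic, discontinuous only at `0`, as
the continuous mapping theorem requires. -/
lemma IVArray.clcTest_eq {Ω : Type*} [MeasurableSpace Ω] {P : Measure Ω} (M : IVArray Ω P)
    (g : ℕ → Ω → VarComp) (α : ℝ) (A : ℕ → Ω → ℝ × ℝ) (n : ℕ) (ω : Ω) :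
    M.clcTest g α A n ω = (Set.Ici (0 : ℝ)).indicator 1
      ((A n ω).1 * M.AR g n ω ^ 2 + (A n ω).2 * M.LM g n ω ^ 2
        + (1 - (A n ω).1 - (A n ω).2) * M.LMstar g n ω ^ 2 - critVal α (A n ω) (g n ω).ρ) := by
  simp [clcTest, Set.indicator]

/-! ### Limit laws of the statistics and optimality of the feasible test. -/

namespace IVArray

variable {Ω : Type*} [MeasurableSpace Ω] {P : Measure Ω} [IsProbabilityMeasure P]
  {M : IVArray Ω P} {B : Set ℝ} {S : LimitCov} {g : ℕ → Ω → VarComp} {d : ℕ → ℝ} {Ct Δt : ℝ}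

namespace LocalAlternatives

lemma ρ_sq_lt (h : M.LocalAlternatives B S g d Ct Δt) : S.ρ ^ 2 < 1 := by
  have := (LimitCov.regular h.posDef).ρ_sq_lt
  rwa [LimitCov.gamma_zero] at this

/-- The joint limit of the jackknife AR and LM statistics. -/
lemma tendstoInDistribution_AR_LM (h : M.LocalAlternatives B S g d Ct Δt) :
    TendstoInDistribution (fun n ω => (M.AR g n ω, M.LM g n ω)) atTop (corrMap S.ρ) (fun _ => P)
      (normalPair 0 (S.drift Ct Δt)) := by
  have hr := LimitCov.regular h.posDef
  have hΦ : 0 < S.Φ₁ := by simpa [LimitCov.gamma_zero] using hr.Φ₁_pos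
  have hΨ : 0 < S.Ψ := by simpa [LimitCov.gamma_zero] using hr.Ψ_pos
  set c₀ := (√S.Φ₁)⁻¹
  set c₁ := (√S.Ψ)⁻¹
  have hmeas (n : ℕ) : AEMeasurable
      (fun ω => ((√(g n ω).Φ₁)⁻¹, (√(g n ω).Ψ)⁻¹, M.Δ n, M.Δ n * M.conc n)) P := by
    have h1 := h.aemeasurable_Φ₁ n
    have h2 := h.aemeasurable_Ψ n
    fun_prop
  have hu : TendstoInMeasure P
      (fun n ω => ((√(g n ω).Φ₁)⁻¹, (√(g n ω).Ψ)⁻¹, M.Δ n, M.Δ n * M.conc n)) atTop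
      fun _ => (c₀, c₁, (0 : ℝ), Δt * Ct) := by
    refine h.tendstoInMeasure_of_forall (fun n => (hmeas n).aestronglyMeasurable)
      (ae_of_all _ fun ω k hk hg _ => ?_)
    have h1 := hg.sqrt_Φ₁_inv hr
    have h2 := hg.sqrt_Ψ_inv hr
    rw [LimitCov.gamma_zero] at h1 h2
    exact h1.prodMk_nhds (h2.prodMk_nhds ((h.tendsto_Δ.comp hk).prodMk_nhds
      (h.tendsto_Δ_conc.comp hk)))
  -- `QXX` enters centred, and its centring only through `Δ * conc`, which converges. In `AR` that
  -- term carries a further factor `Δ → 0`, so only `LM` acquires a drift.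
  have key := h.weak.continuous_comp_prodMk_of_tendstoInMeasure_const
    (g := fun p : EuclideanSpace ℝ (Fin 3) × (ℝ × ℝ × ℝ × ℝ) =>
      (p.2.1 * (p.1 0 + 2 * p.2.2.2.1 * p.1 1 + p.2.2.2.1 ^ 2 * p.1 2 + p.2.2.2.1 * p.2.2.2.2),
        p.2.2.1 * (p.1 1 + p.2.2.2.1 * p.1 2 + p.2.2.2.2))) (by fun_prop) hu hmeas
  have hX : (fun n ω => (M.AR g n ω, M.LM g n ω)) = fun n ω =>
      ((√(g n ω).Φ₁)⁻¹ * (M.Qee n ω + 2 * M.Δ n * M.QXe n ω +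
        M.Δ n ^ 2 * (M.QXX n ω - M.conc n) + M.Δ n * (M.Δ n * M.conc n)),
        (√(g n ω).Ψ)⁻¹ * (M.QXe n ω + M.Δ n * (M.QXX n ω - M.conc n) + M.Δ n * M.conc n)) := by
    ext n ω
    · rw [AR, Qee₀_eq]
      ring
    · rw [LM, QXe₀_eq]
      ring
  rw [hX]
  refine tendstoInDistribution_of_map_eq key (continuous_corrMap S.ρ).measurable.aemeasurable ?_
  have hsq : √S.Φ₁ ^ 2 = S.Φ₁ := Real.sq_sqrt hΦ.le
  have hsq' : √S.Ψ ^ 2 = S.Ψ := Real.sq_sqrt hΨ.le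
  have hn : √S.Φ₁ ≠ 0 := (Real.sqrt_pos.2 hΦ).ne'
  have hn' : √S.Ψ ≠ 0 := (Real.sqrt_pos.2 hΨ).ne'
  have h01 : c₀ * c₁ * S.Φ₁₂ = S.ρ := by
    rw [LimitCov.ρ, Real.sqrt_mul hΦ.le, div_eq_mul_inv, mul_inv]
    ring
  have h00 : c₀ ^ 2 * S.Φ₁ = 1 := by
    rw [inv_pow, hsq, inv_mul_cancel₀ hΦ.ne']
  have h11 : c₁ ^ 2 * S.Ψ = 1 := by
    rw [inv_pow, hsq', inv_mul_cancel₀ hΨ.ne']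
  rw [← map_scale_multivariateGaussian h.posDef.posSemidef h.ρ_sq_lt (c₀ := c₀) (c₁ := c₁)
    (by simpa [LimitCov.mat] using h00) (by simpa [LimitCov.mat] using h11)
    (by simpa [LimitCov.mat] using h01) (by simpa [LimitCov.mat] using h01) (S.drift Ct Δt)]
  congr 1
  ext w
  · simp
  · have hs : √(1 - S.ρ ^ 2) ≠ 0 := (Real.sqrt_pos.2 (by linarith [h.ρ_sq_lt])).ne'
    have : √(1 - S.ρ ^ 2) * S.drift Ct Δt = c₁ * (Δt * Ct) := by
      rw [LimitCov.drift, Real.sqrt_mul (by linarith [h.ρ_sq_lt])]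
      have hc : √S.Ψ * c₁ = 1 := mul_inv_cancel₀ hn'
      field_simp
      linear_combination (-(Δt * Ct)) * hc
    simp only [this, id]
    ring

/-- Admissible tests have convergent rejection probabilities. -/
lemma tendsto_integral_levelTest (h : M.LocalAlternatives B S g d Ct Δt) {α : ℝ} {φ : ℝ × ℝ → ℝ}
    (hφ : IsLevelTest α S.ρ φ) :
    Tendsto (fun n => ∫ ω, φ (M.AR g n ω, M.LM g n ω) ∂P) atTop
      (𝓝 (∫ z, φ (corrMap S.ρ z) ∂(normalPair 0 (S.drift Ct Δt)))) :=
  tendsto_integral_of_tendstoInDistribution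
    (tendstoInDistribution_comp_of_ae_continuousAt h.tendstoInDistribution_AR_LM hφ.1
      (map_corrMap_absolutelyContinuous h.ρ_sq_lt _ hφ.2.2.2))
    (fun _ _ => hφ.2.1 _) fun _ => hφ.2.1 _

section weights

variable {α : ℝ} {abar : ℝ} {s : PlugIn} {A : ℕ → Ω → ℝ × ℝ}

lemma tendstoInMeasure_weights (h : M.LocalAlternatives B S g d Ct Δt)
    (hα : α ∈ Set.Ioo (0 : ℝ) 1) (habar : abar ∈ Set.Ioo (0 : ℝ) 1)
    (hA_meas : ∀ n, AEMeasurable (A n) P)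
    (hA : ∀ n, ∀ᵐ ω ∂P, (M.feasible g α abar B s n ω).Nonempty →
      A n ω ∈ M.argminSet g α abar B s n ω) :
    TendstoInMeasure P (fun n ω => (A n ω).1) atTop (fun _ => 0) ∧
    TendstoInMeasure P (fun n ω => (A n ω).2 * S.ρ) atTop (fun _ => 0) := by
  refine ⟨h.tendstoInMeasure_of_forall (fun n => ?_) ?_,
    h.tendstoInMeasure_of_forall (fun n => ?_) ?_⟩
  · exact (hA_meas n).fst.aestronglyMeasurable
  · filter_upwards [h.ae_tendsto_weights hα habar hA] with ω hω k hk h1 h2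
    exact (hω k hk h1 h2).fst_nhds
  · exact ((hA_meas n).snd.mul_const _).aestronglyMeasurable
  · filter_upwards [h.ae_tendsto_weights hα habar hA] with ω hω k hk h1 h2
    exact (hω k hk h1 h2).snd_nhds.fst_nhds

/-- The limit of the centred test statistic. -/
lemma tendstoInDistribution_statistic (h : M.LocalAlternatives B S g d Ct Δt)
    (hα : α ∈ Set.Ioo (0 : ℝ) 1) (habar : abar ∈ Set.Ioo (0 : ℝ) 1)
    (hA_meas : ∀ n, AEMeasurable (A n) P)
    (hA : ∀ n, ∀ᵐ ω ∂P, (M.feasible g α abar B s n ω).Nonempty →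
      A n ω ∈ M.argminSet g α abar B s n ω) :
    TendstoInDistribution (fun n ω => (A n ω).1 * M.AR g n ω ^ 2 + (A n ω).2 * M.LM g n ω ^ 2
        + (1 - (A n ω).1 - (A n ω).2) * M.LMstar g n ω ^ 2 - critVal α (A n ω) (g n ω).ρ) atTop
      (fun z : ℝ × ℝ => z.2 ^ 2 - chiSqCrit α) (fun _ => P) (normalPair 0 (S.drift Ct Δt)) := by
  have hr := LimitCov.regular h.posDef
  have hcrit (n : ℕ) : AEMeasurable (fun ω => critVal α (A n ω) (g n ω).ρ) P :=
    Measurable.comp_aemeasurable (g := fun x : (ℝ × ℝ) × ℝ => critVal α x.1 x.2)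
      (f := fun ω => (A n ω, (g n ω).ρ)) (measurable_critVal hα) ((hA_meas n).prodMk (h.aemeasurable_ρ n))
  have hmeas (n : ℕ) : AEMeasurable (fun ω => ((√(1 - (g n ω).ρ ^ 2))⁻¹, (g n ω).ρ,
      √(1 - (g n ω).ρ ^ 2), (A n ω).1, (A n ω).2 * (g n ω).ρ,
      critVal α (A n ω) (g n ω).ρ)) P := by
    have h1 := h.aemeasurable_ρ n
    have h2 := hcrit n
    have h3 := (hA_meas n).fst
    have h4 := (hA_meas n).snd
    fun_prop
  have hu : TendstoInMeasure P (fun n ω => ((√(1 - (g n ω).ρ ^ 2))⁻¹, (g n ω).ρ,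
      √(1 - (g n ω).ρ ^ 2), (A n ω).1, (A n ω).2 * (g n ω).ρ, critVal α (A n ω) (g n ω).ρ)) atTop
      fun _ => ((√(1 - S.ρ ^ 2))⁻¹, S.ρ, √(1 - S.ρ ^ 2), (0 : ℝ), (0 : ℝ), chiSqCrit α) := by
    refine h.tendstoInMeasure_of_forall (fun n => (hmeas n).aestronglyMeasurable) ?_
    filter_upwards [h.ae_tendsto_weights hα habar hA] with ω hω k hk hg hD
    have e := hω k hk hg hD
    have h1 := hg.sqrt_ρ_inv hr
    have h2 := hg.ρ
    have h3 := hg.sqrt_ρ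
    rw [LimitCov.gamma_zero] at h1 h2 h3
    exact h1.prodMk_nhds (h2.prodMk_nhds (h3.prodMk_nhds (e.fst_nhds.prodMk_nhds
      e.snd_nhds.snd_nhds)))
  -- Since `LM = ρ AR + √(1 - ρ²) LM*`, the difference `LM² - LM*²` is a multiple of `ρ`. The
  -- statistic therefore involves the second weight only through its product with the estimated `ρ`,
  -- which converges even where the weight does not.
  have key := h.tendstoInDistribution_AR_LM.continuous_comp_prodMk_of_tendstoInMeasure_const
    (g := fun p : (ℝ × ℝ) × (ℝ × ℝ × ℝ × ℝ × ℝ × ℝ) =>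
      (p.2.1 * (p.1.2 - p.2.2.1 * p.1.1)) ^ 2 +
        p.2.2.2.2.1 * (p.1.1 ^ 2 - (p.2.1 * (p.1.2 - p.2.2.1 * p.1.1)) ^ 2) +
        p.2.2.2.2.2.1 * (p.2.2.1 * p.1.1 ^ 2 +
          2 * p.2.2.2.1 * p.1.1 * (p.2.1 * (p.1.2 - p.2.2.1 * p.1.1)) -
          p.2.2.1 * (p.2.1 * (p.1.2 - p.2.2.1 * p.1.1)) ^ 2) - p.2.2.2.2.2.2) (by fun_prop) hu hmeas
  have hs : √(1 - S.ρ ^ 2) ≠ 0 := (Real.sqrt_pos.2 (by linarith [h.ρ_sq_lt])).ne'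
  have hZ : (fun z : ℝ × ℝ => z.2 ^ 2 - chiSqCrit α) = fun z =>
      ((√(1 - S.ρ ^ 2))⁻¹ * ((corrMap S.ρ z).2 - S.ρ * (corrMap S.ρ z).1)) ^ 2 +
        0 * ((corrMap S.ρ z).1 ^ 2 -
          ((√(1 - S.ρ ^ 2))⁻¹ * ((corrMap S.ρ z).2 - S.ρ * (corrMap S.ρ z).1)) ^ 2) +
        0 * (S.ρ * (corrMap S.ρ z).1 ^ 2 + 2 * √(1 - S.ρ ^ 2) * (corrMap S.ρ z).1 *
          ((√(1 - S.ρ ^ 2))⁻¹ * ((corrMap S.ρ z).2 - S.ρ * (corrMap S.ρ z).1)) -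
          S.ρ * ((√(1 - S.ρ ^ 2))⁻¹ * ((corrMap S.ρ z).2 - S.ρ * (corrMap S.ρ z).1)) ^ 2) -
        chiSqCrit α := by
    ext z
    simp only [corrMap, add_sub_cancel_left, inv_mul_cancel_left₀ hs]
    ring
  have hT (n : ℕ) : AEMeasurable (fun ω => (A n ω).1 * M.AR g n ω ^ 2 + (A n ω).2 * M.LM g n ω ^ 2
        + (1 - (A n ω).1 - (A n ω).2) * M.LMstar g n ω ^ 2 - critVal α (A n ω) (g n ω).ρ) P := by
    have h2 := hcrit n
    have h3 := (hA_meas n).fst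
    have h4 := (hA_meas n).snd
    have h5 := h.aemeasurable_AR n
    have h6 := h.aemeasurable_LM n
    have h7 := h.aemeasurable_LMstar n
    fun_prop
  rw [hZ]
  refine tendstoInDistribution_of_tendstoInMeasure_sub _ _ key ?_ hT
  refine h.tendstoInMeasure_of_forall
    (fun n => ((hT n).sub (key.forall_aemeasurable n)).aestronglyMeasurable)
    (ae_of_all _ fun ω k hk hg _ => ?_)
  -- The rewritten statistic equals the original one as soon as the estimated `ρ` satisfies `ρ² <
  -- 1`.
  refine (tendsto_const_nhds (x := (0 : ℝ))).congr' ?_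
  filter_upwards [hg.eventually_pos hr] with i hi
  have hp : 0 < 1 - (g (k i) ω).ρ ^ 2 := by linarith [hi.2.2]
  have hs' : √(1 - (g (k i) ω).ρ ^ 2) ≠ 0 := (Real.sqrt_pos.2 hp).ne'
  have hsq := Real.sq_sqrt hp.le
  simp only [Pi.sub_apply]
  have hLM : M.LM g (k i) ω = (g (k i) ω).ρ * M.AR g (k i) ω +
      √(1 - (g (k i) ω).ρ ^ 2) * M.LMstar g (k i) ω := by
    rw [LMstar]
    field_simp
    ring
  have hstar : (√(1 - (g (k i) ω).ρ ^ 2))⁻¹ * (M.LM g (k i) ω - (g (k i) ω).ρ * M.AR g (k i) ω) =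
    M.LMstar g (k i) ω := rfl
  rw [hstar, hLM]
  linear_combination (-(A (k i) ω).2 * M.LMstar g (k i) ω ^ 2) * hsq

lemma tendstoInDistribution_clcTest (h : M.LocalAlternatives B S g d Ct Δt)
    (hα : α ∈ Set.Ioo (0 : ℝ) 1) (habar : abar ∈ Set.Ioo (0 : ℝ) 1)
    (hA_meas : ∀ n, AEMeasurable (A n) P)
    (hA : ∀ n, ∀ᵐ ω ∂P, (M.feasible g α abar B s n ω).Nonempty →
      A n ω ∈ M.argminSet g α abar B s n ω) :
    TendstoInDistribution (M.clcTest g α A) atTop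
      ((chiRegion α).indicator (1 : ℝ × ℝ → ℝ)) (fun _ => P)
      (normalPair 0 (S.drift Ct Δt)) := by
  have hm : Measurable fun z : ℝ × ℝ => z.2 ^ 2 - chiSqCrit α := by fun_prop
  have key := tendstoInDistribution_comp_of_ae_continuousAt
    (h.tendstoInDistribution_statistic hα habar hA_meas hA) measurable_indicator_Ici (by
      refine measure_mono_null (t := {0}) (fun t ht => ?_) ?_
      · by_contra hne
        exact ht (continuousAt_indicator_Ici hne)
      · rw [Measure.map_apply hm (measurableSet_singleton 0)]
        exact normalPair_sub_chiSqCrit_eq α _ _)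
  simp_rw [indicator_Ici_eq_indicator_chiRegion] at key
  have hX : M.clcTest g α A = _ := funext fun n => funext fun ω => M.clcTest_eq g α A n ω
  rw [hX]
  exact key

lemma tendsto_integral_clcTest (h : M.LocalAlternatives B S g d Ct Δt)
    (hα : α ∈ Set.Ioo (0 : ℝ) 1) (habar : abar ∈ Set.Ioo (0 : ℝ) 1)
    (hA_meas : ∀ n, AEMeasurable (A n) P)
    (hA : ∀ n, ∀ᵐ ω ∂P, (M.feasible g α abar B s n ω).Nonempty →
      A n ω ∈ M.argminSet g α abar B s n ω) :
    Tendsto (fun n => ∫ ω, M.clcTest g α A n ω ∂P) atTop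
      (𝓝 ((normalPair 0 (S.drift Ct Δt)).real (chiRegion α))) := by
  rw [← integral_indicator_one (measurableSet_chiRegion α)]
  refine tendsto_integral_of_tendstoInDistribution
    (h.tendstoInDistribution_clcTest hα habar hA_meas hA) (fun n ω => ?_)
    (indicator_chiRegion_mem α)
  rw [clcTest_eq]
  exact indicator_Ici_mem _

end weights

/-- The limiting power of the orthogonalized test is the largest one among invariant and unbiased
tests. -/
lemma isLUB_power (h : M.LocalAlternatives B S g d Ct Δt) {α : ℝ} (hα : α ∈ Set.Ioo (0 : ℝ) 1) :
    IsLUB {l | ∃ φ ∈ invariantTests α S.ρ ∪ unbiasedTests α S.ρ,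
        Tendsto (fun n => ∫ ω, φ (M.AR g n ω, M.LM g n ω) ∂P) atTop (𝓝 l)}
      ((normalPair 0 (S.drift Ct Δt)).real (chiRegion α)) := by
  -- The supremum is attained: the orthogonalized test is itself invariant.
  refine IsGreatest.isLUB ⟨⟨orthTest α S.ρ, Or.inl (orthTest_mem_invariantTests hα h.ρ_sq_lt), ?_⟩,
    ?_⟩
  · have := h.tendsto_integral_levelTest (orthTest_mem_invariantTests hα h.ρ_sq_lt).1
    simp_rw [orthTest_corrMap h.ρ_sq_lt] at this
    rwa [integral_indicator_one (measurableSet_chiRegion α)] at this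
  · rintro l ⟨φ, hφ, hl⟩
    have hlev : IsLevelTest α S.ρ φ := hφ.elim And.left And.left
    rw [tendsto_nhds_unique hl (h.tendsto_integral_levelTest hlev)]
    exact integral_comp_corrMap_le hα h.ρ_sq_lt hφ _

end LocalAlternatives

end IVArray

end JackknifeCLC

open JackknifeCLC in
open Classical in
theorem theorem3 {Ω : Type*} [MeasurableSpace Ω] (P : Measure Ω) [IsProbabilityMeasure P]
    (M : IVArray Ω P)
    -- significance level, cap on the weights, parameter space
    (α : ℝ) (hα : α ∈ Set.Ioo (0 : ℝ) 1) (abar : ℝ) (habar : abar ∈ Set.Ioo (0 : ℝ) 1)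
    (B : Set ℝ) (hB : IsCompact B)
    (hBrich : ∃ r : ℝ, 0 < r ∧ ∀ n, Set.Icc (M.β₀ n) (M.β₀ n + r) ⊆ B ∨
      Set.Icc (M.β₀ n - r) (M.β₀ n) ⊆ B)
    -- joint weak convergence of the quadratic forms
    (S : LimitCov) (hS : S.mat.PosDef)
    (hweak : TendstoInDistribution
      (fun n ω => (!₂[M.Qee n ω, M.QXe n ω, M.QXX n ω - M.conc n] : EuclideanSpace ℝ (Fin 3)))
      atTop id (fun _ => P) (multivariateGaussian 0 S.mat))
    -- consistent estimators of the variance components at the tested value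
    (g : ℕ → Ω → VarComp) (hg_meas : ∀ n, AEMeasurable (fun ω => (g n ω).toVec) P)
    (hg : TendstoInMeasure P (fun n ω => (g n ω).toVec - (S.gamma (M.Δ n)).toVec) atTop
      (fun _ => 0))
    -- strong identification and local alternatives
    (d : ℕ → ℝ) (hd : Tendsto d atTop (𝓝 0)) (hd0 : ∀ᶠ n in atTop, d n ≠ 0)
    (Ct Δt : ℝ) (hCt : Ct ≠ 0)
    (hconc : ∀ᶠ n in atTop, M.conc n = Ct / d n)
    (hΔ : ∀ᶠ n in atTop, M.Δ n = Δt * d n)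
    -- the minimax weights
    (s : PlugIn) (A : ℕ → Ω → ℝ × ℝ) (hA_meas : ∀ n, AEMeasurable (A n) P)
    (hA : ∀ n, ∀ᵐ ω ∂P, (M.feasible g α abar B s n ω).Nonempty →
      A n ω ∈ M.argminSet g α abar B s n ω) :
    TendstoInMeasure P (fun n ω => (A n ω).1) atTop (fun _ => 0) ∧
    TendstoInMeasure P (fun n ω => (A n ω).2 * S.ρ) atTop (fun _ => 0) ∧
    TendstoInDistribution (M.clcTest g α A) atTop
      (fun x : ℝ => if chiSqCrit α ≤ x ^ 2 then (1 : ℝ) else 0) (fun _ => P)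
      (gaussianReal (Δt * Ct / √((1 - S.ρ ^ 2) * S.Ψ)) 1) ∧
    (∀ φ ∈ invariantTests α S.ρ ∪ unbiasedTests α S.ρ,
      ∃ l, Tendsto (fun n => ∫ ω, φ (M.AR g n ω, M.LM g n ω) ∂P) atTop (𝓝 l)) ∧
    ∃ L : ℝ,
      Tendsto (fun n => ∫ ω, M.clcTest g α A n ω ∂P) atTop (𝓝 L) ∧
      IsLUB {l | ∃ φ ∈ invariantTests α S.ρ ∪ unbiasedTests α S.ρ,
        Tendsto (fun n => ∫ ω, φ (M.AR g n ω, M.LM g n ω) ∂P) atTop (𝓝 l)} L ∧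
      ∀ φ ∈ invariantTests α S.ρ ∪ unbiasedTests α S.ρ, ∀ ψ : ℕ → Ω → ℝ,
        TendstoInMeasure P (fun n ω => ψ n ω - φ (M.AR g n ω, M.LM g n ω)) atTop (fun _ => 0) →
        UniformIntegrable ψ 1 P →
        ∃ l, Tendsto (fun n => ∫ ω, ψ n ω ∂P) atTop (𝓝 l) ∧ l ≤ L := by
  have h : M.LocalAlternatives B S g d Ct Δt :=
    ⟨hB, hBrich, hS, hweak, hg_meas, hg, hd, hd0, hCt, hconc, hΔ⟩
  have hlev (φ : ℝ × ℝ → ℝ) (hφ : φ ∈ invariantTests α S.ρ ∪ unbiasedTests α S.ρ) :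
      IsLevelTest α S.ρ φ := hφ.elim And.left And.left
  obtain ⟨h1, h2⟩ := h.tendstoInMeasure_weights hα habar hA_meas hA
  refine ⟨h1, h2, ?_, fun φ hφ => ⟨_, h.tendsto_integral_levelTest (hlev φ hφ)⟩,
    (normalPair 0 (S.drift Ct Δt)).real (chiRegion α),
    h.tendsto_integral_clcTest hα habar hA_meas hA, h.isLUB_power hα,
    fun φ hφ ψ hψ hui => ⟨_, ?_, integral_comp_corrMap_le hα h.ρ_sq_lt hφ _⟩⟩
  · have hm : Measurable fun x : ℝ => if chiSqCrit α ≤ x ^ 2 then (1 : ℝ) else 0 :=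
      Measurable.ite (measurableSet_le measurable_const (by fun_prop)) measurable_const
        measurable_const
    refine tendstoInDistribution_of_map_eq
      (h.tendstoInDistribution_clcTest hα habar hA_meas hA) hm.aemeasurable ?_
    -- The limit variable on `ℝ` is the second coordinate of the normal pair, the only one on which
    -- `chiRegion` depends.
    have hsnd : (normalPair 0 (S.drift Ct Δt)).map Prod.snd = gaussianReal (S.drift Ct Δt) 1 :=
      measurePreserving_snd.map_eq
    have hd : gaussianReal (Δt * Ct / √((1 - S.ρ ^ 2) * S.Ψ)) 1 =
        (normalPair 0 (S.drift Ct Δt)).map Prod.snd := hsnd.symm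
    rw [hd, Measure.map_map hm measurable_snd]
    congr 1
  · exact tendsto_integral_of_uniformIntegrable
      (fun n => ((hlev φ hφ).1.comp_aemeasurable
        ((h.aemeasurable_AR n).prodMk (h.aemeasurable_LM n))).aestronglyMeasurable)
      (fun _ _ => (hlev φ hφ).2.1 _) hui hψ (h.tendsto_integral_levelTest (hlev φ hφ))
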